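/- **Setting.** Let $q_0,q_1,q_2$ be the vertices of an equilateral triangle in the plane, $F_i(x)=\tfrac12(x-q_i)+q_i$, and let $SG$ be the Sierpinski gasket, the attractor of $F_0,F_1,F_2$. A cell of level $m$ is a set $F_{w_1}\cdots F_{w_m}(SG)$ with $w_1,\dots,w_m\in\{0,1,2\}$. Put $V_0=\{q_0,q_1,q_2\}$, $V_{m+1}=\bigcup_iF_iV_m$; two distinct points of $V_m$ are neighbours, $x\sim_m y$, if they lie in a common cell of level $m$. Let $\mu$ be the probability measure on $SG$ giving mass $3^{-m}$ to every cell of level $m$, and $\langle u,v\rangle=\int uv\,d\mu$. For continuous $u,f$ on $SG$ we say that $u$ is in the domain of the Laplacian and $\Delta u=f$ if $\tfrac32 5^m\sum_{y\sim_m x}(u(y)-u(x))$ converges to $f(x)$ as $m\to\infty$, uniformly over $x\in V_m\setminus V_0$. A function $u$ is harmonic if $\Delta u=0$. For $n\in\{0,1,2\}$, with indices mod 3, $$\partial_nu(q_n)=\lim_{m\to\infty}\left(\tfrac53\right)^m\big(2u(q_n)-u(F_n^mq_{n+1})-u(F_n^mq_{n-1})\big),\qquad \partial_Tu(q_n)=\lim_{m\to\infty}5^m\big(u(F_n^mq_{n+1})-u(F_n^mq_{n-1})\big).$$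 *Green's function.* For $z\in V_m$ let $\psi^{(m)}_z$ be the continuous function with $\psi_z^{(m)}(x)=\delta_{zx}$ for $x\in V_m$ which is harmonic on each cell of level $m$ (that is, its composition with each $F_{w_1}\cdots F_{w_m}$ is harmonic) and vanishes outside the level-$m$ cells containing $z$. Put $$G(x,y)=\lim_{M\to\infty}\sum_{m=0}^M\ \sum_{z,z'\in V_{m+1}\setminus V_m}g(z,z')\,\psi_z^{(m+1)}(x)\,\psi_{z'}^{(m+1)}(y),$$ where, for $z,z'\in V_{m+1}\setminus V_m$, $g(z,z)=\tfrac9{50}(\tfrac35)^m$, $g(z,z')=\tfrac3{50}(\tfrac35)^m$ if $z\ne z'$ lie in a common cell of level $m+1$, and $g(z,z')=0$ otherwise. *Orthogonal polynomials.* For $i\in\{1,2,3\}$ and $j\ge0$ the monomial $P_{ji}$ is the function with $\Delta^{j+1}P_{ji}=0$ and, for $0\le m\le j$, $$\Delta^mP_{ji}(q_0)=\delta_{mj}\delta_{i1},\qquad \partial_n\Delta^mP_{ji}(q_0)=\delta_{mj}\delta_{i2},\qquad \partial_T\Delta^mP_{ji}(q_0)=\delta_{mj}\delta_{i3}.$$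 Fix $i=3$ (the antisymmetric monomials) or $i=2$. Let $p_j=P_{ji}-\sum_{l<j}d_l^2\langle P_{ji},p_l\rangle p_l$ with $d_j=\|p_j\|_{L^2(\mu)}^{-1}$ be the Gram–Schmidt orthogonalization of $(P_{ji})_{j\ge0}$, and set $Q_j=d_jp_j$, $c_k=d_{k-1}^2/d_k^2$ for $k\ge1$, and $\tilde f_{k+1}(x)=-\int G(x,y)Q_k(y)\,d\mu(y)$ for $k\ge0$. **Theorem 3.7.** All these objects are well defined: the monomials $P_{ji}$ exist, $\|p_j\|_{L^2(\mu)}>0$, each $Q_k$ is in the domain of $\Delta$, the limit defining $G(x,y)$ exists for all $x,y\in SG$, and $y\mapsto G(x,y)Q_k(y)$ is $\mu$-integrable for every $x\in SG$ and $k\ge0$. For $N\ge0$ and $x,y\in SG$ let $K_N(x,y)=\sum_{k=0}^NQ_k(x)Q_k(y)$. Then $$K_N(x,y)=\sqrt{c_{N+1}}\,\big[Q_N(x)\,\Delta Q_{N+1}(y)-Q_{N+1}(x)\,\Delta Q_N(y)\big]+\sum_{k=0}^N\tilde f_{k+1}(x)\,\Delta Q_k(y).$$ In particular, for every $x\in SG$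 and $N\ge0$, $$K_N(x,x)=\sqrt{c_{N+1}}\,\big[Q_N(x)\,\Delta Q_{N+1}(x)-Q_{N+1}(x)\,\Delta Q_N(x)\big]+\sum_{k=0}^N\tilde f_{k+1}(x)\,\Delta Q_k(x).$$ -/

import Mathlib

namespace SierpinskiGasket

open MeasureTheory Filter Topology
open scoped Classical

noncomputable section

/-- The Euclidean plane. -/
abbrev Plane : Type := EuclideanSpace ℝ (Fin 2)

/-! ### The gasket, its cells and its vertices -/

/-- The contraction `x ↦ (x - q i) / 2 + q i` of the plane. -/
def contr (q : Fin 3 → Plane) (i : Fin 3) (x : Plane) : Plane :=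
  (1 / 2 : ℝ) • (x - q i) + q i

/-- The point with address `w`, i.e. `lim_m F_{w 0} ∘ ⋯ ∘ F_{w m} (x)` for any starting
point `x`; for these three maps it is the series `∑ 2^{-(k+1)} q_{w k}`. -/
def addr (q : Fin 3 → Plane) (w : ℕ → Fin 3) : Plane :=
  ∑' k : ℕ, (1 / 2 : ℝ) ^ (k + 1) • q (w k)

/-- The Sierpinski gasket: the attractor of the three contractions, as the set of all points
that have an address. See `gasket_nonempty`, `isCompact_gasket`, `gasket_eq_iUnion` below. -/
def gasket (q : Fin 3 → Plane) : Set Plane := Set.range (addr q)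

theorem norm_addr_term_le (q : Fin 3 → Plane) (k : ℕ) (w : ℕ → Fin 3) :
    ‖(1 / 2 : ℝ) ^ (k + 1) • q (w k)‖ ≤ (1 / 2 : ℝ) ^ k * (∑ i, ‖q i‖) := by
  rw [norm_smul, norm_pow]
  have h1 : ‖q (w k)‖ ≤ ∑ i, ‖q i‖ :=
    Finset.single_le_sum (f := fun i => ‖q i‖) (fun i _ => norm_nonneg _) (Finset.mem_univ (w k))
  have h2 : ‖(1 / 2 : ℝ)‖ ^ (k + 1) ≤ (1 / 2 : ℝ) ^ k := by
    rw [Real.norm_of_nonneg (by norm_num)]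
    exact pow_le_pow_of_le_one (by norm_num) (by norm_num) (Nat.le_succ k)
  exact mul_le_mul h2 h1 (norm_nonneg _) (by positivity)

theorem summable_addr_bound (q : Fin 3 → Plane) :
    Summable (fun k : ℕ => (1 / 2 : ℝ) ^ k * (∑ i, ‖q i‖)) :=
  (summable_geometric_of_lt_one (by norm_num) (by norm_num)).mul_right _

theorem summable_addr (q : Fin 3 → Plane) (w : ℕ → Fin 3) :
    Summable (fun k : ℕ => (1 / 2 : ℝ) ^ (k + 1) • q (w k)) :=
  Summable.of_norm_bounded (summable_addr_bound q) (fun k => norm_addr_term_le q k w)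

theorem continuous_addr (q : Fin 3 → Plane) : Continuous (addr q) := by
  refine continuous_tsum (fun k => ?_) (summable_addr_bound q) (fun k w => norm_addr_term_le q k w)
  have h : Continuous (fun w : ℕ → Fin 3 => q (w k)) :=
    (continuous_of_discreteTopology (f := q)).comp (continuous_apply k)
  exact h.const_smul ((1 / 2 : ℝ) ^ (k + 1))

/-- Prefixing an address by the letter `i` applies the contraction number `i`. -/
theorem contr_addr (q : Fin 3 → Plane) (i : Fin 3) (w : ℕ → Fin 3) :
    contr q i (addr q w) = addr q (fun k => Nat.casesOn k i w) := by
  unfold addr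
  rw [(summable_addr q (fun k => Nat.casesOn k i w)).tsum_eq_zero_add]
  have h : ∀ k : ℕ, (1 / 2 : ℝ) ^ (k + 1 + 1) • q (w k)
      = (1 / 2 : ℝ) • ((1 / 2 : ℝ) ^ (k + 1) • q (w k)) := by
    intro k
    rw [smul_smul, ← pow_succ']
  simp only [h]
  rw [(summable_addr q w).tsum_const_smul]
  unfold contr
  module

theorem contr_mem (q : Fin 3 → Plane) (i : Fin 3) {x : Plane} (hx : x ∈ gasket q) :
    contr q i x ∈ gasket q := by
  obtain ⟨w, rfl⟩ := hx
  exact ⟨_, (contr_addr q i w).symm⟩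

theorem vertex_mem (q : Fin 3 → Plane) (i : Fin 3) : q i ∈ gasket q := by
  refine ⟨fun _ => i, ?_⟩
  have h := contr_addr q i (fun _ => i)
  have e : (fun k : ℕ => (Nat.casesOn k i (fun _ => i) : Fin 3)) = fun _ => i := by
    funext k
    cases k <;> rfl
  rw [e] at h
  unfold contr at h
  have h2 : (1 / 2 : ℝ) • (addr q (fun _ => i) - q i) = 0 := by
    have h3 : (1 / 2 : ℝ) • (addr q (fun _ => i) - q i)
        = addr q (fun _ => i) - ((1 / 2 : ℝ) • (addr q (fun _ => i) - q i) + q i) := by module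
    rw [h3, h, sub_self]
  exact sub_eq_zero.mp ((smul_eq_zero_iff_right (by norm_num)).mp h2)

theorem gasket_nonempty (q : Fin 3 → Plane) : (gasket q).Nonempty := ⟨_, vertex_mem q 0⟩

theorem isCompact_gasket (q : Fin 3 → Plane) : IsCompact (gasket q) :=
  isCompact_range (continuous_addr q)

/-- The self-similar identity `SG = F_0 SG ∪ F_1 SG ∪ F_2 SG`. -/
theorem gasket_eq_iUnion (q : Fin 3 → Plane) : gasket q = ⋃ i, contr q i '' gasket q := by
  ext x
  simp only [Set.mem_iUnion, Set.mem_image]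
  constructor
  · rintro ⟨w, rfl⟩
    refine ⟨w 0, addr q (fun k => w (k + 1)), ⟨_, rfl⟩, ?_⟩
    rw [contr_addr]
    congr 1
    funext k
    cases k <;> rfl
  · rintro ⟨i, y, hy, rfl⟩
    exact contr_mem q i hy

/-- The gasket as a space. -/
abbrev SG (q : Fin 3 → Plane) : Type := gasket q

/-- The contractions as self-maps of the gasket. -/
def F (q : Fin 3 → Plane) (i : Fin 3) (x : SG q) : SG q := ⟨contr q i x, contr_mem q i x.2⟩

/-- The boundary points `q_0, q_1, q_2` as points of the gasket. -/
def bdry (q : Fin 3 → Plane) (i : Fin 3) : SG q := ⟨q i, vertex_mem q i⟩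

/-- `F_w = F_{w_1} ∘ ⋯ ∘ F_{w_m}` for a word `w = (w_1, …, w_m)`. -/
def Fw (q : Fin 3 → Plane) : List (Fin 3) → SG q → SG q
  | [] => id
  | i :: w => F q i ∘ Fw q w

/-- The cell `F_w SG`, of level `|w|`. -/
def cell (q : Fin 3 → Plane) (w : List (Fin 3)) : Set (SG q) := Set.range (Fw q w)

/-- `x` and `y` lie in a common cell of level `m`. -/
def SameCell (q : Fin 3 → Plane) (m : ℕ) (x y : SG q) : Prop :=
  ∃ w : List (Fin 3), w.length = m ∧ x ∈ cell q w ∧ y ∈ cell q w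

/-- The vertices of level `m`: `V_0 = {q_0, q_1, q_2}` and `V_{m+1} = ⋃_i F_i V_m`. -/
def V (q : Fin 3 → Plane) : ℕ → Finset (SG q)
  | 0 => Finset.univ.image (bdry q)
  | m + 1 => Finset.univ.biUnion fun i => (V q m).image (F q i)

/-! ### The Laplacian -/

/-- The graph Laplacian `Δ_m u (x) = ∑_{y ∼_m x} (u y - u x)`. -/
def graphLap (q : Fin 3 → Plane) (m : ℕ) (u : SG q → ℝ) (x : SG q) : ℝ :=
  ∑ y ∈ (V q m).filter (fun y => y ≠ x ∧ SameCell q m x y), (u y - u x)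

/-- `u` is in the domain of the Laplacian and `Δ u = f`: both functions are continuous, and
`(3/2) 5^m Δ_m u` converges to `f`, uniformly over the non-boundary vertices of level `m`. -/
def HasLaplacian (q : Fin 3 → Plane) (u f : SG q → ℝ) : Prop :=
  Continuous u ∧ Continuous f ∧
    ∀ ε : ℝ, 0 < ε → ∃ M : ℕ, ∀ m : ℕ, M ≤ m → ∀ x ∈ V q m \ V q 0,
      |(3 / 2 : ℝ) * 5 ^ m * graphLap q m u x - f x| < ε

/-- `u` belongs to the domain of the Laplacian. -/
def InDomain (q : Fin 3 → Plane) (u : SG q → ℝ) : Prop := ∃ f, HasLaplacian q u f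

/-- The Laplacian `Δ u`, with value `0` off its domain. -/
def lap (q : Fin 3 → Plane) (u : SG q → ℝ) : SG q → ℝ :=
  if h : InDomain q u then h.choose else 0

/-- Harmonic functions. -/
def Harmonic (q : Fin 3 → Plane) (u : SG q → ℝ) : Prop := HasLaplacian q u 0

/-- The space `H^j` of polynomials of degree at most `j`: solutions of `Δ^{j+1} u = 0`. -/
def IsPolynomial (q : Fin 3 → Plane) (j : ℕ) (u : SG q → ℝ) : Prop :=
  (∀ m ≤ j, InDomain q ((lap q)^[m] u)) ∧ (lap q)^[j + 1] u = 0

/-- The normal derivative of `u` at `q_n` exists and equals `a` (indices of boundary points are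
taken mod 3, as arithmetic in `Fin 3`). -/
def HasNormalDeriv (q : Fin 3 → Plane) (u : SG q → ℝ) (n : Fin 3) (a : ℝ) : Prop :=
  Tendsto (fun m : ℕ => (5 / 3 : ℝ) ^ m *
      (2 * u (bdry q n) - u ((F q n)^[m] (bdry q (n + 1))) - u ((F q n)^[m] (bdry q (n - 1)))))
    atTop (𝓝 a)

/-- The tangential derivative of `u` at `q_n` exists and equals `a`. -/
def HasTangentialDeriv (q : Fin 3 → Plane) (u : SG q → ℝ) (n : Fin 3) (a : ℝ) : Prop :=
  Tendsto (fun m : ℕ => (5 : ℝ) ^ m *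
      (u ((F q n)^[m] (bdry q (n + 1))) - u ((F q n)^[m] (bdry q (n - 1)))))
    atTop (𝓝 a)

/-! ### Monomials -/

/-- The conditions that define the monomial `P_{ji}^{(n)}`, for `i = 1, 2, 3`. -/
def IsMonomial (q : Fin 3 → Plane) (n : Fin 3) (j i : ℕ) (u : SG q → ℝ) : Prop :=
  IsPolynomial q j u ∧ ∀ m ≤ j,
    (lap q)^[m] u (bdry q n) = (if m = j ∧ i = 1 then 1 else 0) ∧
    HasNormalDeriv q ((lap q)^[m] u) n (if m = j ∧ i = 2 then 1 else 0) ∧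
    HasTangentialDeriv q ((lap q)^[m] u) n (if m = j ∧ i = 3 then 1 else 0)

/-- The monomial `P_{ji}^{(n)}`: the function with the defining property. -/
def monomial (q : Fin 3 → Plane) (n : Fin 3) (j i : ℕ) : SG q → ℝ :=
  Classical.epsilon (IsMonomial q n j i)

/-! ### The natural measure -/

/-- The address map into the gasket. -/
def addrSG (q : Fin 3 → Plane) (w : ℕ → Fin 3) : SG q := ⟨addr q w, w, rfl⟩

theorem measurable_addrSG (q : Fin 3 → Plane) : Measurable (addrSG q) :=
  (continuous_addr q).measurable.subtype_mk

/-- The natural probability measure on the gasket, which gives mass `3^{-m}` to every cell of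
level `m`: the law of a point whose address is a sequence of independent uniform letters. -/
def mu (q : Fin 3 → Plane) : Measure (SG q) :=
  (Measure.infinitePi (fun _ : ℕ => (PMF.uniformOfFintype (Fin 3)).toMeasure)).map (addrSG q)

instance instIsProbabilityMeasureMu (q : Fin 3 → Plane) : IsProbabilityMeasure (mu q) :=
  Measure.isProbabilityMeasure_map (measurable_addrSG q).aemeasurable

/-- The inner product `⟨u, v⟩ = ∫ u v dμ`. -/
def ip (q : Fin 3 → Plane) (u v : SG q → ℝ) : ℝ := ∫ x, u x * v x ∂(mu q)

/-! ### Green's function -/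

/-- `u` is the piecewise harmonic function of level `m` that equals `1` at `z`, equals `0` at
every other vertex of level `m`, and vanishes outside the cells of level `m` that contain `z`. -/
def IsTent (q : Fin 3 → Plane) (m : ℕ) (z : SG q) (u : SG q → ℝ) : Prop :=
  Continuous u ∧
  (∀ w : List (Fin 3), w.length = m → Harmonic q (u ∘ Fw q w)) ∧
  (∀ x ∈ V q m, u x = if x = z then 1 else 0) ∧
  (∀ x, ¬ SameCell q m z x → u x = 0)

/-- The function `ψ_z^{(m)}`, for `z ∈ V_m`. -/
def psi (q : Fin 3 → Plane) (m : ℕ) (z : SG q) : SG q → ℝ :=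
  Classical.epsilon (IsTent q m z)

/-- The coefficients `g(z, z')` for `z, z' ∈ V_{m+1} \ V_m`. -/
def greenCoeff (q : Fin 3 → Plane) (m : ℕ) (z z' : SG q) : ℝ :=
  if z = z' then 9 / 50 * (3 / 5) ^ m
  else if SameCell q (m + 1) z z' then 3 / 50 * (3 / 5) ^ m
  else 0

/-- The partial sums `G_M(x, y)`. -/
def greenPartial (q : Fin 3 → Plane) (M : ℕ) (x y : SG q) : ℝ :=
  ∑ m ∈ Finset.range (M + 1), ∑ z ∈ V q (m + 1) \ V q m, ∑ z' ∈ V q (m + 1) \ V q m,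
    greenCoeff q m z z' * psi q (m + 1) z x * psi q (m + 1) z' y

/-- Green's function `G(x, y) = lim_M G_M(x, y)`. -/
def green (q : Fin 3 → Plane) (x y : SG q) : ℝ :=
  limUnder atTop (fun M : ℕ => greenPartial q M x y)

/-! ### Orthogonal polynomials -/

/-- The Gram–Schmidt process (without normalization) in `L²(μ)`:
`p_j = P_j - ∑_{l < j} ‖p_l‖⁻² ⟨P_j, p_l⟩ p_l`. -/
def gramSchmidtSeq (q : Fin 3 → Plane) (P : ℕ → SG q → ℝ) (j : ℕ) : SG q → ℝ := fun x =>
  P j x - ∑ l : Fin j,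
    ip q (P j) (gramSchmidtSeq q P l) / ip q (gramSchmidtSeq q P l) (gramSchmidtSeq q P l)
      * gramSchmidtSeq q P l x
termination_by j
decreasing_by all_goals exact l.2

/-- The monic orthogonal polynomials `p_j`, obtained from the monomials `P_{ji} = P_{ji}^{(0)}`,
`j = 0, 1, 2, …`, for a fixed `i`. -/
def monicOP (q : Fin 3 → Plane) (i : ℕ) : ℕ → SG q → ℝ :=
  gramSchmidtSeq q (fun j => monomial q 0 j i)

/-- `d_j = ‖p_j‖⁻¹`. -/
def dCoeff (q : Fin 3 → Plane) (i j : ℕ) : ℝ :=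
  (Real.sqrt (ip q (monicOP q i j) (monicOP q i j)))⁻¹

/-- The orthonormal polynomials `Q_j = d_j p_j`. -/
def Q (q : Fin 3 → Plane) (i j : ℕ) (x : SG q) : ℝ := dCoeff q i j * monicOP q i j x

/-- `c_k = d_{k-1}² / d_k²` for `k ≥ 1` (the value at `k = 0` plays no role). -/
def cCoeff (q : Fin 3 → Plane) (i : ℕ) : ℕ → ℝ
  | 0 => 0
  | k + 1 => dCoeff q i k ^ 2 / dCoeff q i (k + 1) ^ 2

/-- The auxiliary polynomials: `f̃_0 = 0` and `f̃_{k+1}(x) = - ∫ G(x, y) Q_k(y) dμ(y)`. -/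
def fTilde (q : Fin 3 → Plane) (i : ℕ) : ℕ → SG q → ℝ
  | 0 => fun _ => 0
  | k + 1 => fun x => - ∫ y, green q x y * Q q i k y ∂(mu q)

/-- The kernel `K_N(x, y) = ∑_{k ≤ N} Q_k(x) Q_k(y)`. -/
def K (q : Fin 3 → Plane) (i N : ℕ) (x y : SG q) : ℝ :=
  ∑ k ∈ Finset.range (N + 1), Q q i k x * Q q i k y

end

end SierpinskiGasket

namespace SierpinskiGasket

open MeasureTheory Filter Topology
open scoped Classical

noncomputable section

section

/-! ### Geometry of the gasket -/

/-! Let `sol q f` be the solution of `-Δu = f` with zero boundary values. The theorem is a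
Christoffel–Darboux formula for the operator `f ↦ -sol q f`, which plays the role of multiplication
by the variable. This operator maps the monomial of degree `j` to the one of degree `j+1` plus a
multiple of the one of degree `0`, so it raises degree by one and keeps the leading coefficient. Its
integral kernel is minus Green's function, which is symmetric. Hence its matrix `jac` in the
orthonormal polynomials is symmetric and tridiagonal, with off-diagonal entries `‖p_{k+1}‖ / ‖p_k‖ =
√c_{k+1}` (`jac_symm`, `jac_eq_zero`, `jac_succ`).

Write `J` for this matrix. The expansion `-sol Q_k = ∑ J_{kl} Q_l` is the expansion of `f̃_{k+1}`;
applying `Δ` to it gives `Q_k = ∑ J_{kl} ΔQ_l`. Insert the second into `K_N(x,y)` and the first into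
`∑ f̃_{k+1}(x) ΔQ_k(y)`. The parts with both indices at most `N` agree by symmetry of `J`; what
remains on each side is the single entry `J_{N,N+1}`, and these two terms form the bracket
(`sum_onp_mul_onp`).

The rest is analysis from scratch for the pointwise Laplacian. Harmonic functions come from the
1/5–2/5 rule, and `sol` from the self-similar recursion: on each first-level cell it is a harmonic
function plus `1/5` of the solution for the restricted right-hand side. An exact discrete
Gauss–Green formula (`ndiff_sol`) shows that `-sol q f` has Laplacian `f`, and a maximum principle
gives uniqueness. Green's operator satisfies the same recursion and is bounded, so it equals `sol`
(`integral_green`).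

The objects of the statement that are picked by choice (Laplacian, monomials, tents) are then
identified by existence and uniqueness. For monomials, uniqueness holds because value, normal and
tangential derivative at `q_0` determine a harmonic function. Existence uses reflection symmetry,
which makes one of the two derivatives vanish identically, and the decay of the monomials towards
`q_0`, which makes the tangential derivative converge. -/

/-- The three points are the vertices of an equilateral triangle. -/
class Equilateral (q : Fin 3 → Plane) : Prop where
  exists_dist : ∃ s : ℝ, 0 < s ∧ ∀ a b : Fin 3, a ≠ b → dist (q a) (q b) = s

/-- The side length. -/
def side (q : Fin 3 → Plane) : ℝ := dist (q 0) (q 1)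

/-- The barycentric coordinates of an equilateral triangle. -/
def bary (q : Fin 3 → Plane) (i : Fin 3) (x : Plane) : ℝ :=
  1 / 3 + 2 / side q ^ 2 *
    inner ℝ (x - (1 / 3 : ℝ) • (q 0 + q 1 + q 2)) (q i - (1 / 3 : ℝ) • (q 0 + q 1 + q 2))

variable {q : Fin 3 → Plane}

theorem continuous_bary (i : Fin 3) : Continuous (bary q i) := by
  unfold bary
  fun_prop

theorem dist_vertices [h : Equilateral q] {a b : Fin 3} (hab : a ≠ b) :
    dist (q a) (q b) = side q := by
  obtain ⟨s, -, hs⟩ := h.exists_dist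
  rw [side, hs a b hab, hs 0 1 (by decide)]

theorem side_pos [h : Equilateral q] : 0 < side q := by
  obtain ⟨s, hs0, hs⟩ := h.exists_dist
  rw [side, hs 0 1 (by decide)]
  exact hs0

theorem sum_bary (x : Plane) : ∑ i, bary q i x = 1 := by
  unfold bary
  rw [Finset.sum_add_distrib, ← Finset.mul_sum, ← inner_sum, Fin.sum_univ_three]
  have h : q 0 - (1 / 3 : ℝ) • (q 0 + q 1 + q 2) + (q 1 - (1 / 3 : ℝ) • (q 0 + q 1 + q 2)) +
      (q 2 - (1 / 3 : ℝ) • (q 0 + q 1 + q 2)) = 0 := by module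
  rw [Fin.sum_univ_three, h, inner_zero_right]
  norm_num

theorem bary_vertex [Equilateral q] (i j : Fin 3) :
    bary q i (q j) = if i = j then 1 else 0 := by
  have hs := side_pos (q := q)
  -- Inner products of vertices measured from the centroid, for an arbitrary labelling; the centroid
  -- is symmetric, so three cyclic labellings cover all pairs.
  have key : ∀ a b c : Plane, dist a b = side q → dist b c = side q → dist a c = side q →
      inner ℝ (a - (1 / 3 : ℝ) • (a + b + c)) (a - (1 / 3 : ℝ) • (a + b + c)) = side q ^ 2 / 3 ∧
      inner ℝ (a - (1 / 3 : ℝ) • (a + b + c)) (b - (1 / 3 : ℝ) • (a + b + c)) = -side q ^ 2 / 6 := by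
    intro a b c h1 h2 h3
    set u := a - b
    set v := a - c
    have hu : inner ℝ u u = side q ^ 2 := by
      rw [real_inner_self_eq_norm_sq, ← h1, dist_eq_norm]
    have hv : inner ℝ v v = side q ^ 2 := by
      rw [real_inner_self_eq_norm_sq, ← h3, dist_eq_norm]
    have huv : inner ℝ (v - u) (v - u) = side q ^ 2 := by
      have e : v - u = b - c := by simp only [u, v]; abel
      rw [real_inner_self_eq_norm_sq, ← h2, dist_eq_norm, e]
    have e1 : a - (1 / 3 : ℝ) • (a + b + c) = (1 / 3 : ℝ) • (u + v) := by
      simp only [u, v]; module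
    have e2 : b - (1 / 3 : ℝ) • (a + b + c) = (1 / 3 : ℝ) • (v - u - u) := by
      simp only [u, v]; module
    rw [e1, e2]
    simp only [inner_sub_left, inner_sub_right, inner_add_left, inner_add_right,
      real_inner_smul_left, real_inner_smul_right] at *
    have hc := real_inner_comm u v
    constructor <;> linarith
  have d : ∀ {a b : Fin 3}, a ≠ b → dist (q a) (q b) = side q := fun h => dist_vertices h
  have hss : 2 / side q ^ 2 * (side q ^ 2 / 3) = 2 / 3 := by field_simp
  have hss' : 2 / side q ^ 2 * (-side q ^ 2 / 6) = -1 / 3 := by field_simp; norm_num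
  have p1 : q 0 + q 1 + q 2 = q 0 + q 2 + q 1 := by abel
  have p2 : q 0 + q 1 + q 2 = q 1 + q 0 + q 2 := by abel
  have p3 : q 0 + q 1 + q 2 = q 1 + q 2 + q 0 := by abel
  have p4 : q 0 + q 1 + q 2 = q 2 + q 0 + q 1 := by abel
  have p5 : q 0 + q 1 + q 2 = q 2 + q 1 + q 0 := by abel
  unfold bary
  have k1 := key (q 0) (q 1) (q 2) (d (by decide)) (d (by decide)) (d (by decide))
  have k2 := key (q 1) (q 2) (q 0) (d (by decide)) (d (by decide)) (d (by decide))
  have k3 := key (q 2) (q 0) (q 1) (d (by decide)) (d (by decide)) (d (by decide))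
  rw [← p3] at k2
  rw [← p4] at k3
  fin_cases i <;> fin_cases j <;> simp only [Fin.zero_eta, Fin.mk_one, Fin.reduceFinMk, if_true,
    Fin.reduceEq, if_false, zero_ne_one, one_ne_zero]
  · rw [k1.1, hss]; norm_num
  · rw [real_inner_comm, k1.2, hss']; norm_num
  · rw [k3.2, hss']; norm_num
  · rw [k1.2, hss']; norm_num
  · rw [k2.1, hss]; norm_num
  · rw [real_inner_comm, k2.2, hss']; norm_num
  · rw [real_inner_comm, k3.2, hss']; norm_num
  · rw [k2.2, hss']; norm_num
  · rw [k3.1, hss]; norm_num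

theorem bary_contr [Equilateral q] (i j : Fin 3) (x : Plane) :
    bary q i (contr q j x) = (bary q i x + if i = j then 1 else 0) / 2 := by
  rw [← bary_vertex (q := q) i j]
  unfold bary contr
  have e : (1 / 2 : ℝ) • (x - q j) + q j - (1 / 3 : ℝ) • (q 0 + q 1 + q 2)
    = (1 / 2 : ℝ) • ((x - (1 / 3 : ℝ) • (q 0 + q 1 + q 2)) +
      (q j - (1 / 3 : ℝ) • (q 0 + q 1 + q 2))) := by module
  rw [e, real_inner_smul_left, inner_add_left]
  ring

instance instCompactSpaceSG : CompactSpace (SG q) :=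
  isCompact_iff_compactSpace.mp (isCompact_gasket q)

instance instNonemptySG : Nonempty (SG q) := ⟨bdry q 0⟩

theorem exists_F (x : SG q) : ∃ (i : Fin 3) (y : SG q), x = F q i y := by
  have hx := (gasket_eq_iUnion q).subset x.2
  simp only [Set.mem_iUnion, Set.mem_image] at hx
  obtain ⟨i, y, hy, h⟩ := hx
  exact ⟨i, ⟨y, hy⟩, Subtype.ext h.symm⟩

theorem dist_F (i : Fin 3) (x y : SG q) : dist (F q i x) (F q i y) = dist x y / 2 := by
  rw [Subtype.dist_eq, Subtype.dist_eq, F, F]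
  simp only [contr, dist_eq_norm]
  have e : (1 / 2 : ℝ) • ((x : Plane) - q i) + q i - ((1 / 2 : ℝ) • ((y : Plane) - q i) + q i)
    = (1 / 2 : ℝ) • ((x : Plane) - y) := by module
  rw [e, norm_smul]
  norm_num
  ring

theorem F_injective (i : Fin 3) : Function.Injective (F q i) := by
  intro x y h
  have h2 := dist_F i x y
  rw [h, dist_self] at h2
  exact dist_le_zero.mp (by linarith)

@[fun_prop]
theorem continuous_F (i : Fin 3) : Continuous (F q i) := by
  refine Continuous.subtype_mk ?_ _
  unfold contr
  fun_prop

/-- The barycentric coordinates as functions on the gasket. -/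
def lam (q : Fin 3 → Plane) (i : Fin 3) (x : SG q) : ℝ := bary q i x

theorem continuous_lam (i : Fin 3) : Continuous (lam q i) :=
  (continuous_bary i).comp continuous_subtype_val

theorem sum_lam (x : SG q) : ∑ i, lam q i x = 1 := sum_bary _

theorem lam_bdry [Equilateral q] (i j : Fin 3) :
    lam q i (bdry q j) = if i = j then 1 else 0 := bary_vertex i j

theorem lam_F [Equilateral q] (i j : Fin 3) (x : SG q) :
    lam q i (F q j x) = (lam q i x + if i = j then 1 else 0) / 2 := bary_contr i j x

/-- At a minimum point `F_j y` self-similarity gives `min ≥ min / 2`, so the minimum, attained by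
compactness, is nonnegative. Comparing an extremal point with its preimage in a cell is the standard
device for facts about the gasket here. -/
theorem lam_nonneg [Equilateral q] (i : Fin 3) (x : SG q) : 0 ≤ lam q i x := by
  obtain ⟨m, -, hm⟩ := isCompact_univ.exists_isMinOn Set.univ_nonempty
    (continuous_lam (q := q) i).continuousOn
  have hm' : ∀ y, lam q i m ≤ lam q i y := fun y => hm (Set.mem_univ y)
  obtain ⟨j, y, rfl⟩ := exists_F m
  have h1 := hm' y
  have h2 := hm' x
  rw [lam_F] at *
  split_ifs at * <;> linarith

theorem lam_le_one [Equilateral q] (i : Fin 3) (x : SG q) : lam q i x ≤ 1 := by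
  rw [← sum_lam x]
  exact Finset.single_le_sum (f := fun i => lam q i x) (fun j _ => lam_nonneg j x)
    (Finset.mem_univ i)

theorem F_bdry_self (i : Fin 3) : F q i (bdry q i) = bdry q i := by
  apply Subtype.ext
  simp [F, bdry, contr]

theorem F_bdry_comm (i j : Fin 3) : F q i (bdry q j) = F q j (bdry q i) := by
  apply Subtype.ext
  simp only [F, bdry, contr]
  module

/-- The point of the level set farthest from `q_i` lies in cell `i`, and its preimage is in the
level set and twice as far away; so the largest distance is zero. -/
theorem eq_bdry_of_lam [Equilateral q] (i : Fin 3) (x : SG q) (h : lam q i x = 1) :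
    x = bdry q i := by
  have hc : IsCompact {x : SG q | lam q i x = 1} :=
    (isClosed_eq (continuous_lam i) continuous_const).isCompact
  obtain ⟨m, hm1, hm⟩ := hc.exists_isMaxOn ⟨x, h⟩
    (f := fun y => dist y (bdry q i)) (by fun_prop)
  obtain ⟨j, y, rfl⟩ := exists_F m
  have h1 : lam q i (F q j y) = 1 := hm1
  rw [lam_F] at h1
  have h2 := lam_le_one i y
  have hij : i = j := by
    by_contra hne
    rw [if_neg hne] at h1
    linarith
  subst hij
  have h3 : lam q i y = 1 := by
    rw [if_pos rfl] at h1
    linarith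
  have h4 : dist y (bdry q i) ≤ dist (F q i y) (bdry q i) := hm h3
  have h5 : dist x (bdry q i) ≤ dist (F q i y) (bdry q i) := hm h
  have h6 := dist_F i y (bdry q i)
  rw [F_bdry_self] at h6
  exact dist_le_zero.mp (by linarith)

/-- The `i`-th coordinate is at least `1/2` on cell `i` and at most `1/2` on cell `j`; a common
point therefore attains the extremal values, and these occur only at vertices. -/
theorem F_eq_F [Equilateral q] {i j : Fin 3} (hij : i ≠ j) {x y : SG q}
    (h : F q i x = F q j y) : x = bdry q j ∧ y = bdry q i := by
  have h1 := congrArg (lam q i) h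
  have h2 := congrArg (lam q j) h
  rw [lam_F, lam_F, if_pos rfl, if_neg hij] at h1
  rw [lam_F, lam_F, if_pos rfl, if_neg hij.symm] at h2
  have := lam_le_one i y
  have := lam_le_one j x
  have := lam_nonneg i x
  have := lam_nonneg j y
  exact ⟨eq_bdry_of_lam _ _ (by linarith), eq_bdry_of_lam _ _ (by linarith)⟩

theorem bdry_injective [Equilateral q] : Function.Injective (bdry q) := by
  intro i j h
  have h1 := congrArg (lam q i) h
  rw [lam_bdry, lam_bdry, if_pos rfl] at h1
  by_contra hne
  rw [if_neg hne] at h1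
  norm_num at h1

theorem F_eq_bdry [Equilateral q] {i j : Fin 3} {x : SG q} (h : F q i x = bdry q j) :
    i = j ∧ x = bdry q j := by
  rw [← F_bdry_self j] at h
  by_cases hij : i = j
  · subst hij
    exact ⟨rfl, F_injective i h⟩
  · exact absurd (bdry_injective (F_eq_F hij h).2) (fun e => hij e.symm)

theorem iterate_F_bdry_self (i : Fin 3) (m : ℕ) : (F q i)^[m] (bdry q i) = bdry q i :=
  Function.iterate_fixed (F_bdry_self i) m

/-! ### Gluing -/

/-- The function whose composition with the `i`-th contraction is `g i`. -/
def glue (g : Fin 3 → SG q → ℝ) (x : SG q) : ℝ :=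
  g (exists_F x).choose (exists_F x).choose_spec.choose

/-- Distinct cells share only the point `F_i q_j = F_j q_i`, so agreement there makes the chosen
preimage irrelevant. -/
theorem glue_F [Equilateral q] {g : Fin 3 → SG q → ℝ}
    (h : ∀ i j, g i (bdry q j) = g j (bdry q i)) (i : Fin 3) (x : SG q) :
    glue g (F q i x) = g i x := by
  have key : ∀ j y, F q i x = F q j y → g j y = g i x := by
    intro j y hs
    by_cases hij : i = j
    · subst hij
      rw [F_injective i hs]
    · obtain ⟨h1, h2⟩ := F_eq_F hij hs
      rw [h1, h2]
      exact h j i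
  exact key _ _ (exists_F (F q i x)).choose_spec.choose_spec

/-- By compactness the map from three disjoint copies of the gasket onto the gasket is closed, hence
a quotient map. -/
theorem continuous_of_comp_F {X : Type*} [TopologicalSpace X] {u : SG q → X}
    (h : ∀ i, Continuous fun x => u (F q i x)) : Continuous u := by
  let Φ : Fin 3 × SG q → SG q := fun p => F q p.1 p.2
  have hΦ : Continuous Φ := continuous_prod_of_discrete_left.mpr fun i => continuous_F i
  have hs : Function.Surjective Φ := fun x => by
    obtain ⟨i, y, rfl⟩ := exists_F x
    exact ⟨(i, y), rfl⟩
  have hq : IsQuotientMap Φ := hΦ.isClosedMap.isQuotientMap hΦ hs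
  exact hq.continuous_iff.mpr (continuous_prod_of_discrete_left.mpr h)

/-! ### Cells -/

theorem Fw_replicate (m : ℕ) (i : Fin 3) (x : SG q) :
    Fw q (List.replicate m i) x = (F q i)^[m] x := by
  induction m with
  | zero => rfl
  | succ m ih => rw [Function.iterate_succ_apply', ← ih]; rfl

@[fun_prop]
theorem continuous_Fw (w : List (Fin 3)) : Continuous (Fw q w) := by
  induction w with
  | nil => exact continuous_id
  | cons i w ih => exact (continuous_F i).comp ih

theorem dist_Fw (w : List (Fin 3)) (x y : SG q) :
    dist (Fw q w x) (Fw q w y) = dist x y / 2 ^ w.length := by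
  induction w with
  | nil => simp [Fw]
  | cons i w ih =>
    simp only [Fw, Function.comp_apply, dist_F, ih, List.length_cons, pow_succ]
    ring

theorem exists_Fw (m : ℕ) (x : SG q) :
    ∃ (w : List (Fin 3)) (y : SG q), w.length = m ∧ x = Fw q w y := by
  induction m generalizing x with
  | zero => exact ⟨[], x, rfl, rfl⟩
  | succ m ih =>
    obtain ⟨i, y, rfl⟩ := exists_F x
    obtain ⟨w, z, hw, rfl⟩ := ih y
    exact ⟨i :: w, z, by simp [hw], rfl⟩

theorem exists_dist_le (q : Fin 3 → Plane) : ∃ C : ℝ, 0 < C ∧ ∀ x y : SG q, dist x y ≤ C := by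
  obtain ⟨C, hC⟩ := Metric.isBounded_iff.mp (isCompact_univ (X := SG q)).isBounded
  exact ⟨max C 1, by positivity, fun x y =>
    (hC (Set.mem_univ x) (Set.mem_univ y)).trans (le_max_left _ _)⟩

/-- A continuous function oscillates little on cells of high level. -/
theorem exists_level_osc_le {f : SG q → ℝ} (hf : Continuous f) {ε : ℝ} (hε : 0 < ε) :
    ∃ M : ℕ, ∀ w : List (Fin 3), M ≤ w.length → ∀ x y, |f (Fw q w x) - f (Fw q w y)| < ε := by
  have huc := CompactSpace.uniformContinuous_of_continuous hf
  obtain ⟨δ, hδ, h⟩ := Metric.uniformContinuous_iff.mp huc ε hε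
  obtain ⟨C, hC, hd⟩ := exists_dist_le q
  obtain ⟨M, hM⟩ := exists_pow_lt_of_lt_one (div_pos hδ hC) (by norm_num : (1 / 2 : ℝ) < 1)
  refine ⟨M, fun w hw x y => h ?_⟩
  rw [dist_Fw]
  have h1 : (1 / 2 : ℝ) ^ w.length ≤ (1 / 2) ^ M :=
    pow_le_pow_of_le_one (by norm_num) (by norm_num) hw
  have h2 : (1 / 2 : ℝ) ^ w.length < δ / C := h1.trans_lt hM
  rw [lt_div_iff₀ hC] at h2
  have h3 := hd x y
  calc dist x y / 2 ^ w.length = (1 / 2 : ℝ) ^ w.length * dist x y := by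
        rw [one_div, inv_pow]; ring
    _ ≤ (1 / 2 : ℝ) ^ w.length * C := by gcongr
    _ < δ := h2

end

section

variable {q : Fin 3 → Plane}

/-! ### Vertices and neighbours -/

theorem mem_V_zero {x : SG q} : x ∈ V q 0 ↔ ∃ i, bdry q i = x := by
  simp [V]

theorem mem_V_succ {m : ℕ} {x : SG q} : x ∈ V q (m + 1) ↔ ∃ i, ∃ y ∈ V q m, F q i y = x := by
  simp [V]

theorem F_mem_V {m : ℕ} {x : SG q} (i : Fin 3) (h : x ∈ V q m) : F q i x ∈ V q (m + 1) :=
  mem_V_succ.mpr ⟨i, x, h, rfl⟩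

theorem bdry_mem_V (m : ℕ) (i : Fin 3) : bdry q i ∈ V q m := by
  induction m with
  | zero => exact mem_V_zero.mpr ⟨i, rfl⟩
  | succ m ih =>
    rw [← F_bdry_self i]
    exact F_mem_V i ih

theorem V_zero_subset (m : ℕ) : V q 0 ⊆ V q m := by
  intro x hx
  obtain ⟨i, rfl⟩ := mem_V_zero.mp hx
  exact bdry_mem_V m i

theorem V_subset_succ (m : ℕ) : V q m ⊆ V q (m + 1) := by
  induction m with
  | zero => exact V_zero_subset 1
  | succ m ih =>
    intro x hx
    obtain ⟨i, y, hy, rfl⟩ := mem_V_succ.mp hx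
    exact F_mem_V i (ih hy)

theorem V_mono : Monotone (V q) := monotone_nat_of_le_succ V_subset_succ

theorem F_mem_V_iff [Equilateral q] {m : ℕ} {x : SG q} {i : Fin 3} :
    F q i x ∈ V q (m + 1) ↔ x ∈ V q m := by
  refine ⟨fun h => ?_, F_mem_V i⟩
  obtain ⟨j, y, hy, hxy⟩ := mem_V_succ.mp h
  by_cases hij : j = i
  · subst hij
    rwa [← F_injective j hxy]
  · rw [(F_eq_F hij hxy).2]
    exact bdry_mem_V m j

theorem F_notMem_V_zero [Equilateral q] {x : SG q} {i : Fin 3} (h : x ∉ V q 0) :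
    F q i x ∉ V q 0 := by
  intro hx
  obtain ⟨j, hj⟩ := mem_V_zero.mp hx
  exact h (mem_V_zero.mpr ⟨j, (F_eq_bdry hj.symm).2.symm⟩)

theorem F_bdry_notMem_V_zero [Equilateral q] {i j : Fin 3} (h : i ≠ j) :
    F q i (bdry q j) ∉ V q 0 := by
  intro hx
  obtain ⟨k, hk⟩ := mem_V_zero.mp hx
  obtain ⟨h1, h2⟩ := F_eq_bdry hk.symm
  exact h (h1.trans (bdry_injective h2).symm)

/-- A non-boundary vertex comes from a non-boundary vertex or is a midpoint. -/
theorem interior_cases {m : ℕ} {x : SG q} (h : x ∈ V q (m + 1) \ V q 0) :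
    (∃ i, ∃ y ∈ V q m \ V q 0, x = F q i y) ∨ ∃ i j, i ≠ j ∧ x = F q i (bdry q j) := by
  obtain ⟨hx, h0⟩ := Finset.mem_sdiff.mp h
  obtain ⟨i, y, hy, rfl⟩ := mem_V_succ.mp hx
  by_cases hy0 : y ∈ V q 0
  · obtain ⟨j, rfl⟩ := mem_V_zero.mp hy0
    refine Or.inr ⟨i, j, ?_, rfl⟩
    rintro rfl
    rw [F_bdry_self] at h0
    exact h0 (bdry_mem_V 0 i)
  · exact Or.inl ⟨i, y, Finset.mem_sdiff.mpr ⟨hy, hy0⟩, rfl⟩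

theorem F_mem_interior [Equilateral q] {m : ℕ} {x : SG q} (i : Fin 3) (h : x ∈ V q m \ V q 0) :
    F q i x ∈ V q (m + 1) \ V q 0 := by
  obtain ⟨h1, h2⟩ := Finset.mem_sdiff.mp h
  exact Finset.mem_sdiff.mpr ⟨F_mem_V i h1, F_notMem_V_zero h2⟩

theorem Fw_mem_interior [Equilateral q] {m : ℕ} {x : SG q} (w : List (Fin 3))
    (h : x ∈ V q m \ V q 0) : Fw q w x ∈ V q (m + w.length) \ V q 0 := by
  induction w with
  | nil => exact h
  | cons i w ih => exact F_mem_interior i ih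

theorem Fw_bdry_mem_V (w : List (Fin 3)) (i : Fin 3) : Fw q w (bdry q i) ∈ V q w.length := by
  induction w with
  | nil => exact bdry_mem_V 0 i
  | cons j w ih => exact F_mem_V j ih

theorem exists_interior_dist_lt [Equilateral q] (x : SG q) {ε : ℝ} (hε : 0 < ε) :
    ∃ m, ∃ y ∈ V q m \ V q 0, dist x y < ε := by
  obtain ⟨C, hC, hd⟩ := exists_dist_le q
  obtain ⟨M, hM⟩ := exists_pow_lt_of_lt_one (div_pos hε hC) (by norm_num : (1 / 2 : ℝ) < 1)
  obtain ⟨w, y, hw, rfl⟩ := exists_Fw M x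
  refine ⟨1 + w.length, Fw q w (F q 0 (bdry q 1)), Fw_mem_interior w ?_, ?_⟩
  · exact Finset.mem_sdiff.mpr ⟨F_mem_V 0 (bdry_mem_V 0 1), F_bdry_notMem_V_zero (by decide)⟩
  · rw [dist_Fw, hw]
    rw [lt_div_iff₀ hC, one_div, inv_pow] at hM
    have h3 := hd y (F q 0 (bdry q 1))
    calc _ = (2 ^ M : ℝ)⁻¹ * dist y (F q 0 (bdry q 1)) := by ring
      _ ≤ (2 ^ M : ℝ)⁻¹ * C := by gcongr
      _ < ε := hM

theorem dense_interior (q : Fin 3 → Plane) [Equilateral q] :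
    Dense {x : SG q | ∃ m, x ∈ V q m \ V q 0} := by
  rw [Metric.dense_iff]
  intro x r hr
  obtain ⟨m, y, hy, hd⟩ := exists_interior_dist_lt x hr
  exact ⟨y, by rwa [Metric.mem_ball, dist_comm], m, hy⟩

/-- The neighbours of `x` in the graph of level `m`. -/
def nbrs (q : Fin 3 → Plane) (m : ℕ) (x : SG q) : Finset (SG q) :=
  (V q m).filter (fun y => y ≠ x ∧ SameCell q m x y)

theorem graphLap_eq (m : ℕ) (u : SG q → ℝ) (x : SG q) :
    graphLap q m u x = ∑ y ∈ nbrs q m x, (u y - u x) := rfl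

theorem mem_nbrs {m : ℕ} {x y : SG q} :
    y ∈ nbrs q m x ↔ y ∈ V q m ∧ y ≠ x ∧ SameCell q m x y := by
  simp [nbrs]

theorem sameCell_zero (x y : SG q) : SameCell q 0 x y := ⟨[], rfl, ⟨x, rfl⟩, ⟨y, rfl⟩⟩

theorem sameCell_succ {m : ℕ} {x y : SG q} : SameCell q (m + 1) x y ↔
    ∃ l x' y', x = F q l x' ∧ y = F q l y' ∧ SameCell q m x' y' := by
  constructor
  · rintro ⟨w, hw, ⟨a, rfl⟩, ⟨b, rfl⟩⟩
    match w, hw with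
    | l :: w, hw =>
      exact ⟨l, _, _, rfl, rfl, w, by simpa using hw, ⟨a, rfl⟩, ⟨b, rfl⟩⟩
  · rintro ⟨l, x', y', rfl, rfl, w, hw, ⟨a, rfl⟩, ⟨b, rfl⟩⟩
    exact ⟨l :: w, by simp [hw], ⟨a, rfl⟩, ⟨b, rfl⟩⟩

theorem mem_nbrs_succ [Equilateral q] {m : ℕ} {x y : SG q} : y ∈ nbrs q (m + 1) x ↔
    ∃ l x' y', x = F q l x' ∧ y = F q l y' ∧ y' ∈ nbrs q m x' := by
  simp only [mem_nbrs]
  constructor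
  · rintro ⟨hy, hne, hc⟩
    obtain ⟨l, x', y', rfl, rfl, hc'⟩ := sameCell_succ.mp hc
    exact ⟨l, x', y', rfl, rfl, F_mem_V_iff.mp hy, fun h => hne (by rw [h]), hc'⟩
  · rintro ⟨l, x', y', rfl, rfl, hy, hne, hc⟩
    exact ⟨F_mem_V l hy, fun h => hne (F_injective l h),
      sameCell_succ.mpr ⟨l, x', y', rfl, rfl, hc⟩⟩

/-- The image of a non-boundary vertex lies in no other first-level cell, so all its neighbours come
from the same cell. Together with `nbrs_mid` this reduces every graph Laplacian to the junction
points. -/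
theorem nbrs_F [Equilateral q] {m : ℕ} {x : SG q} (hx : x ∉ V q 0) (i : Fin 3) :
    nbrs q (m + 1) (F q i x) = (nbrs q m x).image (F q i) := by
  ext y
  rw [mem_nbrs_succ, Finset.mem_image]
  constructor
  · rintro ⟨l, x', y', h, rfl, hy⟩
    by_cases hil : i = l
    · subst hil
      rw [F_injective i h]
      exact ⟨y', hy, rfl⟩
    · rw [(F_eq_F hil h).1] at hx
      exact absurd (bdry_mem_V 0 l) hx
  · rintro ⟨y', hy, rfl⟩
    exact ⟨i, x, y', rfl, rfl, hy⟩

theorem nbrs_F_bdry_self [Equilateral q] (m : ℕ) (n : Fin 3) :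
    nbrs q (m + 1) (bdry q n) = (nbrs q m (bdry q n)).image (F q n) := by
  ext y
  rw [mem_nbrs_succ, Finset.mem_image]
  constructor
  · rintro ⟨l, x', y', h, rfl, hy⟩
    obtain ⟨rfl, rfl⟩ := F_eq_bdry h.symm
    exact ⟨y', hy, rfl⟩
  · rintro ⟨y', hy, rfl⟩
    exact ⟨n, bdry q n, y', (F_bdry_self n).symm, rfl, hy⟩

theorem nbrs_bdry [Equilateral q] (m : ℕ) (n : Fin 3) : nbrs q m (bdry q n) =
    {(F q n)^[m] (bdry q (n + 1)), (F q n)^[m] (bdry q (n - 1))} := by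
  induction m with
  | zero =>
    ext y
    simp only [mem_nbrs, mem_V_zero, sameCell_zero, and_true, Function.iterate_zero, id_eq,
      Finset.mem_insert, Finset.mem_singleton]
    have h3 : ∀ i n : Fin 3, i = n ∨ i = n + 1 ∨ i = n - 1 := by decide
    have h4 : ∀ n : Fin 3, n + 1 ≠ n ∧ n - 1 ≠ n := by decide
    constructor
    · rintro ⟨⟨i, rfl⟩, hne⟩
      rcases h3 i n with rfl | rfl | rfl
      · exact absurd rfl hne
      · exact Or.inl rfl
      · exact Or.inr rfl
    · rintro (rfl | rfl)
      · exact ⟨⟨_, rfl⟩, fun h => (h4 n).1 (bdry_injective h)⟩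
      · exact ⟨⟨_, rfl⟩, fun h => (h4 n).2 (bdry_injective h)⟩
  | succ m ih =>
    rw [nbrs_F_bdry_self, ih, Finset.image_insert, Finset.image_singleton,
      Function.iterate_succ_apply', Function.iterate_succ_apply']

theorem nbrs_mid [Equilateral q] (m : ℕ) (j k : Fin 3) :
    nbrs q (m + 1) (F q j (bdry q k)) =
      (nbrs q m (bdry q k)).image (F q j) ∪ (nbrs q m (bdry q j)).image (F q k) := by
  ext y
  rw [mem_nbrs_succ, Finset.mem_union, Finset.mem_image, Finset.mem_image]
  constructor
  · rintro ⟨l, x', y', h, rfl, hy⟩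
    by_cases hl : j = l
    · subst hl
      rw [F_injective j h]
      exact Or.inl ⟨y', hy, rfl⟩
    · obtain ⟨h1, rfl⟩ := F_eq_F hl h
      rw [bdry_injective h1]
      exact Or.inr ⟨y', hy, rfl⟩
  · rintro (⟨y', hy, rfl⟩ | ⟨y', hy, rfl⟩)
    · exact ⟨j, _, y', rfl, rfl, hy⟩
    · exact ⟨k, _, y', F_bdry_comm j k, rfl, hy⟩

/-! ### Discrete normal derivatives and the graph Laplacian at junctions. -/

/-- The difference of level `m` that approximates the normal derivative at `q_n`. -/
def ndiff (q : Fin 3 → Plane) (m : ℕ) (u : SG q → ℝ) (n : Fin 3) : ℝ :=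
  2 * u (bdry q n) - u ((F q n)^[m] (bdry q (n + 1))) - u ((F q n)^[m] (bdry q (n - 1)))

theorem ndiff_succ (m : ℕ) (u : SG q → ℝ) (n : Fin 3) :
    ndiff q (m + 1) u n = ndiff q m (fun x => u (F q n x)) n := by
  simp only [ndiff, Function.iterate_succ_apply', F_bdry_self]

theorem graphLap_F [Equilateral q] {m : ℕ} {x : SG q} (hx : x ∉ V q 0) (i : Fin 3)
    (u : SG q → ℝ) :
    graphLap q (m + 1) u (F q i x) = graphLap q m (fun y => u (F q i y)) x := by
  rw [graphLap_eq, graphLap_eq, nbrs_F hx, Finset.sum_image (F_injective i).injOn]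

theorem graphLap_bdry [Equilateral q] (m : ℕ) (u : SG q → ℝ) (n : Fin 3) :
    graphLap q m u (bdry q n) = -ndiff q m u n := by
  rw [graphLap_eq, nbrs_bdry, Finset.sum_pair, ndiff]
  · ring
  · intro h
    have h3 : ∀ n : Fin 3, n + 1 ≠ n - 1 := by decide
    exact h3 n (bdry_injective ((F_injective n).iterate m h))

/-- A junction point lies in two cells and its neighbours split accordingly; each half of the sum is
minus a discrete normal derivative at a corner. Laplace equations thus become matching conditions
for normal derivatives. -/
theorem graphLap_mid [Equilateral q] (m : ℕ) (u : SG q → ℝ) {j k : Fin 3} (hjk : j ≠ k) :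
    graphLap q (m + 1) u (F q j (bdry q k)) =
      -(ndiff q m (fun y => u (F q j y)) k + ndiff q m (fun y => u (F q k y)) j) := by
  rw [neg_add, ← graphLap_bdry, ← graphLap_bdry, graphLap_eq, graphLap_eq, graphLap_eq,
    nbrs_mid m j k, Finset.sum_union, Finset.sum_image (F_injective j).injOn,
    Finset.sum_image (F_injective k).injOn, F_bdry_comm k j]
  rw [Finset.disjoint_left]
  intro y h1 h2
  obtain ⟨a, ha, rfl⟩ := Finset.mem_image.mp h1
  obtain ⟨b, hb, hab⟩ := Finset.mem_image.mp h2
  exact (mem_nbrs.mp ha).2.1 (F_eq_F hjk hab.symm).1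

/-! ### Linearity and uniqueness of the Laplacian -/

theorem graphLap_add (m : ℕ) (u v : SG q → ℝ) (x : SG q) :
    graphLap q m (fun y => u y + v y) x = graphLap q m u x + graphLap q m v x := by
  rw [graphLap_eq, graphLap_eq, graphLap_eq, ← Finset.sum_add_distrib]
  exact Finset.sum_congr rfl fun y _ => by ring

theorem graphLap_smul (m : ℕ) (c : ℝ) (u : SG q → ℝ) (x : SG q) :
    graphLap q m (fun y => c * u y) x = c * graphLap q m u x := by
  rw [graphLap_eq, graphLap_eq, Finset.mul_sum]
  exact Finset.sum_congr rfl fun y _ => by ring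

theorem HasLaplacian.add {u v f g : SG q → ℝ} (hu : HasLaplacian q u f)
    (hv : HasLaplacian q v g) : HasLaplacian q (fun x => u x + v x) (fun x => f x + g x) := by
  refine ⟨hu.1.add hv.1, hu.2.1.add hv.2.1, fun ε hε => ?_⟩
  obtain ⟨M₁, h1⟩ := hu.2.2 (ε / 2) (by linarith)
  obtain ⟨M₂, h2⟩ := hv.2.2 (ε / 2) (by linarith)
  refine ⟨max M₁ M₂, fun m hm x hx => ?_⟩
  have e1 := h1 m ((le_max_left _ _).trans hm) x hx
  have e2 := h2 m ((le_max_right _ _).trans hm) x hx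
  rw [graphLap_add]
  calc _ = |((3 / 2 : ℝ) * 5 ^ m * graphLap q m u x - f x) +
        ((3 / 2 : ℝ) * 5 ^ m * graphLap q m v x - g x)| := by congr 1; ring
    _ ≤ _ := abs_add_le _ _
    _ < ε := by linarith

theorem HasLaplacian.smul {u f : SG q → ℝ} (c : ℝ) (hu : HasLaplacian q u f) :
    HasLaplacian q (fun x => c * u x) (fun x => c * f x) := by
  refine ⟨hu.1.const_mul c, hu.2.1.const_mul c, fun ε hε => ?_⟩
  obtain ⟨M, h⟩ := hu.2.2 (ε / (|c| + 1)) (by positivity)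
  refine ⟨M, fun m hm x hx => ?_⟩
  have e := h m hm x hx
  rw [graphLap_smul]
  calc _ = |c * ((3 / 2 : ℝ) * 5 ^ m * graphLap q m u x - f x)| := by congr 1; ring
    _ = |c| * |(3 / 2 : ℝ) * 5 ^ m * graphLap q m u x - f x| := abs_mul _ _
    _ ≤ |c| * (ε / (|c| + 1)) := by gcongr
    _ < (|c| + 1) * (ε / (|c| + 1)) := by gcongr; linarith
    _ = ε := by field_simp

theorem HasLaplacian.sub {u v f g : SG q → ℝ} (hu : HasLaplacian q u f)
    (hv : HasLaplacian q v g) : HasLaplacian q (fun x => u x - v x) (fun x => f x - g x) := by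
  have h := hu.add (hv.smul (-1))
  simpa only [neg_one_mul, ← sub_eq_add_neg] using h

theorem hasLaplacian_zero : HasLaplacian q (fun _ => 0) (fun _ => 0) :=
  ⟨continuous_const, continuous_const, fun ε hε => ⟨0, fun m _ x _ => by
    simpa [graphLap_eq] using hε⟩⟩

theorem HasLaplacian.sum {ι : Type*} (s : Finset ι) {u f : ι → SG q → ℝ}
    (h : ∀ i ∈ s, HasLaplacian q (u i) (f i)) :
    HasLaplacian q (fun x => ∑ i ∈ s, u i x) (fun x => ∑ i ∈ s, f i x) := by
  induction s using Finset.induction_on with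
  | empty => simpa using hasLaplacian_zero
  | insert a s ha ih =>
    simp only [Finset.sum_insert ha]
    exact (h a (Finset.mem_insert_self a s)).add
      (ih fun i hi => h i (Finset.mem_insert_of_mem hi))

/-- Each non-boundary vertex belongs to all later levels, so the limit determines the Laplacian
there; these vertices are dense and both candidates are continuous. -/
theorem HasLaplacian.unique [Equilateral q] {u f g : SG q → ℝ} (hf : HasLaplacian q u f)
    (hg : HasLaplacian q u g) : f = g := by
  refine Continuous.ext_on (dense_interior q) hf.2.1 hg.2.1 ?_
  rintro x ⟨k, hx⟩
  obtain ⟨hx1, hx2⟩ := Finset.mem_sdiff.mp hx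
  by_contra hne
  have hpos : 0 < |f x - g x| / 2 := by
    have := abs_pos.mpr (sub_ne_zero.mpr hne)
    linarith
  obtain ⟨M₁, h1⟩ := hf.2.2 _ hpos
  obtain ⟨M₂, h2⟩ := hg.2.2 _ hpos
  set m := max k (max M₁ M₂)
  have hm : x ∈ V q m \ V q 0 := Finset.mem_sdiff.mpr ⟨V_mono (le_max_left _ _) hx1, hx2⟩
  have e1 := h1 m (by simp [m]) x hm
  have e2 := h2 m (by simp [m]) x hm
  rw [abs_sub_comm] at e1
  have := abs_sub_le (f x) ((3 / 2 : ℝ) * 5 ^ m * graphLap q m u x) (g x)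
  linarith

theorem HasLaplacian.lap_eq [Equilateral q] {u f : SG q → ℝ} (h : HasLaplacian q u f) :
    lap q u = f := by
  have hd : InDomain q u := ⟨f, h⟩
  rw [lap, dif_pos hd]
  exact hd.choose_spec.unique h

theorem InDomain.hasLaplacian {u : SG q → ℝ} (h : InDomain q u) :
    HasLaplacian q u (lap q u) := by
  rw [lap, dif_pos h]
  exact h.choose_spec

/-! ### The reflection that fixes `q_0` -/

/-- The affine reflection of the plane that exchanges `q_1` and `q_2`. -/
def planeRefl (q : Fin 3 → Plane) (x : Plane) : Plane :=
  x + (bary q 1 x - bary q 2 x) • (q 2 - q 1)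

theorem continuous_planeRefl : Continuous (planeRefl q) :=
  continuous_id.add (((continuous_bary 1).sub (continuous_bary 2)).smul continuous_const)

theorem planeRefl_contr [Equilateral q] (i : Fin 3) (x : Plane) :
    planeRefl q (contr q i x) = contr q (Equiv.swap 1 2 i) (planeRefl q x) := by
  unfold planeRefl
  rw [bary_contr, bary_contr]
  fin_cases i
  · have h : (Equiv.swap (1 : Fin 3) 2) 0 = 0 := by decide
    simp only [Fin.zero_eta, h, contr, one_ne_zero, Fin.reduceEq, if_false]
    module
  · have h : (Equiv.swap (1 : Fin 3) 2) 1 = 2 := by decide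
    simp only [Fin.mk_one, h, contr, Fin.reduceEq, if_false, if_true]
    module
  · have h : (Equiv.swap (1 : Fin 3) 2) 2 = 1 := by decide
    simp only [Fin.reduceFinMk, h, contr, Fin.reduceEq, if_false, if_true]
    module

/-- The reflection permutes the contractions, so the distance from the reflected point to the gasket
is at most halved on passing into a cell. Its maximum is then at most half of itself, hence zero. -/
theorem planeRefl_mem [Equilateral q] (x : SG q) : planeRefl q x ∈ gasket q := by
  have hcont : Continuous fun y : SG q => Metric.infDist (planeRefl q y) (gasket q) :=
    (Metric.continuous_infDist_pt _).comp (continuous_planeRefl.comp continuous_subtype_val)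
  obtain ⟨m, -, hm⟩ := isCompact_univ.exists_isMaxOn Set.univ_nonempty hcont.continuousOn
  have hmax : ∀ y : SG q, Metric.infDist (planeRefl q y) (gasket q) ≤
    Metric.infDist (planeRefl q m) (gasket q) := fun y => hm (Set.mem_univ y)
  obtain ⟨i, y, rfl⟩ := exists_F m
  obtain ⟨z, hz, hyz⟩ := (isCompact_gasket q).exists_infDist_eq_dist (gasket_nonempty q)
    (planeRefl q y)
  have h1 : Metric.infDist (planeRefl q (F q i y)) (gasket q) ≤
      dist (planeRefl q y) z / 2 := by
    refine (Metric.infDist_le_dist_of_mem (contr_mem q (Equiv.swap 1 2 i) hz)).trans ?_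
    rw [show planeRefl q (F q i y) = _ from planeRefl_contr i y]
    simp only [contr, dist_eq_norm]
    rw [show ∀ a b c : Plane, (1 / 2 : ℝ) • (a - c) + c - ((1 / 2 : ℝ) • (b - c) + c)
      = (1 / 2 : ℝ) • (a - b) from fun a b c => by module, norm_smul]
    norm_num
    linarith
  have h2 := hmax y
  have h3 := hmax x
  rw [((isCompact_gasket q).isClosed).mem_iff_infDist_zero (gasket_nonempty q)]
  exact le_antisymm (by linarith) Metric.infDist_nonneg

/-- The reflection of the gasket that exchanges `q_1` and `q_2`. -/
def refl (q : Fin 3 → Plane) [Equilateral q] (x : SG q) : SG q := ⟨planeRefl q x, planeRefl_mem x⟩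

variable [Equilateral q]

theorem continuous_refl : Continuous (refl q) :=
  (continuous_planeRefl.comp continuous_subtype_val).subtype_mk _

theorem refl_F (i : Fin 3) (x : SG q) :
    refl q (F q i x) = F q (Equiv.swap 1 2 i) (refl q x) :=
  Subtype.ext (planeRefl_contr i x)

theorem refl_bdry (i : Fin 3) : refl q (bdry q i) = bdry q (Equiv.swap 1 2 i) := by
  have h := refl_F i (bdry q i)
  rw [F_bdry_self] at h
  apply dist_le_zero.mp
  have h2 := dist_F (Equiv.swap 1 2 i) (refl q (bdry q i)) (bdry q (Equiv.swap 1 2 i))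
  rw [← h, F_bdry_self] at h2
  linarith

theorem refl_refl (x : SG q) : refl q (refl q x) = x := by
  have hcont : Continuous fun y : SG q => dist (refl q (refl q y)) y :=
    (continuous_refl.comp continuous_refl).dist continuous_id
  obtain ⟨m, -, hm⟩ := isCompact_univ.exists_isMaxOn Set.univ_nonempty hcont.continuousOn
  have hmax : ∀ y : SG q, dist (refl q (refl q y)) y ≤ dist (refl q (refl q m)) m :=
    fun y => hm (Set.mem_univ y)
  obtain ⟨i, y, rfl⟩ := exists_F m
  have h1 := hmax y
  have h2 := hmax x
  rw [refl_F, refl_F, Equiv.swap_apply_self, dist_F] at h1 h2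
  exact dist_le_zero.mp (by linarith)

theorem refl_mem_V {m : ℕ} {x : SG q} (h : x ∈ V q m) : refl q x ∈ V q m := by
  induction m generalizing x with
  | zero =>
    obtain ⟨i, rfl⟩ := mem_V_zero.mp h
    rw [refl_bdry]
    exact bdry_mem_V 0 _
  | succ m ih =>
    obtain ⟨i, y, hy, rfl⟩ := mem_V_succ.mp h
    rw [refl_F]
    exact F_mem_V _ (ih hy)

theorem sameCell_refl {m : ℕ} {x y : SG q} (h : SameCell q m x y) :
    SameCell q m (refl q x) (refl q y) := by
  induction m generalizing x y with
  | zero => exact sameCell_zero _ _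
  | succ m ih =>
    obtain ⟨l, x', y', rfl, rfl, h'⟩ := sameCell_succ.mp h
    rw [refl_F, refl_F]
    exact sameCell_succ.mpr ⟨_, _, _, rfl, rfl, ih h'⟩

theorem refl_mem_nbrs {m : ℕ} {x y : SG q} (h : y ∈ nbrs q m x) :
    refl q y ∈ nbrs q m (refl q x) := by
  rw [mem_nbrs] at *
  refine ⟨refl_mem_V h.1, fun e => h.2.1 ?_, sameCell_refl h.2.2⟩
  rw [← refl_refl y, e, refl_refl]

theorem graphLap_refl (m : ℕ) (u : SG q → ℝ) (x : SG q) :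
    graphLap q m (fun y => u (refl q y)) x = graphLap q m u (refl q x) := by
  rw [graphLap_eq, graphLap_eq]
  refine Finset.sum_nbij' (refl q) (refl q) (fun y hy => refl_mem_nbrs hy) (fun y hy => ?_)
    (fun y _ => refl_refl y) (fun y _ => refl_refl y) (fun y _ => rfl)
  have := refl_mem_nbrs hy
  rwa [refl_refl] at this

theorem HasLaplacian.refl {u f : SG q → ℝ} (h : HasLaplacian q u f) :
    HasLaplacian q (fun x => u (refl q x)) (fun x => f (SierpinskiGasket.refl q x)) := by
  refine ⟨h.1.comp continuous_refl, h.2.1.comp continuous_refl, fun ε hε => ?_⟩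
  obtain ⟨M, hM⟩ := h.2.2 ε hε
  refine ⟨M, fun m hm x hx => ?_⟩
  rw [graphLap_refl]
  obtain ⟨h1, h2⟩ := Finset.mem_sdiff.mp hx
  refine hM m hm _ (Finset.mem_sdiff.mpr ⟨refl_mem_V h1, fun h0 => h2 ?_⟩)
  have := refl_mem_V h0
  rwa [refl_refl] at this

end

section

variable {q : Fin 3 → Plane}

/-! ### Harmonic functions -/

/-- The three indices sum to `0` in `Fin 3`, so the index different from distinct `i` and `k` is
`-(i + k)`. These values let `simp` evaluate such expressions. -/
theorem fin3_arith : (-1 : Fin 3) = 2 ∧ (-2 : Fin 3) = 1 ∧ (1 + 1 : Fin 3) = 2 ∧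
    (1 + 2 : Fin 3) = 0 ∧ (2 + 1 : Fin 3) = 0 ∧ (2 + 2 : Fin 3) = 1 ∧ (2 - 1 : Fin 3) = 1 ∧
    (1 - 2 : Fin 3) = 2 ∧ (0 - 1 : Fin 3) = 2 := by
  decide

/-- The boundary values on the `i`-th cell of the harmonic function with boundary values `a`
(the `1/5`-`2/5` rule). -/
def hext (i : Fin 3) (a : Fin 3 → ℝ) (k : Fin 3) : ℝ :=
  if k = i then a i else (2 * a i + 2 * a k + a (-(i + k))) / 5

theorem hext_comm (i j : Fin 3) (a : Fin 3 → ℝ) : hext i a j = hext j a i := by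
  unfold hext
  by_cases h : i = j
  · subst h; rfl
  · rw [if_neg h, if_neg (Ne.symm h), add_comm i j]
    ring

theorem hext_self (i : Fin 3) (a : Fin 3 → ℝ) : hext i a i = a i := if_pos rfl

/-- Both bounds contain the same term `2 * a i / 5`, so the range of boundary values contracts by
`3/5` in each subcell. This is the source of the rate `3/5` for harmonic functions. -/
theorem hext_sub_le {lo hi : ℝ} {a : Fin 3 → ℝ} (h : ∀ j, lo ≤ a j ∧ a j ≤ hi) (i k : Fin 3) :
    (2 * a i + 3 * lo) / 5 ≤ hext i a k ∧ hext i a k ≤ (2 * a i + 3 * hi) / 5 := by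
  have h1 := h i
  have h2 := h k
  have h3 := h (-(i + k))
  unfold hext
  split_ifs <;> constructor <;> linarith

theorem hext_add (i : Fin 3) (a b : Fin 3 → ℝ) : hext i (a + b) = hext i a + hext i b := by
  funext k
  simp only [hext, Pi.add_apply]
  split_ifs
  · rfl
  · ring

theorem hext_smul (i : Fin 3) (c : ℝ) (a : Fin 3 → ℝ) : hext i (c • a) = c • hext i a := by
  funext k
  simp only [hext, Pi.smul_apply, smul_eq_mul]
  split_ifs
  · rfl
  · ring

/-- Approximations of the harmonic function with boundary values `a`. -/
def harmApprox (q : Fin 3 → Plane) : ℕ → (Fin 3 → ℝ) → SG q → ℝ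
  | 0, a => fun x => ∑ i, a i * lam q i x
  | n + 1, a => glue fun i => harmApprox q n (hext i a)

/-- The harmonic function with boundary values `a`. -/
def harm (q : Fin 3 → Plane) (a : Fin 3 → ℝ) (x : SG q) : ℝ :=
  limUnder atTop fun n => harmApprox q n a x

variable [Equilateral q]

theorem harmApprox_bdry (n : ℕ) (a : Fin 3 → ℝ) (j : Fin 3) :
    harmApprox q n a (bdry q j) = a j := by
  induction n generalizing a j with
  | zero => simp [harmApprox, lam_bdry]
  | succ n ih =>
    rw [← F_bdry_self, harmApprox, glue_F, ih, hext_self]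
    intro i k
    rw [ih, ih, hext_comm]

theorem harmApprox_succ_F (n : ℕ) (a : Fin 3 → ℝ) (i : Fin 3) (x : SG q) :
    harmApprox q (n + 1) a (F q i x) = harmApprox q n (hext i a) x := by
  rw [harmApprox, glue_F]
  intro i k
  rw [harmApprox_bdry, harmApprox_bdry, hext_comm]

theorem continuous_harmApprox (n : ℕ) (a : Fin 3 → ℝ) : Continuous (harmApprox q n a) := by
  induction n generalizing a with
  | zero => exact continuous_finsetSum _ fun i _ => (continuous_lam i).const_mul _
  | succ n ih =>
    refine continuous_of_comp_F fun i => ?_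
    simp only [harmApprox_succ_F]
    exact ih _

theorem harmApprox_add (n : ℕ) (a b : Fin 3 → ℝ) (x : SG q) :
    harmApprox q n (a + b) x = harmApprox q n a x + harmApprox q n b x := by
  induction n generalizing a b x with
  | zero => simp [harmApprox, add_mul, Finset.sum_add_distrib]
  | succ n ih =>
    obtain ⟨i, y, rfl⟩ := exists_F x
    rw [harmApprox_succ_F, harmApprox_succ_F, harmApprox_succ_F, hext_add, ih]

theorem harmApprox_smul (n : ℕ) (c : ℝ) (a : Fin 3 → ℝ) (x : SG q) :
    harmApprox q n (c • a) x = c * harmApprox q n a x := by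
  induction n generalizing a x with
  | zero => simp [harmApprox, mul_assoc, Finset.mul_sum]
  | succ n ih =>
    obtain ⟨i, y, rfl⟩ := exists_F x
    rw [harmApprox_succ_F, harmApprox_succ_F, hext_smul, ih]

theorem harmApprox_mem {lo hi : ℝ} {a : Fin 3 → ℝ} (h : ∀ j, lo ≤ a j ∧ a j ≤ hi) (n : ℕ)
    (x : SG q) : lo ≤ harmApprox q n a x ∧ harmApprox q n a x ≤ hi := by
  induction n generalizing a x with
  | zero =>
    have hs := sum_lam x
    simp only [harmApprox]
    constructor
    · calc lo = ∑ i, lo * lam q i x := by rw [← Finset.mul_sum, hs, mul_one]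
        _ ≤ _ := Finset.sum_le_sum fun i _ =>
          mul_le_mul_of_nonneg_right (h i).1 (lam_nonneg i x)
    · calc _ ≤ ∑ i, hi * lam q i x := Finset.sum_le_sum fun i _ =>
          mul_le_mul_of_nonneg_right (h i).2 (lam_nonneg i x)
        _ = hi := by rw [← Finset.mul_sum, hs, mul_one]
  | succ n ih =>
    obtain ⟨i, y, rfl⟩ := exists_F x
    rw [harmApprox_succ_F]
    refine ih (fun j => ?_) y
    have h1 := hext_sub_le h i j
    have h2 := h i
    constructor <;> linarith

/-- On a cell of level `n` the two approximations are the first two for boundary values in an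
interval of length `(hi - lo) * (3/5)^n`, and both stay in that interval. -/
theorem abs_harmApprox_succ_sub_le {lo hi : ℝ} {a : Fin 3 → ℝ} (h : ∀ j, lo ≤ a j ∧ a j ≤ hi)
    (n : ℕ) (x : SG q) :
    |harmApprox q (n + 1) a x - harmApprox q n a x| ≤ (hi - lo) * (3 / 5) ^ n := by
  induction n generalizing a lo hi x with
  | zero =>
    have h1 := harmApprox_mem h 0 x
    have h2 := harmApprox_mem h 1 x
    rw [abs_le, pow_zero, mul_one]
    constructor <;> linarith
  | succ n ih =>
    obtain ⟨i, y, rfl⟩ := exists_F x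
    rw [harmApprox_succ_F, harmApprox_succ_F]
    refine (ih (hext_sub_le h i) y).trans (le_of_eq ?_)
    rw [pow_succ]
    ring

theorem exists_bounds (a : Fin 3 → ℝ) : ∀ j, -(∑ i, |a i|) ≤ a j ∧ a j ≤ ∑ i, |a i| := by
  intro j
  rw [← abs_le]
  exact Finset.single_le_sum (f := fun i => |a i|) (fun i _ => abs_nonneg _) (Finset.mem_univ j)

theorem tendsto_harm (a : Fin 3 → ℝ) (x : SG q) :
    Tendsto (fun n => harmApprox q n a x) atTop (𝓝 (harm q a x)) := by
  refine CauchySeq.tendsto_limUnder (cauchySeq_of_le_geometric (3 / 5)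
    ((∑ i, |a i|) - -(∑ i, |a i|)) (by norm_num) fun n => ?_)
  rw [dist_comm]
  exact abs_harmApprox_succ_sub_le (exists_bounds a) n x

theorem harm_bdry (a : Fin 3 → ℝ) (j : Fin 3) : harm q a (bdry q j) = a j := by
  refine tendsto_nhds_unique (tendsto_harm a _) ?_
  simp only [harmApprox_bdry]
  exact tendsto_const_nhds

theorem harm_F (a : Fin 3 → ℝ) (i : Fin 3) (x : SG q) :
    harm q a (F q i x) = harm q (hext i a) x := by
  refine tendsto_nhds_unique ((tendsto_add_atTop_iff_nat 1).mpr (tendsto_harm a _)) ?_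
  simp only [harmApprox_succ_F]
  exact tendsto_harm _ _

theorem harm_add (a b : Fin 3 → ℝ) (x : SG q) :
    harm q (a + b) x = harm q a x + harm q b x := by
  refine tendsto_nhds_unique (tendsto_harm (a + b) x) ?_
  simp only [harmApprox_add]
  exact (tendsto_harm _ _).add (tendsto_harm _ _)

theorem harm_smul (c : ℝ) (a : Fin 3 → ℝ) (x : SG q) :
    harm q (c • a) x = c * harm q a x := by
  refine tendsto_nhds_unique (tendsto_harm (c • a) x) ?_
  simp only [harmApprox_smul]
  exact (tendsto_harm _ _).const_mul _

theorem harm_zero (x : SG q) : harm q 0 x = 0 := by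
  have := harm_smul (q := q) 0 0 x
  rwa [zero_smul, zero_mul] at this

theorem harm_mem {lo hi : ℝ} {a : Fin 3 → ℝ} (h : ∀ j, lo ≤ a j ∧ a j ≤ hi) (x : SG q) :
    lo ≤ harm q a x ∧ harm q a x ≤ hi :=
  ⟨ge_of_tendsto' (tendsto_harm a x) fun n => (harmApprox_mem h n x).1,
    le_of_tendsto' (tendsto_harm a x) fun n => (harmApprox_mem h n x).2⟩

theorem harm_const (c : ℝ) (x : SG q) : harm q (fun _ => c) x = c := by
  have h := harm_mem (q := q) (lo := c) (hi := c) (a := fun _ => c)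
    (fun _ => ⟨le_rfl, le_rfl⟩) x
  exact le_antisymm h.2 h.1

theorem harm_eq_sum (a : Fin 3 → ℝ) (x : SG q) :
    harm q a x = ∑ j, a j * harm q (Pi.single j 1) x := by
  have h : a = a 0 • Pi.single 0 1 + a 1 • Pi.single 1 1 + a 2 • Pi.single 2 1 := by
    funext k
    fin_cases k <;> simp
  conv_lhs => rw [h]
  rw [harm_add, harm_add, harm_smul, harm_smul, harm_smul, Fin.sum_univ_three]

theorem continuous_of_geometric {X : Type*} [TopologicalSpace X] {u : ℕ → X → ℝ} {v : X → ℝ}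
    {C r : ℝ} (hr : r < 1) (hu : ∀ n, Continuous (u n))
    (hd : ∀ n x, |u (n + 1) x - u n x| ≤ C * r ^ n)
    (hv : ∀ x, Tendsto (fun n => u n x) atTop (𝓝 (v x))) (hr0 : 0 ≤ r) : Continuous v := by
  refine TendstoUniformly.continuous (F := u) (p := atTop) ?_ (Frequently.of_forall hu)
  rw [Metric.tendstoUniformly_iff]
  intro ε hε
  have ht : Tendsto (fun n : ℕ => C * r ^ n / (1 - r)) atTop (𝓝 0) := by
    have := ((tendsto_pow_atTop_nhds_zero_of_lt_one hr0 hr).const_mul C).div_const (1 - r)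
    simpa using this
  filter_upwards [ht.eventually (gt_mem_nhds hε)] with n hn x
  rw [dist_comm]
  refine lt_of_le_of_lt (dist_le_of_le_geometric_of_tendsto r C hr (f := fun n => u n x)
    (fun k => ?_) (hv x) n) hn
  rw [dist_comm]
  exact hd k x

theorem continuous_harm (a : Fin 3 → ℝ) : Continuous (harm q a) :=
  continuous_of_geometric (r := 3 / 5) (by norm_num) (fun n => continuous_harmApprox n a)
    (fun n x => abs_harmApprox_succ_sub_le (exists_bounds a) n x) (tendsto_harm a) (by norm_num)

/-- The 1/5–2/5 rule multiplies this difference by exactly `3/5` at each step, so the normal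
derivative of a harmonic function is already exact at level `0`. -/
theorem ndiff_harm (m : ℕ) (a : Fin 3 → ℝ) (n : Fin 3) :
    ndiff q m (harm q a) n = (3 / 5) ^ m * (2 * a n - a (n + 1) - a (n - 1)) := by
  induction m generalizing a with
  | zero => simp [ndiff, harm_bdry]
  | succ m ih =>
    rw [ndiff_succ]
    simp only [harm_F]
    rw [ih, pow_succ]
    have : ∀ n : Fin 3, n + 1 ≠ n ∧ n - 1 ≠ n ∧ -(n + (n + 1)) = n - 1 ∧
      -(n + (n - 1)) = n + 1 := by decide
    obtain ⟨h1, h2, h3, h4⟩ := this n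
    simp only [hext, if_neg h1, if_neg h2, h3, h4, if_true]
    ring

/-- The normal derivatives of the two harmonic pieces cancel at a junction: this condition at the
three midpoints is what the 1/5–2/5 rule solves. -/
theorem hext_matching {i j : Fin 3} (hij : i ≠ j) (a : Fin 3 → ℝ) :
    2 * hext i a j - hext i a (j + 1) - hext i a (j - 1) +
      (2 * hext j a i - hext j a (i + 1) - hext j a (i - 1)) = 0 := by
  fin_cases i <;> fin_cases j <;> simp [hext, fin3_arith] at hij ⊢ <;> ring

theorem graphLap_harm {m : ℕ} {x : SG q} (hx : x ∈ V q m \ V q 0) (a : Fin 3 → ℝ) :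
    graphLap q m (harm q a) x = 0 := by
  induction m generalizing x a with
  | zero => simp at hx
  | succ m ih =>
    obtain ⟨i, y, hy, rfl⟩ | ⟨i, j, hij, rfl⟩ := interior_cases hx
    · rw [graphLap_F (Finset.mem_sdiff.mp hy).2]
      simp only [harm_F]
      exact ih hy _
    · rw [graphLap_mid m _ hij]
      simp only [harm_F, ndiff_harm]
      rw [← mul_add, hext_matching hij, mul_zero, neg_zero]

theorem hasLaplacian_harm (a : Fin 3 → ℝ) : HasLaplacian q (harm q a) (fun _ => 0) :=
  ⟨continuous_harm a, continuous_const, fun ε hε => ⟨0, fun m _ x hx => by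
    rw [graphLap_harm hx]
    simpa using hε⟩⟩

/-! ### Tents at the midpoints -/

/-- The piecewise harmonic function of level `1` which takes the value `1` at the midpoint
opposite to `q_i` and vanishes at the other vertices. -/
def mid (q : Fin 3 → Plane) (i : Fin 3) : SG q → ℝ :=
  glue fun j => if j = i then 0 else harm q (Pi.single (-(i + j)) 1)

theorem mid_compat (i j k : Fin 3) :
    (if j = i then (0 : SG q → ℝ) else harm q (Pi.single (-(i + j)) 1)) (bdry q k) =
      (if k = i then (0 : SG q → ℝ) else harm q (Pi.single (-(i + k)) 1)) (bdry q j) := by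
  split_ifs with h1 h2 h2
  · rfl
  · subst h1
    rw [harm_bdry, Pi.zero_apply, Pi.single_apply, if_neg]
    revert h2
    revert j k
    decide
  · subst h2
    rw [harm_bdry, Pi.zero_apply, Pi.single_apply, if_neg]
    revert h1
    revert j k
    decide
  · rw [harm_bdry, harm_bdry, Pi.single_apply, Pi.single_apply]
    congr 1
    revert h1 h2
    revert i j k
    decide

theorem mid_F (i j : Fin 3) (x : SG q) :
    mid q i (F q j x) = if j = i then 0 else harm q (Pi.single (-(i + j)) 1) x := by
  rw [mid, glue_F (mid_compat i)]
  split_ifs <;> rfl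

theorem continuous_mid (i : Fin 3) : Continuous (mid q i) := by
  refine continuous_of_comp_F fun j => ?_
  simp only [mid_F]
  split_ifs
  · exact continuous_const
  · exact continuous_harm _

theorem mid_mem (i : Fin 3) (x : SG q) : 0 ≤ mid q i x ∧ mid q i x ≤ 1 := by
  obtain ⟨j, y, rfl⟩ := exists_F x
  rw [mid_F]
  split_ifs
  · exact ⟨le_rfl, zero_le_one⟩
  · refine harm_mem (fun k => ?_) y
    rw [Pi.single_apply]
    split_ifs <;> norm_num

/-- A combination of the three midpoint tents, restricted to a cell. -/
theorem sum_mid_F (c : Fin 3 → ℝ) (i : Fin 3) (x : SG q) :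
    ∑ k, c k * mid q k (F q i x) = harm q (fun n => if n = i then 0 else c (-(i + n))) x := by
  rw [harm_eq_sum, Fin.sum_univ_three, Fin.sum_univ_three]
  simp only [mid_F]
  fin_cases i <;>
    simp [fin3_arith] <;>
    ring

end

section

variable {q : Fin 3 → Plane}

/-! ### Self-similarity of the measure -/

/-- The law of a sequence of independent uniform letters. -/
def letters : Measure (ℕ → Fin 3) :=
  Measure.infinitePi (fun _ : ℕ => (PMF.uniformOfFintype (Fin 3)).toMeasure)

instance instIsProbabilityMeasureLetters : IsProbabilityMeasure letters := by
  unfold letters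
  infer_instance

/-- Prefixing a sequence by a letter. -/
def consSeq (i : Fin 3) (w : ℕ → Fin 3) : ℕ → Fin 3 := fun k => Nat.casesOn k i w

theorem measurable_consSeq (i : Fin 3) : Measurable (consSeq i) := by
  refine measurable_pi_lambda _ fun k => ?_
  cases k with
  | zero => exact measurable_const
  | succ k => exact measurable_pi_apply k

theorem addrSG_consSeq (i : Fin 3) (w : ℕ → Fin 3) :
    addrSG q (consSeq i w) = F q i (addrSG q w) :=
  Subtype.ext (contr_addr q i w).symm

/-- The first letter is uniform and independent of the tail. It suffices to compare both sides on
finite-dimensional boxes. -/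
theorem letters_eq : letters = ∑ i : Fin 3, (3⁻¹ : ENNReal) • letters.map (consSeq i) := by
  symm
  refine Measure.eq_infinitePi _ fun s t ht => ?_
  set ν := (PMF.uniformOfFintype (Fin 3)).toMeasure with hν
  -- After a prefix `i`, the constraint at position `0` is decided by `i` alone; the other
  -- constraints, shifted down by one position to `s'`, are constraints on the tail.
  have key : ∀ i : Fin 3, letters.map (consSeq i) (Set.pi s t) =
      (if 0 ∈ s → i ∈ t 0 then 1 else 0) * ∏ k ∈ s.erase 0, ν (t k) := by
    intro i
    rw [Measure.map_apply (measurable_consSeq i)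
      (MeasurableSet.pi s.countable_toSet fun k _ => ht k)]
    set s' : Finset ℕ := (s.erase 0).image Nat.pred with hs'
    have himg : ∏ k ∈ s', ν (t (k + 1)) = ∏ k ∈ s.erase 0, ν (t k) := by
      rw [hs', Finset.prod_image]
      · refine Finset.prod_congr rfl fun k hk => ?_
        have : k ≠ 0 := (Finset.mem_erase.mp hk).1
        rw [Nat.pred_eq_sub_one, Nat.sub_add_cancel (Nat.pos_of_ne_zero this)]
      · intro a ha b hb hab
        have h1 := (Finset.mem_erase.mp ha).1
        have h2 := (Finset.mem_erase.mp hb).1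
        simp only [Nat.pred_eq_sub_one] at hab
        omega
    have hpi : letters (Set.pi s' fun k => t (k + 1)) = ∏ k ∈ s', ν (t (k + 1)) :=
      Measure.infinitePi_pi _ fun k _ => ht (k + 1)
    have hmem : ∀ k, k ∈ s' ↔ k + 1 ∈ s := by
      intro k
      simp only [hs', Finset.mem_image, Finset.mem_erase]
      constructor
      · rintro ⟨a, ⟨h0, ha⟩, rfl⟩
        rwa [Nat.pred_eq_sub_one, Nat.sub_add_cancel (Nat.pos_of_ne_zero h0)]
      · intro h
        exact ⟨k + 1, ⟨by omega, h⟩, rfl⟩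
    split_ifs with h
    · rw [one_mul, ← himg, ← hpi]
      congr 1
      ext w
      simp only [Set.mem_preimage, Set.mem_pi, Finset.mem_coe, hmem]
      constructor
      · intro hw k hk
        exact hw (k + 1) hk
      · intro hw k hk
        cases k with
        | zero => exact h hk
        | succ k => exact hw k hk
    · rw [zero_mul]
      convert measure_empty (μ := letters)
      ext w
      simp only [Set.mem_preimage, Set.mem_pi, Finset.mem_coe, Set.mem_empty_iff_false, iff_false]
      push Not at h
      exact fun hw => h.2 (hw 0 h.1)
  have hone : ∀ i : Fin 3, ν {i} = 3⁻¹ := by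
    intro i
    rw [hν, PMF.toMeasure_apply_singleton _ _ (measurableSet_singleton i)]
    simp
  have hν0 : ∀ A : Set (Fin 3), ν A = ∑ i : Fin 3, (3⁻¹ : ENNReal) * if i ∈ A then 1 else 0 := by
    intro A
    have hA : A = ((Finset.univ.filter fun i => i ∈ A : Finset (Fin 3)) : Set (Fin 3)) := by
      ext; simp
    conv_lhs => rw [hA]
    rw [← sum_measure_singleton, Finset.sum_filter]
    refine Finset.sum_congr rfl fun i _ => ?_
    rw [hone]
    split_ifs <;> simp
  simp only [Measure.coe_finsetSum, Finset.sum_apply, Measure.smul_apply, smul_eq_mul, key]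
  by_cases h0 : 0 ∈ s
  · rw [← Finset.mul_prod_erase s _ h0, hν0 (t 0), Finset.sum_mul]
    exact Finset.sum_congr rfl fun i _ => by simp [h0]
  · have : ∑ i : Fin 3, (3⁻¹ : ENNReal) = 1 := by
      rw [Finset.sum_const, Finset.card_univ, Fintype.card_fin, nsmul_eq_mul]
      exact ENNReal.mul_inv_cancel (by norm_num) (by norm_num)
    simp only [h0, false_imp_iff, if_true, one_mul, Finset.erase_eq_of_notMem h0]
    rw [← Finset.sum_mul, this, one_mul]

theorem integrable_of_continuous {f : SG q → ℝ} (hf : Continuous f) : Integrable f (mu q) :=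
  (BoundedContinuousFunction.mkOfCompact ⟨f, hf⟩).integrable (mu q)

theorem integral_mu {f : SG q → ℝ} (hf : Continuous f) :
    ∫ x, f x ∂(mu q) = ∫ w, f (addrSG q w) ∂letters :=
  integral_map (measurable_addrSG q).aemeasurable hf.aestronglyMeasurable

/-- The computation is done on address sequences, where the three pieces are disjoint and the
overlap of cells at vertices plays no role. -/
theorem integral_self_similar {f : SG q → ℝ} (hf : Continuous f) :
    ∫ x, f x ∂(mu q) = 1 / 3 * ∑ i, ∫ x, f (F q i x) ∂(mu q) := by
  rw [integral_mu hf]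
  have hm : StronglyMeasurable fun w => f (addrSG q w) :=
    hf.stronglyMeasurable.comp_measurable (measurable_addrSG q)
  obtain ⟨C, hC⟩ := (isCompact_range hf).isBounded.exists_norm_le
  have hfin : ∀ ν : Measure (ℕ → Fin 3), IsFiniteMeasure ν →
      Integrable (fun w => f (addrSG q w)) ν := fun ν _ =>
    Integrable.of_bound hm.aestronglyMeasurable C
      (Eventually.of_forall fun w => hC _ ⟨_, rfl⟩)
  conv_lhs => rw [letters_eq]
  rw [integral_finsetSum_measure, Finset.mul_sum]
  · refine Finset.sum_congr rfl fun i _ => ?_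
    rw [integral_smul_measure, integral_map (measurable_consSeq i).aemeasurable
      hm.aestronglyMeasurable, integral_mu (f := fun x => f (F q i x)) (hf.comp (continuous_F i))]
    simp [addrSG_consSeq]
  · intro i _
    refine (hfin _ ?_).smul_measure (by norm_num)
    exact Measure.isFiniteMeasure_map _ _

/-- The measure has full support: by self-similarity the integral vanishes on every cell, while `f`
stays above half of a positive value on a small cell around the point. -/
theorem integral_nonneg_eq_zero {f : SG q → ℝ} (hf : Continuous f) (h0 : ∀ x, 0 ≤ f x)
    (h : ∫ x, f x ∂(mu q) = 0) : ∀ x, f x = 0 := by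
  have hw : ∀ w : List (Fin 3), ∀ g : SG q → ℝ, Continuous g → (∀ x, 0 ≤ g x) →
      ∫ x, g x ∂(mu q) = 0 → ∫ x, g (Fw q w x) ∂(mu q) = 0 := by
    intro w
    induction w with
    | nil => exact fun g _ _ h => h
    | cons i w ih =>
      intro g hg hg0 h
      refine ih (fun x => g (F q i x)) (by fun_prop) (fun x => hg0 _) ?_
      rw [integral_self_similar hg] at h
      have h1 : ∑ i, ∫ x, g (F q i x) ∂(mu q) = 0 := by linarith
      exact (Finset.sum_eq_zero_iff_of_nonneg fun i _ => integral_nonneg fun x => hg0 _).mp h1 i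
        (Finset.mem_univ i)
  intro x
  by_contra hne
  have hpos : 0 < f x := lt_of_le_of_ne (h0 x) (Ne.symm hne)
  obtain ⟨M, hM⟩ := exists_level_osc_le hf (half_pos hpos)
  obtain ⟨w, y, hwl, rfl⟩ := exists_Fw M x
  have h1 := hw w f hf h0 h
  have h2 : f (Fw q w y) / 2 ≤ ∫ x, f (Fw q w x) ∂(mu q) := by
    have h3 : ∫ _, f (Fw q w y) / 2 ∂(mu q) ≤ ∫ x, f (Fw q w x) ∂(mu q) := by
      refine integral_mono (integrable_const _)
        (integrable_of_continuous (hf.comp (continuous_Fw w))) fun x => ?_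
      have := (abs_lt.mp (hM w hwl.ge y x)).2
      simp only
      linarith
    simpa using h3
  linarith

/-! ### Integrals against the harmonic basis -/

variable [Equilateral q]

/-- The integral of `f` against the harmonic function that is `1` at `q_n` and `0` at the other
two boundary points. -/
def harmInt (q : Fin 3 → Plane) (f : SG q → ℝ) (n : Fin 3) : ℝ :=
  ∫ x, harm q (Pi.single n 1) x * f x ∂(mu q)

theorem integral_harm_mul {f : SG q → ℝ} (hf : Continuous f) (a : Fin 3 → ℝ) :
    ∫ x, harm q a x * f x ∂(mu q) = ∑ k, a k * harmInt q f k := by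
  have h : ∀ x, harm q a x * f x = ∑ k, a k * (harm q (Pi.single k 1) x * f x) := by
    intro x
    rw [harm_eq_sum, Finset.sum_mul]
    exact Finset.sum_congr rfl fun k _ => by ring
  simp only [h]
  rw [integral_finsetSum]
  · exact Finset.sum_congr rfl fun k _ => integral_const_mul _ _
  · exact fun k _ => ((integrable_of_continuous ((continuous_harm _).mul hf)).const_mul _)

theorem harmInt_self_similar {f : SG q → ℝ} (hf : Continuous f) (n : Fin 3) :
    harmInt q f n = 1 / 3 * ∑ i, ∑ k, hext i (Pi.single n 1) k * harmInt q (fun x => f (F q i x)) k := by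
  rw [harmInt, integral_self_similar (f := fun x => harm q _ x * f x) ((continuous_harm _).mul hf)]
  congr 1
  refine Finset.sum_congr rfl fun i _ => ?_
  simp only [harm_F]
  exact integral_harm_mul (hf.comp (continuous_F i)) _

/-- Self-similarity gives a linear system for the three integrals, and their sum is `1` because the
three basis functions add up to `1`. -/
theorem harmInt_one (n : Fin 3) : harmInt q (fun _ => 1) n = 1 / 3 := by
  have h : ∀ n, harmInt q (fun _ => 1) n =
      1 / 3 * ∑ i, ∑ k, hext i (Pi.single n 1) k * harmInt q (fun _ => 1) k :=
    fun n => harmInt_self_similar continuous_const n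
  have hs : ∑ k, (1 : ℝ) * harmInt q (fun _ => 1) k = 1 := by
    rw [← integral_harm_mul continuous_const (fun _ => 1)]
    simp [harm_const]
  have h0 := h 0
  have h1 := h 1
  have h2 := h 2
  simp only [Fin.sum_univ_three] at h0 h1 h2 hs
  simp [hext, fin3_arith] at h0 h1 h2
  fin_cases n <;> simp <;> linarith

theorem harmInt_mem {f : SG q → ℝ} (hf : Continuous f) {lo hi : ℝ} (h : ∀ x, lo ≤ f x ∧ f x ≤ hi)
    (n : Fin 3) : lo / 3 ≤ harmInt q f n ∧ harmInt q f n ≤ hi / 3 := by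
  have h0 : ∀ x, 0 ≤ harm q (Pi.single n 1) x := fun x => by
    refine (harm_mem (lo := 0) (hi := 1) (fun k => ?_) x).1
    rw [Pi.single_apply]
    split_ifs <;> norm_num
  have hc : ∀ c : ℝ, ∫ x, harm q (Pi.single n 1) x * c ∂(mu q) = c / 3 := by
    intro c
    have := harmInt_one (q := q) n
    simp only [harmInt, mul_one] at this
    rw [integral_mul_const, this]
    ring
  have hi1 := integrable_of_continuous ((continuous_harm (Pi.single n 1)).mul hf)
  constructor
  · rw [← hc]
    exact integral_mono ((integrable_of_continuous (continuous_harm _)).mul_const _) hi1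
      fun x => mul_le_mul_of_nonneg_left (h x).1 (h0 x)
  · rw [← hc]
    exact integral_mono hi1 ((integrable_of_continuous (continuous_harm _)).mul_const _)
      fun x => mul_le_mul_of_nonneg_left (h x).2 (h0 x)

/-! ### Tent integrals and the midpoint values of the Dirichlet solution. -/

/-- The integral of `f` against the tent at the midpoint opposite to `q_i`. -/
def midInt (q : Fin 3 → Plane) (f : SG q → ℝ) (i : Fin 3) : ℝ := ∫ x, mid q i x * f x ∂(mu q)

theorem midInt_eq {f : SG q → ℝ} (hf : Continuous f) (l : Fin 3) :
    midInt q f l = 1 / 3 * ∑ j, if j = l then 0 else harmInt q (fun x => f (F q j x)) (-(l + j)) := by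
  rw [midInt, integral_self_similar (f := fun x => mid q l x * f x) ((continuous_mid l).mul hf)]
  congr 1
  refine Finset.sum_congr rfl fun j _ => ?_
  simp only [mid_F]
  split_ifs
  · simp
  · rfl

theorem abs_midInt_le {f : SG q → ℝ} {B : ℝ} (h : ∀ x, |f x| ≤ B) (i : Fin 3) :
    |midInt q f i| ≤ B := by
  have := norm_integral_le_of_norm_le_const (μ := mu q) (C := B)
    (f := fun x => mid q i x * f x) (Eventually.of_forall fun x => ?_)
  · simpa [midInt] using this
  · have hm := mid_mem i x
    rw [norm_mul, Real.norm_of_nonneg hm.1]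
    calc _ ≤ 1 * |f x| := mul_le_mul_of_nonneg_right hm.2 (abs_nonneg _)
      _ ≤ B := by rw [one_mul]; exact h x

/-- The values at the midpoints of the solution of `-Δ u = f` that vanishes on the boundary. -/
def gcoef (q : Fin 3 → Plane) (f : SG q → ℝ) (k : Fin 3) : ℝ :=
  ∑ l, (if k = l then 9 / 50 else 3 / 50) * midInt q f l

theorem abs_gcoef_le {f : SG q → ℝ} {B : ℝ} (h : ∀ x, |f x| ≤ B) (k : Fin 3) :
    |gcoef q f k| ≤ B := by
  have hm := fun l => abs_le.mp (abs_midInt_le h l)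
  have h0 := hm 0
  have h1 := hm 1
  have h2 := hm 2
  rw [gcoef, Fin.sum_univ_three, abs_le]
  have hB : 0 ≤ B := (abs_nonneg _).trans (h (bdry q 0))
  fin_cases k <;> simp <;> constructor <;> linarith

end

section

variable {q : Fin 3 → Plane}

/-! ### The solution operator of the Dirichlet problem -/

/-- The boundary values on the `i`-th cell of the function with values `gcoef q f` at the
midpoints and zero boundary values. -/
def gval (q : Fin 3 → Plane) (f : SG q → ℝ) (i n : Fin 3) : ℝ :=
  if n = i then 0 else gcoef q f (-(i + n))

theorem gval_self (f : SG q → ℝ) (i : Fin 3) : gval q f i i = 0 := if_pos rfl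

theorem gval_comm (f : SG q → ℝ) (i j : Fin 3) : gval q f i j = gval q f j i := by
  unfold gval
  rw [add_comm i j]
  exact if_congr eq_comm rfl rfl

/-- Approximations of the solution of `-Δ u = f` with zero boundary values. -/
def solApprox (q : Fin 3 → Plane) : ℕ → (SG q → ℝ) → SG q → ℝ
  | 0, _ => fun _ => 0
  | n + 1, f => glue fun i x =>
      harm q (gval q f i) x + 1 / 5 * solApprox q n (fun y => f (F q i y)) x

/-- The solution of `-Δ u = f` with zero boundary values. -/
def sol (q : Fin 3 → Plane) (f : SG q → ℝ) (x : SG q) : ℝ :=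
  limUnder atTop fun n => solApprox q n f x

theorem exists_abs_le {f : SG q → ℝ} (hf : Continuous f) : ∃ B, ∀ x, |f x| ≤ B := by
  obtain ⟨C, hC⟩ := (isCompact_range hf).isBounded.exists_norm_le
  exact ⟨C, fun x => hC _ ⟨x, rfl⟩⟩

theorem ndiff_add (m : ℕ) (u v : SG q → ℝ) (n : Fin 3) :
    ndiff q m (fun x => u x + v x) n = ndiff q m u n + ndiff q m v n := by
  unfold ndiff
  ring

theorem ndiff_smul (m : ℕ) (c : ℝ) (u : SG q → ℝ) (n : Fin 3) :
    ndiff q m (fun x => c * u x) n = c * ndiff q m u n := by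
  unfold ndiff
  ring

theorem continuous_iterate_F (n : Fin 3) (m : ℕ) : Continuous (F q n)^[m] :=
  (continuous_F n).iterate m

variable [Equilateral q]

theorem abs_gval_le {f : SG q → ℝ} {B : ℝ} (h : ∀ x, |f x| ≤ B) (i n : Fin 3) :
    |gval q f i n| ≤ B := by
  unfold gval
  split_ifs
  · rw [abs_zero]
    exact (abs_nonneg _).trans (h (bdry q 0))
  · exact abs_gcoef_le h _

theorem abs_harm_le {a : Fin 3 → ℝ} {B : ℝ} (h : ∀ j, |a j| ≤ B) (x : SG q) :
    |harm q a x| ≤ B :=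
  abs_le.mpr (harm_mem (fun j => abs_le.mp (h j)) x)

theorem solApprox_bdry (n : ℕ) (f : SG q → ℝ) (j : Fin 3) : solApprox q n f (bdry q j) = 0 := by
  induction n generalizing f j with
  | zero => rfl
  | succ n ih =>
    rw [← F_bdry_self, solApprox, glue_F, ih, harm_bdry, gval_self]
    · ring
    · intro i k
      rw [ih, ih, harm_bdry, harm_bdry, gval_comm]

theorem solApprox_succ_F (n : ℕ) (f : SG q → ℝ) (i : Fin 3) (x : SG q) :
    solApprox q (n + 1) f (F q i x) =
      harm q (gval q f i) x + 1 / 5 * solApprox q n (fun y => f (F q i y)) x := by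
  rw [solApprox, glue_F]
  intro i k
  rw [solApprox_bdry, solApprox_bdry, harm_bdry, harm_bdry, gval_comm]

theorem continuous_solApprox (n : ℕ) (f : SG q → ℝ) : Continuous (solApprox q n f) := by
  induction n generalizing f with
  | zero => exact continuous_const
  | succ n ih =>
    refine continuous_of_comp_F fun i => ?_
    simp only [solApprox_succ_F]
    exact (continuous_harm _).add ((ih _).const_mul _)

/-- Each passage into a cell multiplies the difference by `1/5` and keeps the bound on `f`; the
first difference is a harmonic function with boundary values bounded by `B`. -/
theorem abs_solApprox_succ_sub_le {f : SG q → ℝ} {B : ℝ} (h : ∀ x, |f x| ≤ B) (n : ℕ)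
    (x : SG q) : |solApprox q (n + 1) f x - solApprox q n f x| ≤ B * (1 / 5) ^ n := by
  induction n generalizing f x with
  | zero =>
    obtain ⟨i, y, rfl⟩ := exists_F x
    rw [solApprox_succ_F]
    simpa [solApprox] using abs_harm_le (abs_gval_le h i) y
  | succ n ih =>
    obtain ⟨i, y, rfl⟩ := exists_F x
    rw [solApprox_succ_F, solApprox_succ_F, add_sub_add_left_eq_sub, ← mul_sub, abs_mul, pow_succ,
      abs_of_pos (by norm_num : (0 : ℝ) < 1 / 5)]
    have := ih (f := fun y => f (F q i y)) (fun x => h _) y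
    linarith

theorem tendsto_sol {f : SG q → ℝ} (hf : Continuous f) (x : SG q) :
    Tendsto (fun n => solApprox q n f x) atTop (𝓝 (sol q f x)) := by
  obtain ⟨B, hB⟩ := exists_abs_le hf
  refine CauchySeq.tendsto_limUnder
    (cauchySeq_of_le_geometric (1 / 5) B (by norm_num) fun n => ?_)
  rw [dist_comm]
  exact abs_solApprox_succ_sub_le hB n x

theorem continuous_sol {f : SG q → ℝ} (hf : Continuous f) : Continuous (sol q f) := by
  obtain ⟨B, hB⟩ := exists_abs_le hf
  exact continuous_of_geometric (r := 1 / 5) (by norm_num) (fun n => continuous_solApprox n f)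
    (fun n x => abs_solApprox_succ_sub_le hB n x) (tendsto_sol hf) (by norm_num)

theorem sol_bdry {f : SG q → ℝ} (hf : Continuous f) (j : Fin 3) : sol q f (bdry q j) = 0 := by
  refine tendsto_nhds_unique (tendsto_sol hf _) ?_
  simp only [solApprox_bdry]
  exact tendsto_const_nhds

theorem sol_F {f : SG q → ℝ} (hf : Continuous f) (i : Fin 3) (x : SG q) :
    sol q f (F q i x) = harm q (gval q f i) x + 1 / 5 * sol q (fun y => f (F q i y)) x := by
  refine tendsto_nhds_unique ((tendsto_add_atTop_iff_nat 1).mpr (tendsto_sol hf _)) ?_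
  simp only [solApprox_succ_F]
  exact ((tendsto_sol (hf.comp (continuous_F i)) x).const_mul _).const_add _

theorem abs_sol_le {f : SG q → ℝ} (hf : Continuous f) {B : ℝ} (h : ∀ x, |f x| ≤ B) (x : SG q) :
    |sol q f x| ≤ 2 * B := by
  have h1 := dist_le_of_le_geometric_of_tendsto₀ (1 / 5) B (by norm_num)
    (f := fun n => solApprox q n f x) (fun n => by
      rw [dist_comm]; exact abs_solApprox_succ_sub_le h n x) (tendsto_sol hf x)
  have hB : 0 ≤ B := (abs_nonneg _).trans (h x)
  rw [dist_comm, Real.dist_eq] at h1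
  simp only [solApprox, sub_zero] at h1
  refine h1.trans ?_
  rw [div_le_iff₀ (by norm_num)]
  linarith

/-- The self-similar identity determines the solution operator among bounded operators. -/
theorem eq_sol {T : (SG q → ℝ) → SG q → ℝ} {C : ℝ}
    (hT : ∀ f, Continuous f → ∀ i x, T f (F q i x) =
      harm q (gval q f i) x + 1 / 5 * T (fun y => f (F q i y)) x)
    (hC : ∀ f, Continuous f → ∀ B, (∀ x, |f x| ≤ B) → ∀ x, |T f x| ≤ C * B)
    {f : SG q → ℝ} (hf : Continuous f) (x : SG q) : T f x = sol q f x := by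
  obtain ⟨B, hB⟩ := exists_abs_le hf
  have key : ∀ n : ℕ, ∀ f : SG q → ℝ, Continuous f → (∀ x, |f x| ≤ B) → ∀ x,
      |T f x - sol q f x| ≤ (C + 2) * B * (1 / 5) ^ n := by
    intro n
    induction n with
    | zero =>
      intro f hf hB x
      have h1 := hC f hf B hB x
      have h2 := abs_sol_le hf hB x
      have h3 := abs_sub (T f x) (sol q f x)
      rw [pow_zero]
      linarith
    | succ n ih =>
      intro f hf hB x
      obtain ⟨i, y, rfl⟩ := exists_F x
      rw [hT f hf, sol_F hf, add_sub_add_left_eq_sub, ← mul_sub, abs_mul, pow_succ,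
        abs_of_pos (by norm_num : (0 : ℝ) < 1 / 5)]
      have := ih (fun y => f (F q i y)) (hf.comp (continuous_F i)) (fun x => hB _) y
      linarith
  have ht : Tendsto (fun n : ℕ => (C + 2) * B * (1 / 5 : ℝ) ^ n) atTop (𝓝 0) := by
    simpa using (tendsto_pow_atTop_nhds_zero_of_lt_one (r := (1 / 5 : ℝ)) (by norm_num)
      (by norm_num)).const_mul ((C + 2) * B)
  have h0 : |T f x - sol q f x| ≤ 0 := ge_of_tendsto' ht fun n => key n f hf hB x
  exact sub_eq_zero.mp (abs_nonpos_iff.mp h0)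

/-- A finite linear relation between integrals over the three first-level cells, relying on the
exact weights `9/50` and `3/50`. It is the inductive step of `ndiff_sol`. -/
theorem gcoef_balance {f : SG q → ℝ} (hf : Continuous f) (n : Fin 3) :
    5 * (gval q f n (n + 1) + gval q f n (n - 1)) + harmInt q (fun x => f (F q n x)) n =
      3 * harmInt q f n := by
  rw [harmInt_self_similar hf]
  simp only [gval, gcoef, midInt_eq hf, Fin.sum_univ_three]
  fin_cases n <;> simp [hext, fin3_arith] <;> ring

/-- With midpoint values `g`, the left side at the midpoint opposite to `q_k` is `4 g_k - g_i -
g_j`. The matrix `5I - E` (`E` the all-ones matrix) has inverse entries `3/10` on and `1/10` off the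
diagonal; times `3/5` these are the Green coefficients `9/50` and `3/50`. So `gcoef` solves this
system with right side `3/5` of the tent integrals. -/
theorem gcoef_matching {f : SG q → ℝ} (hf : Continuous f) {i j : Fin 3} (hij : i ≠ j) :
    2 * gval q f i j - gval q f i (j + 1) - gval q f i (j - 1) +
      (2 * gval q f j i - gval q f j (i + 1) - gval q f j (i - 1)) =
    1 / 5 * (harmInt q (fun x => f (F q i x)) j + harmInt q (fun x => f (F q j x)) i) := by
  simp only [gval, gcoef, midInt_eq hf, Fin.sum_univ_three]
  fin_cases i <;> fin_cases j <;> simp [fin3_arith] at hij ⊢ <;> ring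

/-- An exact discrete Gauss–Green formula. The term with `3^m` carries the normal derivative and
cancels between the two cells at a junction; the second term stays bounded and recovers the local
value of `f`. -/
theorem ndiff_sol {f : SG q → ℝ} (hf : Continuous f) (m : ℕ) (n : Fin 3) :
    5 ^ m * ndiff q m (sol q f) n =
      -(3 ^ m * harmInt q f n) + harmInt q (fun x => f ((F q n)^[m] x)) n := by
  induction m generalizing f with
  | zero => simp [ndiff, sol_bdry hf]
  | succ m ih =>
    rw [ndiff_succ]
    simp only [sol_F hf]
    rw [ndiff_add, ndiff_smul, ndiff_harm, gval_self]
    have h1 := ih (f := fun x => f (F q n x)) (hf.comp (continuous_F n))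
    have h2 := gcoef_balance hf n
    have e : (5 : ℝ) ^ m * (3 / 5) ^ m = 3 ^ m := by rw [← mul_pow]; norm_num
    simp only [Function.iterate_succ_apply']
    calc _ = -(5 * ((5 : ℝ) ^ m * (3 / 5) ^ m) * (gval q f n (n + 1) + gval q f n (n - 1))) +
          5 ^ m * ndiff q m (sol q fun y => f (F q n y)) n := by rw [pow_succ]; ring
      _ = _ := by rw [e, h1, pow_succ]; linear_combination (-(3 : ℝ) ^ m) * h2

/-- Descending into cells reduces to a junction: the harmonic part drops out there and the factor
`1/5` is absorbed by the power of `5`. At a junction the surviving terms are averages of `f` over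
two small cells touching it, so the error is at most the oscillation of `f` on cells. -/
theorem abs_lap_sol_le (m : ℕ) {f : SG q → ℝ} (hf : Continuous f) {δ : ℝ}
    (h : ∀ w : List (Fin 3), w.length = m → ∀ x y, |f (Fw q w x) - f (Fw q w y)| ≤ δ)
    {x : SG q} (hx : x ∈ V q m \ V q 0) :
    |(3 / 2 : ℝ) * 5 ^ m * graphLap q m (sol q f) x + f x| ≤ δ := by
  induction m generalizing f x with
  | zero => simp at hx
  | succ m ih =>
    obtain ⟨i, y, hy, rfl⟩ | ⟨i, j, hij, rfl⟩ := interior_cases hx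
    · rw [graphLap_F (Finset.mem_sdiff.mp hy).2]
      simp only [sol_F hf]
      rw [graphLap_add, graphLap_harm hy, graphLap_smul, pow_succ]
      have := ih (f := fun x => f (F q i x)) (hf.comp (continuous_F i))
        (fun w hw => h (i :: w) (by simp [hw])) hy
      convert this using 2
      ring
    · rw [graphLap_mid m _ hij]
      simp only [sol_F hf]
      rw [ndiff_add, ndiff_smul, ndiff_harm, ndiff_add, ndiff_smul, ndiff_harm]
      have e1 := ndiff_sol (f := fun x => f (F q i x)) (hf.comp (continuous_F i)) m j
      have e2 := ndiff_sol (f := fun x => f (F q j x)) (hf.comp (continuous_F j)) m i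
      have e3 := gcoef_matching hf hij
      have e : (5 : ℝ) ^ m * (3 / 5) ^ m = 3 ^ m := by rw [← mul_pow]; norm_num
      -- The points `F_k F_l^m x` fill the cell of level `m + 1` with the junction as a corner,
      -- where `f` differs from its value at the junction by at most `δ`.
      have hmem : ∀ k l : Fin 3, F q k (bdry q l) = F q i (bdry q j) → ∀ x,
          f (F q i (bdry q j)) - δ ≤ f (F q k ((F q l)^[m] x)) ∧
          f (F q k ((F q l)^[m] x)) ≤ f (F q i (bdry q j)) + δ := by
        intro k l hkl x
        have h1 := h (k :: List.replicate m l) (by simp) x (bdry q l)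
        simp only [Fw, Function.comp_apply, Fw_replicate, iterate_F_bdry_self] at h1
        rw [hkl, abs_le] at h1
        constructor <;> linarith
      have m1 := harmInt_mem (f := fun x => f (F q i ((F q j)^[m] x))) 
        (hf.comp ((continuous_F i).comp (continuous_iterate_F j m))) (hmem i j rfl) j
      have m2 := harmInt_mem (f := fun x => f (F q j ((F q i)^[m] x))) 
        (hf.comp ((continuous_F j).comp (continuous_iterate_F i m)))
        (hmem j i (F_bdry_comm j i)) i
      -- The terms of size `3^m` cancel by `gcoef_matching`, leaving only the two local averages.
      have key : (5 : ℝ) ^ (m + 1) * -((3 / 5) ^ m * (2 * gval q f i j - gval q f i (j + 1) -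
          gval q f i (j - 1)) + 1 / 5 * ndiff q m (sol q fun y => f (F q i y)) j +
          ((3 / 5) ^ m * (2 * gval q f j i - gval q f j (i + 1) -
          gval q f j (i - 1)) + 1 / 5 * ndiff q m (sol q fun y => f (F q j y)) i)) =
          -(harmInt q (fun x => f (F q i ((F q j)^[m] x))) j +
            harmInt q (fun x => f (F q j ((F q i)^[m] x))) i) := by
        calc _ = -(5 * ((5 : ℝ) ^ m * (3 / 5) ^ m) * (2 * gval q f i j - gval q f i (j + 1) -
              gval q f i (j - 1) + (2 * gval q f j i - gval q f j (i + 1) - gval q f j (i - 1))))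
              - (5 ^ m * ndiff q m (sol q fun y => f (F q i y)) j)
              - (5 ^ m * ndiff q m (sol q fun y => f (F q j y)) i) := by
              rw [pow_succ]; ring
          _ = _ := by
              rw [e, e1, e2, e3]; ring
      -- Each average has total weight `1/3`, and `3/2 * (1/3 + 1/3) = 1`: this is why the Laplacian
      -- is normalized by `3/2`.
      rw [mul_assoc, key, abs_le]
      constructor <;> linarith

theorem hasLaplacian_sol {f : SG q → ℝ} (hf : Continuous f) :
    HasLaplacian q (fun x => -sol q f x) f := by
  refine ⟨(continuous_sol hf).neg, hf, fun ε hε => ?_⟩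
  obtain ⟨M, hM⟩ := exists_level_osc_le hf (half_pos hε)
  refine ⟨M, fun m hm x hx => ?_⟩
  have h := abs_lap_sol_le m hf (fun w hw x y => (hM w (hw ▸ hm) x y).le) hx
  have e : graphLap q m (fun x => -sol q f x) x = -graphLap q m (sol q f) x := by
    have := graphLap_smul m (-1) (sol q f) x
    simpa using this
  rw [e, ← abs_neg]
  refine lt_of_le_of_lt (le_of_eq ?_) (h.trans_lt (half_lt_self hε))
  congr 1
  ring

/-! ### Uniqueness -/

/-- Maximum principle: a small multiple of a function with Laplacian `1` makes the Laplacian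
strictly positive, which excludes a maximum at a non-boundary vertex; then the perturbation tends to
zero. -/
theorem le_zero_of_hasLaplacian_zero {u : SG q → ℝ} (hu : HasLaplacian q u (fun _ => 0))
    (h0 : ∀ i, u (bdry q i) = 0) (x : SG q) : u x ≤ 0 := by
  set φ : SG q → ℝ := fun x => -sol q (fun _ => 1) x with hφ
  have hφL : HasLaplacian q φ (fun _ => 1) := hasLaplacian_sol continuous_const
  have hφ2 : ∀ x, -2 ≤ φ x := fun x => by
    have := abs_sol_le (q := q) (f := fun _ => 1) continuous_const (B := 1) (by simp) x
    rw [abs_le] at this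
    simp only [hφ]
    linarith
  refine le_of_forall_pos_le_add fun ε hε => ?_
  have hv : HasLaplacian q (fun x => u x + ε / 2 * φ x) (fun _ => 0 + ε / 2 * 1) :=
    hu.add (hφL.smul (ε / 2))
  set v : SG q → ℝ := fun x => u x + ε / 2 * φ x with hvdef
  have hv0 : ∀ i, v (bdry q i) = 0 := fun i => by
    simp only [hvdef, hφ, h0, sol_bdry (q := q) (f := fun _ => 1) continuous_const]
    ring
  -- The limit is `ε / 2`, so an error below `ε / 2` keeps the rescaled graph Laplacian positive.
  -- The final bound is `u ≤ ε` because `φ ≥ -2`.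
  obtain ⟨M, hM⟩ := hv.2.2 (ε / 2) (by linarith)
  have hVle : ∀ m, M ≤ m → ∀ y ∈ V q m, v y ≤ 0 := by
    intro m hm
    obtain ⟨z, hz, hmax⟩ := Finset.exists_max_image (V q m) v ⟨_, bdry_mem_V m 0⟩
    suffices hz0 : z ∈ V q 0 by
      obtain ⟨i, rfl⟩ := mem_V_zero.mp hz0
      intro y hy
      rw [← hv0 i]
      exact hmax y hy
    by_contra hz0
    have h1 := hM m hm z (Finset.mem_sdiff.mpr ⟨hz, hz0⟩)
    have h2 : graphLap q m v z ≤ 0 := by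
      rw [graphLap_eq]
      refine Finset.sum_nonpos fun y hy => ?_
      have := hmax y (mem_nbrs.mp hy).1
      linarith
    have h3 : (3 / 2 : ℝ) * 5 ^ m * graphLap q m v z ≤ 0 :=
      mul_nonpos_of_nonneg_of_nonpos (by positivity) h2
    have h4 := (abs_lt.mp h1).1
    linarith
  have hvle : v x ≤ 0 := by
    have hcl : IsClosed {y | v y ≤ 0} := isClosed_le hv.1 continuous_const
    have hsub : {y : SG q | ∃ m, y ∈ V q m \ V q 0} ⊆ {y | v y ≤ 0} := by
      rintro y ⟨m, hy⟩
      exact hVle (max M m) (le_max_left _ _) y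
        (V_mono (le_max_right _ _) (Finset.mem_sdiff.mp hy).1)
    have := hcl.closure_subset_iff.mpr hsub
    rw [(dense_interior q).closure_eq] at this
    exact this (Set.mem_univ x)
  have := hφ2 x
  simp only [hvdef] at hvle
  nlinarith

theorem HasLaplacian.eq_of_bdry {u v f : SG q → ℝ} (hu : HasLaplacian q u f)
    (hv : HasLaplacian q v f) (h : ∀ i, u (bdry q i) = v (bdry q i)) : u = v := by
  have key : ∀ u v : SG q → ℝ, HasLaplacian q u f → HasLaplacian q v f →
      (∀ i, u (bdry q i) = v (bdry q i)) → ∀ x, u x ≤ v x := by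
    intro u v hu hv h x
    have h1 := hu.sub hv
    simp only [sub_self] at h1
    have := le_zero_of_hasLaplacian_zero h1 (fun i => sub_eq_zero.mpr (h i)) x
    linarith
  funext x
  exact le_antisymm (key u v hu hv h x) (key v u hv hu (fun i => (h i).symm) x)

theorem eq_harm {u : SG q → ℝ} (hu : Harmonic q u) : u = harm q (fun j => u (bdry q j)) :=
  HasLaplacian.eq_of_bdry hu (hasLaplacian_harm _) fun i =>
    (harm_bdry (fun j => u (bdry q j)) i).symm

end

section

variable {q : Fin 3 → Plane}

/-! ### Tents -/

theorem IsTent.bdry_eq_zero {m : ℕ} {z : SG q} {u : SG q → ℝ} (hu : IsTent q m z u)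
    (hz : z ∉ V q 0) (k : Fin 3) : u (bdry q k) = 0 := by
  rw [hu.2.2.1 _ (bdry_mem_V m k), if_neg]
  rintro rfl
  exact hz (bdry_mem_V 0 k)

theorem notMem_V_zero_of_sdiff {m : ℕ} {z : SG q} (hz : z ∈ V q (m + 1) \ V q m) : z ∉ V q 0 :=
  fun h => (Finset.mem_sdiff.mp hz).2 (V_zero_subset m h)

theorem sameCell_symm {m : ℕ} {x y : SG q} (h : SameCell q m x y) : SameCell q m y x := by
  obtain ⟨w, hw, hx, hy⟩ := h
  exact ⟨w, hw, hy, hx⟩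

theorem greenCoeff_symm (m : ℕ) (z z' : SG q) : greenCoeff q m z z' = greenCoeff q m z' z := by
  unfold greenCoeff
  have h : SameCell q (m + 1) z z' ↔ SameCell q (m + 1) z' z := ⟨sameCell_symm, sameCell_symm⟩
  by_cases hz : z = z'
  · rw [hz]
  · rw [if_neg hz, if_neg (Ne.symm hz), if_congr h rfl rfl]

/-- The contribution of level `m` to Green's function. -/
def greenTerm (q : Fin 3 → Plane) (m : ℕ) (x y : SG q) : ℝ :=
  ∑ z ∈ V q (m + 1) \ V q m, ∑ z' ∈ V q (m + 1) \ V q m,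
    greenCoeff q m z z' * psi q (m + 1) z x * psi q (m + 1) z' y

theorem greenPartial_eq (M : ℕ) (x y : SG q) :
    greenPartial q M x y = ∑ m ∈ Finset.range (M + 1), greenTerm q m x y := rfl

theorem greenTerm_symm (m : ℕ) (x y : SG q) : greenTerm q m x y = greenTerm q m y x := by
  rw [greenTerm, greenTerm, Finset.sum_comm]
  refine Finset.sum_congr rfl fun z _ => Finset.sum_congr rfl fun z' _ => ?_
  rw [greenCoeff_symm]
  ring

variable [Equilateral q]

/-- On each cell of level `m` both functions are harmonic with the same corner values. Hence any
explicit tent equals the chosen `psi`. -/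
theorem IsTent.unique {m : ℕ} {z : SG q} {u v : SG q → ℝ} (hu : IsTent q m z u)
    (hv : IsTent q m z v) : u = v := by
  funext x
  obtain ⟨w, y, hw, rfl⟩ := exists_Fw m x
  have h : u ∘ Fw q w = v ∘ Fw q w := by
    refine HasLaplacian.eq_of_bdry (hu.2.1 w hw) (hv.2.1 w hw) fun i => ?_
    have hV : Fw q w (bdry q i) ∈ V q m := hw ▸ Fw_bdry_mem_V w i
    simp only [Function.comp_apply, hu.2.2.1 _ hV, hv.2.2.1 _ hV]
  exact congrFun h y

theorem IsTent.psi_eq {m : ℕ} {z : SG q} {u : SG q → ℝ} (hu : IsTent q m z u) :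
    psi q m z = u :=
  (Classical.epsilon_spec (p := IsTent q m z) ⟨u, hu⟩).unique hu

/-! ### Tents at the new vertices of each level. -/

/-- The midpoint opposite to `q_i`. -/
def midpt (q : Fin 3 → Plane) (i : Fin 3) : SG q := F q (i + 1) (bdry q (i + 2))

theorem F_bdry_eq_iff {j k j' k' : Fin 3} : F q j (bdry q k) = F q j' (bdry q k') ↔
    (j = j' ∧ k = k') ∨ (j = k' ∧ k = j') := by
  constructor
  · intro h
    by_cases hj : j = j'
    · subst hj
      exact Or.inl ⟨rfl, bdry_injective (F_injective j h)⟩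
    · obtain ⟨h1, h2⟩ := F_eq_F hj h
      exact Or.inr ⟨(bdry_injective h2).symm, bdry_injective h1⟩
  · rintro (⟨rfl, rfl⟩ | ⟨rfl, rfl⟩)
    · rfl
    · exact F_bdry_comm _ _

theorem F_bdry_eq_midpt_iff {i j k : Fin 3} :
    F q j (bdry q k) = midpt q i ↔ j ≠ i ∧ k = -(i + j) := by
  rw [midpt, F_bdry_eq_iff]
  revert i j k
  decide

theorem midpt_injective : Function.Injective (midpt q) := by
  intro i j h
  rw [midpt, F_bdry_eq_midpt_iff] at h
  revert h
  revert i j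
  decide

theorem midpt_mem (i : Fin 3) : midpt q i ∈ V q 1 \ V q 0 := by
  refine Finset.mem_sdiff.mpr ⟨F_mem_V _ (bdry_mem_V 0 _), F_bdry_notMem_V_zero ?_⟩
  revert i
  decide

theorem V_one_sdiff : V q 1 \ V q 0 = Finset.univ.image (midpt q) := by
  ext x
  rw [Finset.mem_image]
  constructor
  · intro h
    obtain ⟨i, y, hy, rfl⟩ | ⟨i, j, hij, rfl⟩ := interior_cases h
    · simp at hy
    · refine ⟨-(i + j), Finset.mem_univ _, (F_bdry_eq_midpt_iff.mpr ?_).symm⟩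
      clear h
      revert hij
      revert i j
      decide
  · rintro ⟨i, -, rfl⟩
    exact midpt_mem i

theorem isTent_mid (i : Fin 3) : IsTent q 1 (midpt q i) (mid q i) := by
  refine ⟨continuous_mid i, fun w hw => ?_, fun x hx => ?_, fun x hx => ?_⟩
  · obtain ⟨j, rfl⟩ := List.length_eq_one_iff.mp hw
    have e : mid q i ∘ Fw q [j] =
        if j = i then fun _ => 0 else harm q (Pi.single (-(i + j)) 1) := by
      funext x
      simp only [Fw, Function.comp_apply, id_eq, mid_F]
      split_ifs <;> rfl
    rw [e]
    split_ifs
    · exact hasLaplacian_zero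
    · exact hasLaplacian_harm _
  · obtain ⟨j, y, hy, rfl⟩ := mem_V_succ.mp hx
    obtain ⟨k, rfl⟩ := mem_V_zero.mp hy
    simp only [mid_F, F_bdry_eq_midpt_iff, harm_bdry, Pi.single_apply]
    split_ifs <;> tauto
  · obtain ⟨j, y, rfl⟩ := exists_F x
    rw [mid_F]
    split_ifs with hj
    · rfl
    · refine absurd (sameCell_succ.mpr ⟨j, bdry q (-(i + j)), y, ?_, rfl, sameCell_zero _ _⟩) hx
      exact (F_bdry_eq_midpt_iff.mpr ⟨hj, rfl⟩).symm

/-- The function supported on the cell number `i` that is a copy of `u` there. -/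
def extend (i : Fin 3) (u : SG q → ℝ) : SG q → ℝ := glue fun j => if j = i then u else 0

theorem extend_F {u : SG q → ℝ} (hu : ∀ k, u (bdry q k) = 0) (i j : Fin 3) (x : SG q) :
    extend i u (F q j x) = if j = i then u x else 0 := by
  rw [extend, glue_F]
  · split_ifs <;> rfl
  · intro a b
    split_ifs <;> simp [hu]

/-- A tent at a non-boundary vertex vanishes at the three corners, so its copy in one cell glues
with zero on the others. -/
theorem IsTent.extend {m : ℕ} {z : SG q} {u : SG q → ℝ} (hu : IsTent q m z u)
    (hz : z ∉ V q 0) (i : Fin 3) :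
    IsTent q (m + 1) (F q i z) (SierpinskiGasket.extend i u) := by
  have hF := extend_F (hu.bdry_eq_zero hz) i
  refine ⟨continuous_of_comp_F fun j => ?_, fun w hw => ?_, fun x hx => ?_, fun x hx => ?_⟩
  · simp only [hF]
    split_ifs
    · exact hu.1
    · exact continuous_const
  · match w, hw with
    | j :: w, hw =>
      have e : SierpinskiGasket.extend i u ∘ Fw q (j :: w) =
          if j = i then u ∘ Fw q w else fun _ => 0 := by
        funext x
        simp only [Fw, Function.comp_apply, hF]
        split_ifs <;> rfl
      rw [e]
      split_ifs
      · exact hu.2.1 w (by simpa using hw)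
      · exact hasLaplacian_zero
  · obtain ⟨j, y, hy, rfl⟩ := mem_V_succ.mp hx
    rw [hF]
    by_cases hj : j = i
    · subst hj
      rw [if_pos rfl, hu.2.2.1 y hy]
      exact if_congr (F_injective j).eq_iff.symm rfl rfl
    · rw [if_neg hj, if_neg]
      intro h
      rw [(F_eq_F hj h).2] at hz
      exact hz (bdry_mem_V 0 _)
  · obtain ⟨j, y, rfl⟩ := exists_F x
    rw [hF]
    split_ifs with hj
    · subst hj
      exact hu.2.2.2 y fun h => hx (sameCell_succ.mpr ⟨j, z, y, rfl, rfl, h⟩)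
    · rfl

theorem V_sdiff_succ (m : ℕ) : V q (m + 2) \ V q (m + 1) =
    Finset.univ.biUnion fun i => (V q (m + 1) \ V q m).image (F q i) := by
  ext x
  simp only [Finset.mem_sdiff, Finset.mem_biUnion, Finset.mem_univ, true_and, Finset.mem_image]
  constructor
  · rintro ⟨h1, h2⟩
    obtain ⟨i, y, hy, rfl⟩ := mem_V_succ.mp h1
    exact ⟨i, y, ⟨hy, fun h => h2 (F_mem_V i h)⟩, rfl⟩
  · rintro ⟨i, y, ⟨h1, h2⟩, rfl⟩
    exact ⟨F_mem_V i h1, fun h => h2 (F_mem_V_iff.mp h)⟩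

theorem sum_V_sdiff_succ (m : ℕ) (h : SG q → ℝ) :
    ∑ z ∈ V q (m + 2) \ V q (m + 1), h z =
      ∑ i, ∑ z ∈ V q (m + 1) \ V q m, h (F q i z) := by
  rw [V_sdiff_succ, Finset.sum_biUnion]
  · exact Finset.sum_congr rfl fun i _ => Finset.sum_image (F_injective i).injOn
  · intro i _ j _ hij
    rw [Function.onFun, Finset.disjoint_left]
    intro x h1 h2
    obtain ⟨a, ha, rfl⟩ := Finset.mem_image.mp h1
    obtain ⟨b, hb, hab⟩ := Finset.mem_image.mp h2
    refine notMem_V_zero_of_sdiff ha ?_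
    rw [(F_eq_F hij hab.symm).1]
    exact bdry_mem_V 0 j

/-- Every new vertex is the image of a first-level midpoint under a word, so all these tents arise
from the three midpoint tents by repeated extension. -/
theorem isTent_psi {m : ℕ} {z : SG q} (hz : z ∈ V q (m + 1) \ V q m) :
    IsTent q (m + 1) z (psi q (m + 1) z) := by
  suffices h : ∃ u, IsTent q (m + 1) z u from Classical.epsilon_spec h
  induction m generalizing z with
  | zero =>
    rw [V_one_sdiff] at hz
    obtain ⟨i, -, rfl⟩ := Finset.mem_image.mp hz
    exact ⟨_, isTent_mid i⟩
  | succ m ih =>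
    rw [V_sdiff_succ] at hz
    simp only [Finset.mem_biUnion, Finset.mem_univ, true_and, Finset.mem_image] at hz
    obtain ⟨i, y, hy, rfl⟩ := hz
    obtain ⟨u, hu⟩ := ih hy
    exact ⟨_, hu.extend (notMem_V_zero_of_sdiff hy) i⟩

theorem psi_one (i : Fin 3) : psi q 1 (midpt q i) = mid q i := (isTent_mid i).psi_eq

theorem psi_F {m : ℕ} {z : SG q} (hz : z ∈ V q (m + 1) \ V q m) (i j : Fin 3) (x : SG q) :
    psi q (m + 2) (F q i z) (F q j x) = if j = i then psi q (m + 1) z x else 0 := by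
  have h := isTent_psi hz
  have h0 := notMem_V_zero_of_sdiff hz
  rw [(h.extend h0 i).psi_eq, extend_F (h.bdry_eq_zero h0)]

/-! ### Green's function -/

theorem greenCoeff_F {m : ℕ} {z z' : SG q} (hz : z ∉ V q 0) (hz' : z' ∉ V q 0) (i j : Fin 3) :
    greenCoeff q (m + 1) (F q i z) (F q j z') =
      if i = j then 3 / 5 * greenCoeff q m z z' else 0 := by
  have hc : SameCell q (m + 2) (F q i z) (F q j z') ↔ i = j ∧ SameCell q (m + 1) z z' := by
    constructor
    · intro h
      obtain ⟨l, x', y', h1, h2, h3⟩ := sameCell_succ.mp h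
      have e1 : i = l := by
        by_contra hne
        rw [(F_eq_F hne h1).1] at hz
        exact hz (bdry_mem_V 0 _)
      have e2 : j = l := by
        by_contra hne
        rw [(F_eq_F hne h2).1] at hz'
        exact hz' (bdry_mem_V 0 _)
      subst e1
      subst e2
      rw [F_injective _ h1, F_injective _ h2]
      exact ⟨rfl, h3⟩
    · rintro ⟨rfl, h⟩
      exact sameCell_succ.mpr ⟨i, z, z', rfl, rfl, h⟩
  unfold greenCoeff
  by_cases hij : i = j
  · subst hij
    simp only [(F_injective i).eq_iff, hc, true_and, if_true, pow_succ]
    split_ifs <;> ring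
  · have hne : F q i z ≠ F q j z' := by
      intro h
      rw [(F_eq_F hij h).1] at hz
      exact hz (bdry_mem_V 0 _)
    rw [if_neg hne, if_neg (fun h => hij (hc.mp h).1), if_neg hij]

theorem greenTerm_zero (x y : SG q) : greenTerm q 0 x y =
    ∑ k, ∑ l, (if k = l then 9 / 50 else 3 / 50) * mid q k x * mid q l y := by
  have hc : ∀ k l, greenCoeff q 0 (midpt q k) (midpt q l) = if k = l then 9 / 50 else 3 / 50 := by
    intro k l
    have hs : SameCell q 1 (midpt q k) (midpt q l) := by
      have : ∀ k l : Fin 3, ∃ j, j ≠ k ∧ j ≠ l := by decide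
      obtain ⟨j, hk, hl⟩ := this k l
      exact sameCell_succ.mpr ⟨j, bdry q (-(k + j)), bdry q (-(l + j)),
        (F_bdry_eq_midpt_iff.mpr ⟨hk, rfl⟩).symm, (F_bdry_eq_midpt_iff.mpr ⟨hl, rfl⟩).symm,
        sameCell_zero _ _⟩
    unfold greenCoeff
    rw [zero_add, if_pos hs, if_congr midpt_injective.eq_iff rfl rfl, pow_zero, mul_one, mul_one]
  rw [greenTerm, zero_add, V_one_sdiff, Finset.sum_image midpt_injective.injOn]
  refine Finset.sum_congr rfl fun k _ => ?_
  rw [Finset.sum_image midpt_injective.injOn]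
  refine Finset.sum_congr rfl fun l _ => ?_
  rw [hc, psi_one, psi_one]

/-- A tent at a new vertex of level at least two lives in one first-level cell, new vertices in
different first-level cells are uncoupled, and the coefficients scale by `3/5`. Convergence and
self-similarity of Green's function follow from this. -/
theorem greenTerm_succ_F (m : ℕ) (i j : Fin 3) (x y : SG q) :
    greenTerm q (m + 1) (F q i x) (F q j y) =
      if i = j then 3 / 5 * greenTerm q m x y else 0 := by
  have h : ∀ a, ∀ z ∈ V q (m + 1) \ V q m, ∀ b, ∀ z' ∈ V q (m + 1) \ V q m,
      greenCoeff q (m + 1) (F q a z) (F q b z') * psi q (m + 2) (F q a z) (F q i x) *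
        psi q (m + 2) (F q b z') (F q j y) =
      if i = a then if j = b then if i = j then
        3 / 5 * (greenCoeff q m z z' * psi q (m + 1) z x * psi q (m + 1) z' y)
        else 0 else 0 else 0 := by
    intro a z hz b z' hz'
    rw [psi_F hz, psi_F hz', greenCoeff_F (notMem_V_zero_of_sdiff hz) (notMem_V_zero_of_sdiff hz')]
    by_cases h1 : i = a
    · by_cases h2 : j = b
      · subst h1 h2
        split_ifs <;> ring
      · simp [h2]
    · simp [h1]
  rw [greenTerm, sum_V_sdiff_succ]
  simp only [sum_V_sdiff_succ]
  rw [Finset.sum_eq_single i]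
  · rw [greenTerm]
    split_ifs with hij
    · rw [Finset.mul_sum]
      refine Finset.sum_congr rfl fun z hz => ?_
      rw [Finset.sum_eq_single j, Finset.mul_sum]
      · refine Finset.sum_congr rfl fun z' hz' => ?_
        rw [h i z hz j z' hz', if_pos rfl, if_pos rfl, if_pos hij]
      · intro b _ hb
        refine Finset.sum_eq_zero fun z' hz' => ?_
        rw [h i z hz b z' hz', if_pos rfl, if_neg hb.symm]
      · simp
    · refine Finset.sum_eq_zero fun z hz => Finset.sum_eq_zero fun b _ =>
        Finset.sum_eq_zero fun z' hz' => ?_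
      rw [h i z hz b z' hz', if_pos rfl, if_neg hij, ite_self]
  · intro a _ ha
    refine Finset.sum_eq_zero fun z hz => Finset.sum_eq_zero fun b _ =>
        Finset.sum_eq_zero fun z' hz' => ?_
    rw [h a z hz b z' hz', if_neg ha.symm]
  · simp

theorem abs_greenTerm_le (m : ℕ) (x y : SG q) : |greenTerm q m x y| ≤ 2 * (3 / 5) ^ m := by
  induction m generalizing x y with
  | zero =>
    rw [greenTerm_zero, pow_zero, mul_one]
    have hle : ∀ k l : Fin 3,
        |(if k = l then 9 / 50 else 3 / 50) * mid q k x * mid q l y| ≤ (9 / 50 : ℝ) := by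
      intro k l
      have h1 := mid_mem k x
      have h2 := mid_mem l y
      rw [mul_assoc, abs_mul, abs_of_nonneg (mul_nonneg h1.1 h2.1)]
      have h3 : mid q k x * mid q l y ≤ 1 := mul_le_one₀ h1.2 h2.1 h2.2
      have h4 : |if k = l then (9 / 50 : ℝ) else 3 / 50| ≤ 9 / 50 := by
        split_ifs <;> norm_num [abs_of_pos]
      calc _ ≤ (9 / 50 : ℝ) * 1 := by gcongr; exact mul_nonneg h1.1 h2.1
        _ = _ := mul_one _
    calc _ ≤ ∑ k : Fin 3, ∑ l : Fin 3, (9 / 50 : ℝ) :=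
          (Finset.abs_sum_le_sum_abs _ _).trans (Finset.sum_le_sum fun k _ =>
            (Finset.abs_sum_le_sum_abs _ _).trans (Finset.sum_le_sum fun l _ => hle k l))
      -- Nine terms of size at most `9/50` add up to `81/50`.
      _ ≤ 2 := by simp; norm_num
  | succ m ih =>
    obtain ⟨i, x, rfl⟩ := exists_F x
    obtain ⟨j, y, rfl⟩ := exists_F y
    rw [greenTerm_succ_F]
    split_ifs
    · rw [abs_mul, abs_of_pos (by norm_num : (0 : ℝ) < 3 / 5), pow_succ]
      have := ih x y
      linarith
    · rw [abs_zero]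
      positivity

theorem abs_greenPartial_succ_sub_le (M : ℕ) (x y : SG q) :
    |greenPartial q (M + 1) x y - greenPartial q M x y| ≤ 2 * (3 / 5) ^ M := by
  rw [greenPartial_eq, greenPartial_eq, Finset.sum_range_succ _ (M + 1), add_sub_cancel_left]
  refine (abs_greenTerm_le _ _ _).trans ?_
  have : (0 : ℝ) ≤ (3 / 5) ^ M := by positivity
  rw [pow_succ]
  linarith

theorem tendsto_green (x y : SG q) :
    Tendsto (fun M => greenPartial q M x y) atTop (𝓝 (green q x y)) := by
  refine CauchySeq.tendsto_limUnder
    (cauchySeq_of_le_geometric (3 / 5) 2 (by norm_num) fun n => ?_)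
  rw [dist_comm]
  exact abs_greenPartial_succ_sub_le n x y

theorem continuous_green : Continuous (Function.uncurry (green q)) := by
  refine continuous_of_geometric (r := 3 / 5) (by norm_num)
    (u := fun M (p : SG q × SG q) => greenPartial q M p.1 p.2) (fun M => ?_)
    (fun M p => abs_greenPartial_succ_sub_le M p.1 p.2) (fun p => tendsto_green p.1 p.2)
    (by norm_num)
  simp only [greenPartial_eq, greenTerm]
  refine continuous_finsetSum _ fun m _ => continuous_finsetSum _ fun z hz =>
    continuous_finsetSum _ fun z' hz' => ?_
  exact (continuous_const.mul ((isTent_psi hz).1.comp continuous_fst)).mul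
    ((isTent_psi hz').1.comp continuous_snd)

theorem continuous_green_right (x : SG q) : Continuous (green q x) :=
  continuous_green.uncurry_left x

theorem green_symm (x y : SG q) : green q x y = green q y x := by
  refine tendsto_nhds_unique (tendsto_green x y) ?_
  simp only [greenPartial_eq, greenTerm_symm _ x y]
  exact tendsto_green y x

theorem green_F (i j : Fin 3) (x y : SG q) : green q (F q i x) (F q j y) =
    greenTerm q 0 (F q i x) (F q j y) + if i = j then 3 / 5 * green q x y else 0 := by
  refine tendsto_nhds_unique ((tendsto_add_atTop_iff_nat 1).mpr (tendsto_green _ _)) ?_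
  have h : ∀ M, greenPartial q (M + 1) (F q i x) (F q j y) = greenTerm q 0 (F q i x) (F q j y) +
      if i = j then 3 / 5 * greenPartial q M x y else 0 := by
    intro M
    rw [greenPartial_eq, Finset.sum_range_succ', add_comm]
    simp only [greenTerm_succ_F, greenPartial_eq]
    split_ifs
    · rw [Finset.mul_sum]
    · simp
  simp only [h]
  refine tendsto_const_nhds.add ?_
  split_ifs
  · exact (tendsto_green x y).const_mul _
  · exact tendsto_const_nhds

theorem integral_greenTerm_zero {f : SG q → ℝ} (hf : Continuous f) (x : SG q) :
    ∫ y, greenTerm q 0 x y * f y ∂(mu q) = ∑ k, gcoef q f k * mid q k x := by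
  have h : ∀ y, greenTerm q 0 x y * f y = ∑ k, ∑ l,
      ((if k = l then 9 / 50 else 3 / 50) * mid q k x) * (mid q l y * f y) := by
    intro y
    rw [greenTerm_zero, Finset.sum_mul]
    refine Finset.sum_congr rfl fun k _ => ?_
    rw [Finset.sum_mul]
    exact Finset.sum_congr rfl fun l _ => by ring
  have hi : ∀ k l, Integrable (fun y => ((if k = l then 9 / 50 else 3 / 50) * mid q k x) *
      (mid q l y * f y)) (mu q) := fun k l =>
    (integrable_of_continuous ((continuous_mid l).mul hf)).const_mul _
  simp only [h]
  rw [integral_finsetSum _ fun k _ => integrable_finsetSum _ fun l _ => hi k l]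
  refine Finset.sum_congr rfl fun k _ => ?_
  rw [integral_finsetSum _ fun l _ => hi k l, gcoef, Finset.sum_mul]
  refine Finset.sum_congr rfl fun l _ => ?_
  rw [integral_const_mul, midInt]
  ring

theorem continuous_greenTerm_zero (x : SG q) : Continuous (greenTerm q 0 x) :=
  continuous_finsetSum _ fun _ _ => continuous_finsetSum _ fun _ hz' =>
    continuous_const.mul (isTent_psi hz').1

/-- Green's operator is the solution operator of the Dirichlet problem. -/
theorem integral_green {f : SG q → ℝ} (hf : Continuous f) (x : SG q) :
    ∫ y, green q x y * f y ∂(mu q) = sol q f x := by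
  obtain ⟨C, hC⟩ := (isCompact_range (continuous_green (q := q))).isBounded.exists_norm_le
  refine eq_sol (T := fun f x => ∫ y, green q x y * f y ∂(mu q)) (C := C) ?_ ?_ hf x
  · intro f hf i x
    have hg := continuous_greenTerm_zero (F q i x)
    rw [integral_self_similar (f := fun y => green q (F q i x) y * f y)
      ((continuous_green_right _).mul hf)]
    have h1 := integral_self_similar (f := fun y => greenTerm q 0 (F q i x) y * f y) (hg.mul hf)
    rw [integral_greenTerm_zero hf, sum_mid_F] at h1
    rw [show harm q (gval q f i) x = _ from h1]
    -- The part of level zero reproduces the harmonic function with values `gcoef`. The remaining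
    -- kernel contributes only on the cell of `x`, with factor `3/5` from the kernel and `1/3` from
    -- the measure, that is `1/5`.
    have h2 : ∀ j, ∫ y, green q (F q i x) (F q j y) * f (F q j y) ∂(mu q) =
        ∫ y, greenTerm q 0 (F q i x) (F q j y) * f (F q j y) ∂(mu q) +
        if i = j then 3 / 5 * ∫ y, green q x y * f (F q i y) ∂(mu q) else 0 := by
      intro j
      have hint := integrable_of_continuous
        (f := fun y => greenTerm q 0 (F q i x) (F q j y) * f (F q j y))
        ((hg.comp (continuous_F j)).mul (hf.comp (continuous_F j)))
      simp only [green_F, add_mul]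
      split_ifs with hij
      · subst hij
        simp only [mul_assoc]
        rw [integral_add hint, integral_const_mul]
        exact (integrable_of_continuous ((continuous_green_right x).mul
          (hf.comp (continuous_F i)))).const_mul _
      · simp
    simp only [h2, Finset.sum_add_distrib, Finset.sum_ite_eq, Finset.mem_univ, if_true]
    ring
  · intro f hf B hB x
    have hb : ∀ y, ‖green q x y * f y‖ ≤ C * B := by
      intro y
      rw [norm_mul]
      have h1 : ‖green q x y‖ ≤ C := hC _ ⟨(x, y), rfl⟩
      exact mul_le_mul h1 (hB y) (norm_nonneg _) ((norm_nonneg _).trans h1)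
    simpa using norm_integral_le_of_norm_le_const (μ := mu q) (Eventually.of_forall hb)

/-- Green's operator is symmetric. -/
theorem ip_sol {f g : SG q → ℝ} (hf : Continuous f) (hg : Continuous g) :
    ip q (sol q f) g = ip q f (sol q g) := by
  unfold ip
  simp only [← integral_green hf, ← integral_green hg, ← integral_mul_const, ← integral_const_mul]
  rw [integral_integral_swap]
  · simp only [green_symm]
    refine integral_congr_ae (Eventually.of_forall fun x => integral_congr_ae
      (Eventually.of_forall fun y => ?_))
    simp only
    rw [green_symm]
    ring
  · have hc : Continuous (Function.uncurry fun x y => green q x y * f y * g x) :=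
      (continuous_green.mul (hf.comp continuous_snd)).mul (hg.comp continuous_fst)
    exact (BoundedContinuousFunction.mkOfCompact ⟨_, hc⟩).integrable ((mu q).prod (mu q))

end

section

variable {q : Fin 3 → Plane}

/-! ### Derivatives at `q_0` -/

/-- The difference of level `m` that approximates the tangential derivative at `q_0`. -/
def tdiff (q : Fin 3 → Plane) (m : ℕ) (u : SG q → ℝ) : ℝ :=
  u ((F q 0)^[m] (bdry q 1)) - u ((F q 0)^[m] (bdry q 2))

theorem tdiff_succ (m : ℕ) (u : SG q → ℝ) :
    tdiff q (m + 1) u = tdiff q m (fun x => u (F q 0 x)) := by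
  simp only [tdiff, Function.iterate_succ_apply']

theorem hasNormalDeriv_iff {u : SG q → ℝ} {n : Fin 3} {a : ℝ} : HasNormalDeriv q u n a ↔
    Tendsto (fun m : ℕ => (5 / 3 : ℝ) ^ m * ndiff q m u n) atTop (𝓝 a) := Iff.rfl

theorem hasTangentialDeriv_iff {u : SG q → ℝ} {a : ℝ} : HasTangentialDeriv q u 0 a ↔
    Tendsto (fun m : ℕ => (5 : ℝ) ^ m * tdiff q m u) atTop (𝓝 a) := Iff.rfl

theorem HasNormalDeriv.sub_smul {u v : SG q → ℝ} {n : Fin 3} {a b : ℝ} (c : ℝ)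
    (hu : HasNormalDeriv q u n a) (hv : HasNormalDeriv q v n b) :
    HasNormalDeriv q (fun x => u x - c * v x) n (a - c * b) := by
  rw [hasNormalDeriv_iff] at *
  refine (hu.sub (hv.const_mul c)).congr fun m => ?_
  unfold ndiff
  ring

theorem HasTangentialDeriv.sub_smul {u v : SG q → ℝ} {a b : ℝ} (c : ℝ)
    (hu : HasTangentialDeriv q u 0 a) (hv : HasTangentialDeriv q v 0 b) :
    HasTangentialDeriv q (fun x => u x - c * v x) 0 (a - c * b) := by
  rw [hasTangentialDeriv_iff] at *
  refine (hu.sub (hv.const_mul c)).congr fun m => ?_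
  unfold tdiff
  ring

theorem IsMonomial.lap {j i : ℕ} {u : SG q → ℝ} (h : IsMonomial q 0 (j + 1) i u) :
    IsMonomial q 0 j i (lap q u) := by
  refine ⟨⟨fun m hm => h.1.1 (m + 1) (by omega), h.1.2⟩, fun m hm => ?_⟩
  have := h.2 (m + 1) (by omega)
  simpa only [Function.iterate_succ_apply, add_left_inj] using this

/-! ### Explicit construction of the monomials. -/

/-- The parity of the monomials `P_{j2}` (even) and `P_{j3}` (odd) under the reflection. -/
def parity (i : ℕ) : ℝ := if i = 2 then 1 else -1

/-- The boundary values of `P_{02}` and of `P_{03}`. -/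
def initVal (i : ℕ) : Fin 3 → ℝ := if i = 2 then ![0, -1 / 2, -1 / 2] else ![0, 1 / 2, -1 / 2]

theorem initVal_zero (i : ℕ) : initVal i 0 = 0 := by
  unfold initVal
  split_ifs <;> rfl

/-- The normal (for `i = 2`) or tangential derivative at `q_0` of the solution of `Δ u = f` with
zero boundary values. -/
def derivCoeff (q : Fin 3 → Plane) (i : ℕ) (f : SG q → ℝ) : ℝ :=
  if i = 2 then harmInt q f 0
  else limUnder atTop fun m : ℕ => (5 : ℝ) ^ m * tdiff q m (fun x => -sol q f x)

/-- The monomials `P_{ji}` for `i = 2, 3`. -/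
def mono (q : Fin 3 → Plane) (i : ℕ) : ℕ → SG q → ℝ
  | 0 => harm q (initVal i)
  | j + 1 => fun x => -sol q (mono q i j) x - derivCoeff q i (mono q i j) * harm q (initVal i) x

theorem mono_zero (i : ℕ) : mono q i 0 = harm q (initVal i) := rfl

theorem mono_succ (i j : ℕ) : mono q i (j + 1) = fun x =>
    -sol q (mono q i j) x - derivCoeff q i (mono q i j) * harm q (initVal i) x := rfl

variable [Equilateral q]

theorem hasNormalDeriv_harm (a : Fin 3 → ℝ) (n : Fin 3) :
    HasNormalDeriv q (harm q a) n (2 * a n - a (n + 1) - a (n - 1)) := by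
  rw [hasNormalDeriv_iff]
  refine tendsto_const_nhds.congr fun m => ?_
  rw [ndiff_harm, ← mul_assoc, ← mul_pow]
  norm_num

theorem tdiff_harm (m : ℕ) (a : Fin 3 → ℝ) : tdiff q m (harm q a) = (1 / 5) ^ m * (a 1 - a 2) := by
  induction m generalizing a with
  | zero => simp [tdiff, harm_bdry]
  | succ m ih =>
    rw [tdiff_succ]
    simp only [harm_F]
    rw [ih, pow_succ]
    simp [hext, fin3_arith]
    ring

theorem hasTangentialDeriv_harm (a : Fin 3 → ℝ) :
    HasTangentialDeriv q (harm q a) 0 (a 1 - a 2) := by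
  rw [hasTangentialDeriv_iff]
  refine tendsto_const_nhds.congr fun m => ?_
  rw [tdiff_harm, ← mul_assoc, ← mul_pow]
  norm_num

/-- Divide `ndiff_sol` by `3^m`: the local average in it is bounded, so it disappears in the limit.
-/
theorem hasNormalDeriv_sol {f : SG q → ℝ} (hf : Continuous f) (n : Fin 3) :
    HasNormalDeriv q (fun x => -sol q f x) n (harmInt q f n) := by
  obtain ⟨B, hB⟩ := exists_abs_le hf
  rw [hasNormalDeriv_iff]
  have h : ∀ m : ℕ, (5 / 3 : ℝ) ^ m * ndiff q m (fun x => -sol q f x) n =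
      harmInt q f n - (1 / 3) ^ m * harmInt q (fun x => f ((F q n)^[m] x)) n := by
    intro m
    have h1 := ndiff_sol hf m n
    have h2 : ndiff q m (fun x => -sol q f x) n = -ndiff q m (sol q f) n := by
      unfold ndiff
      ring
    have h3 : (1 / 3 : ℝ) ^ m * 3 ^ m = 1 := by rw [← mul_pow]; norm_num
    rw [h2, show (5 / 3 : ℝ) = 1 / 3 * 5 by norm_num, mul_pow, mul_assoc, mul_neg, h1]
    linear_combination harmInt q f n * h3
  simp only [h]
  have hz : Tendsto (fun m : ℕ => (1 / 3 : ℝ) ^ m * harmInt q (fun x => f ((F q n)^[m] x)) n)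
      atTop (𝓝 0) := by
    refine (tendsto_pow_atTop_nhds_zero_of_lt_one (by norm_num)
      (by norm_num)).zero_mul_isBoundedUnder_le ⟨B / 3, ?_⟩
    rw [eventually_map]
    refine Eventually.of_forall fun m => ?_
    have hm := harmInt_mem (f := fun x => f ((F q n)^[m] x)) (hf.comp (continuous_iterate_F n m))
      (fun x => abs_le.mp (hB _)) n
    simp only [Function.comp_apply, Real.norm_eq_abs]
    exact abs_le.mpr ⟨by linarith [hm.1], hm.2⟩
  simpa using hz.const_sub (harmInt q f n)

/-- With value zero at `q_0`, the contraction in `hext_sub_le` is a contraction of the supremum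
bound itself. -/
theorem abs_harm_iterate_le {a : Fin 3 → ℝ} {B : ℝ} (h0 : a 0 = 0) (h : ∀ j, |a j| ≤ B) (k : ℕ)
    (x : SG q) : |harm q a ((F q 0)^[k] x)| ≤ B * (3 / 5) ^ k := by
  induction k generalizing a B with
  | zero => simpa using abs_harm_le h x
  | succ k ih =>
    rw [Function.iterate_succ_apply', harm_F]
    have := ih (a := hext 0 a) (B := B * (3 / 5)) (by rw [hext_self, h0]) fun j => by
      have := hext_sub_le (fun j => abs_le.mp (h j)) 0 j
      rw [h0] at this
      exact abs_le.mpr ⟨by linarith, by linarith⟩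
    rw [pow_succ']
    linarith

/-- The constant `C = 5/2` balances the recursion `1 + C / 5 = (3/5) * C`, where `1` is the harmonic
part. -/
theorem abs_sol_iterate_le {f : SG q → ℝ} (hf : Continuous f) {B : ℝ} (h : ∀ x, |f x| ≤ B)
    (k : ℕ) (x : SG q) : |sol q f ((F q 0)^[k] x)| ≤ 5 / 2 * B * (3 / 5) ^ k := by
  induction k generalizing f with
  | zero =>
    have h1 := abs_sol_le hf h x
    have hB : 0 ≤ B := (abs_nonneg _).trans (h x)
    simp only [Function.iterate_zero, id_eq, pow_zero, mul_one]
    linarith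
  | succ k ih =>
    rw [Function.iterate_succ_apply', sol_F hf, pow_succ]
    have h1 := abs_harm_iterate_le (gval_self f 0) (abs_gval_le h 0) k x
    have h2 := ih (f := fun y => f (F q 0 y)) (hf.comp (continuous_F 0)) fun y => h _
    refine (abs_add_le _ _).trans ?_
    rw [abs_mul, abs_of_pos (by norm_num : (0 : ℝ) < 1 / 5)]
    linarith

/-- Harmonic tangential differences and the recursive part of `sol` both scale by exactly `1/5`, so
after multiplication by `5^m` each level adds one term that no longer changes. The tangential
derivative becomes a series. -/
theorem tdiff_sol {f : SG q → ℝ} (hf : Continuous f) (m : ℕ) : 5 ^ m * tdiff q m (sol q f) =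
    ∑ k ∈ Finset.range m, 5 * (gval q (fun x => f ((F q 0)^[k] x)) 0 1 -
      gval q (fun x => f ((F q 0)^[k] x)) 0 2) := by
  induction m generalizing f with
  | zero => simp [tdiff, sol_bdry hf]
  | succ m ih =>
    rw [tdiff_succ, Finset.sum_range_succ']
    simp only [sol_F hf, Function.iterate_succ_apply']
    rw [← ih (f := fun y => f (F q 0 y)) (hf.comp (continuous_F 0))]
    have e : tdiff q m (fun x => harm q (gval q f 0) x + 1 / 5 * sol q (fun y => f (F q 0 y)) x) =
        tdiff q m (harm q (gval q f 0)) + 1 / 5 * tdiff q m (sol q fun y => f (F q 0 y)) := by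
      unfold tdiff
      ring
    have e5 : (5 : ℝ) ^ m * (1 / 5) ^ m = 1 := by rw [← mul_pow]; norm_num
    rw [e, tdiff_harm, pow_succ]
    simp only [Function.iterate_zero, id_eq]
    linear_combination 5 * (gval q f 0 1 - gval q f 0 2) * e5

/-- The decay of `f` towards `q_0` bounds the midpoint values of the rescaled functions
geometrically and makes the series of `tdiff_sol` summable. -/
theorem exists_hasTangentialDeriv_sol {f : SG q → ℝ} (hf : Continuous f) {C : ℝ}
    (h : ∀ k x, |f ((F q 0)^[k] x)| ≤ C * (3 / 5) ^ k) :
    ∃ t, HasTangentialDeriv q (fun x => -sol q f x) 0 t := by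
  have hs : Summable fun k : ℕ => 5 * (gval q (fun x => f ((F q 0)^[k] x)) 0 1 -
      gval q (fun x => f ((F q 0)^[k] x)) 0 2) := by
    refine Summable.of_norm_bounded (g := fun k : ℕ => 10 * C * (3 / 5 : ℝ) ^ k)
      ((summable_geometric_of_lt_one (by norm_num) (by norm_num)).mul_left _) fun k => ?_
    have h1 := abs_gval_le (h k) 0 1
    have h2 := abs_gval_le (h k) 0 2
    have h3 := abs_sub (gval q (fun x => f ((F q 0)^[k] x)) 0 1)
      (gval q (fun x => f ((F q 0)^[k] x)) 0 2)
    rw [Real.norm_eq_abs, abs_mul, abs_of_pos (by norm_num : (0 : ℝ) < 5)]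
    linarith
  refine ⟨-_, hasTangentialDeriv_iff.mpr (hs.hasSum.tendsto_sum_nat.neg.congr fun m => ?_)⟩
  rw [← tdiff_sol hf]
  unfold tdiff
  ring

/-! ### Uniqueness of monomials -/

/-- The difference is harmonic, with boundary values `c` satisfying `c 0 = 0`, `c 1 + c 2 = 0` and
`c 1 - c 2 = 0`. -/
theorem HasLaplacian.eq_of_jet {u v f : SG q → ℝ} (hu : HasLaplacian q u f)
    (hv : HasLaplacian q v f) (h0 : u (bdry q 0) = v (bdry q 0)) {a b : ℝ}
    (hun : HasNormalDeriv q u 0 a) (hvn : HasNormalDeriv q v 0 a)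
    (hut : HasTangentialDeriv q u 0 b) (hvt : HasTangentialDeriv q v 0 b) : u = v := by
  have hw := hu.sub (hv.smul 1)
  simp only [one_mul, sub_self] at hw
  have hn := hun.sub_smul 1 hvn
  have ht := hut.sub_smul 1 hvt
  simp only [one_mul, sub_self] at hn ht
  have he := eq_harm hw
  set c : Fin 3 → ℝ := fun j => u (bdry q j) - v (bdry q j) with hc
  rw [he] at hn ht
  have e0 : c 0 = 0 := sub_eq_zero.mpr h0
  have e1 := tendsto_nhds_unique hn (hasNormalDeriv_harm c 0)
  have e2 := tendsto_nhds_unique ht (hasTangentialDeriv_harm c)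
  simp only [zero_add, fin3_arith, e0] at e1
  have hc0 : c = 0 := by
    funext j
    fin_cases j
    · exact e0
    · simp only [Fin.mk_one, Pi.zero_apply]; linarith
    · simp only [Fin.reduceFinMk, Pi.zero_apply]; linarith
  funext x
  have := congrFun he x
  rw [hc0, harm_zero] at this
  exact sub_eq_zero.mp this

/-- Induction on degree: the Laplacians are monomials of lower degree, hence equal, and the data at
`q_0` fix the remaining harmonic freedom. -/
theorem IsMonomial.unique {j i : ℕ} {u v : SG q → ℝ} (hu : IsMonomial q 0 j i u)
    (hv : IsMonomial q 0 j i v) : u = v := by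
  have key : ∀ {j : ℕ} {u v : SG q → ℝ}, IsMonomial q 0 j i u → IsMonomial q 0 j i v →
      SierpinskiGasket.lap q u = SierpinskiGasket.lap q v → u = v := by
    intro j u v hu hv he
    have hLu := (hu.1.1 0 (Nat.zero_le j)).hasLaplacian
    have hLv := (hv.1.1 0 (Nat.zero_le j)).hasLaplacian
    obtain ⟨a1, a2, a3⟩ := hu.2 0 (Nat.zero_le j)
    obtain ⟨b1, b2, b3⟩ := hv.2 0 (Nat.zero_le j)
    simp only [Function.iterate_zero, id_eq] at hLu hLv a1 a2 a3 b1 b2 b3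
    rw [← he] at hLv
    exact hLu.eq_of_jet hLv (a1.trans b1.symm) a2 b2 a3 b3
  induction j generalizing u v with
  | zero =>
    exact key hu hv (by
      have h1 := hu.1.2
      have h2 := hv.1.2
      rw [zero_add, Function.iterate_one] at h1 h2
      rw [h1, h2])
  | succ j ih => exact key hu hv (ih hu.lap hv.lap)

/-! ### The monomials -/

theorem continuous_mono (i j : ℕ) : Continuous (mono q i j) := by
  induction j with
  | zero => exact continuous_harm _
  | succ j ih => exact (continuous_sol ih).neg.sub ((continuous_harm _).const_mul _)

theorem hasLaplacian_mono_zero (i : ℕ) : HasLaplacian q (mono q i 0) (fun _ => 0) :=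
  hasLaplacian_harm _

theorem hasLaplacian_mono_succ (i j : ℕ) : HasLaplacian q (mono q i (j + 1)) (mono q i j) := by
  have h := (hasLaplacian_sol (continuous_mono (q := q) i j)).sub
    ((hasLaplacian_harm (initVal i)).smul (derivCoeff q i (mono q i j)))
  rw [mono_succ]
  simpa using h

theorem mono_bdry_zero (i j : ℕ) : mono q i j (bdry q 0) = 0 := by
  cases j with
  | zero => rw [mono, harm_bdry, initVal_zero]
  | succ j =>
    simp only [mono, sol_bdry (continuous_mono i j), harm_bdry, initVal_zero]
    ring

theorem harm_refl (a : Fin 3 → ℝ) (x : SG q) :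
    harm q a (refl q x) = harm q (fun j => a (Equiv.swap 1 2 j)) x := by
  refine congrFun (HasLaplacian.eq_of_bdry (hasLaplacian_harm a).refl
    (hasLaplacian_harm fun j => a (Equiv.swap 1 2 j)) fun i => ?_) x
  rw [refl_bdry, harm_bdry, harm_bdry]

theorem sol_refl {f : SG q → ℝ} (hf : Continuous f) {c : ℝ} (h : ∀ x, f (refl q x) = c * f x)
    (x : SG q) : sol q f (refl q x) = c * sol q f x := by
  have h1 := (hasLaplacian_sol hf).refl
  have h2 := (hasLaplacian_sol hf).smul c
  rw [show (fun x => f (refl q x)) = fun x => c * f x from funext h] at h1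
  have := congrFun (h1.eq_of_bdry h2 fun i => by rw [refl_bdry, sol_bdry hf, sol_bdry hf]; simp) x
  linarith

/-- The initial harmonic function has this parity, and `sol` preserves it by uniqueness for the
Dirichlet problem. The derivative at `q_0` of the opposite parity then vanishes at every finite
level. -/
theorem mono_refl (i j : ℕ) (x : SG q) : mono q i j (refl q x) = parity i * mono q i j x := by
  have h0 : ∀ x, harm q (initVal i) (refl q x) = parity i * harm q (initVal i) x := by
    intro x
    rw [harm_refl, ← harm_smul]
    congr 1
    funext j
    have e0 : (Equiv.swap (1 : Fin 3) 2) 0 = 0 := by decide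
    have e1 : (Equiv.swap (1 : Fin 3) 2) 1 = 2 := by decide
    have e2 : (Equiv.swap (1 : Fin 3) 2) 2 = 1 := by decide
    unfold initVal parity
    fin_cases j <;> split_ifs <;> simp [e0, e1, e2] <;> norm_num
  induction j generalizing x with
  | zero => exact h0 x
  | succ j ih =>
    simp only [mono, h0, sol_refl (continuous_mono i j) ih]
    ring

theorem refl_iterate_F_zero (m : ℕ) (x : SG q) :
    refl q ((F q 0)^[m] x) = (F q 0)^[m] (refl q x) := by
  have e0 : (Equiv.swap (1 : Fin 3) 2) 0 = 0 := by decide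
  induction m with
  | zero => rfl
  | succ m ih => rw [Function.iterate_succ_apply', refl_F, ih, e0, Function.iterate_succ_apply']

theorem mono_iterate_bdry_two (i j m : ℕ) : mono q i j ((F q 0)^[m] (bdry q 2)) =
    parity i * mono q i j ((F q 0)^[m] (bdry q 1)) := by
  have e1 : (Equiv.swap (1 : Fin 3) 2) 1 = 2 := by decide
  rw [← mono_refl, refl_iterate_F_zero, refl_bdry, e1]

theorem exists_abs_mono_iterate_le (i j : ℕ) :
    ∃ C : ℝ, ∀ k x, |mono q i j ((F q 0)^[k] x)| ≤ C * (3 / 5) ^ k := by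
  have h0 := fun k x => abs_harm_iterate_le (q := q) (initVal_zero i)
    (fun j => abs_le.mpr (exists_bounds (initVal i) j)) k x
  cases j with
  | zero => exact ⟨_, h0⟩
  | succ j =>
    obtain ⟨B, hB⟩ := exists_abs_le (continuous_mono (q := q) i j)
    refine ⟨5 / 2 * B + |derivCoeff q i (mono q i j)| * ∑ n, |initVal i n|, fun k x => ?_⟩
    have h1 := abs_sol_iterate_le (continuous_mono i j) hB k x
    have h2 := mul_le_mul_of_nonneg_left (h0 k x) (abs_nonneg (derivCoeff q i (mono q i j)))
    rw [← abs_mul] at h2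
    refine (abs_sub _ _).trans ?_
    rw [abs_neg]
    linarith

theorem hasNormalDeriv_mono {i : ℕ} (hi : i = 2 ∨ i = 3) (j : ℕ) :
    HasNormalDeriv q (mono q i j) 0 (if j = 0 ∧ i = 2 then 1 else 0) := by
  rcases hi with rfl | rfl
  · have h0 : HasNormalDeriv q (harm q (initVal 2)) 0 1 := by
      convert hasNormalDeriv_harm (q := q) (initVal 2) 0 using 1
      simp [initVal, fin3_arith]
      norm_num
    cases j with
    | zero => simpa [mono_zero] using h0
    | succ j =>
      have h := (hasNormalDeriv_sol (continuous_mono (q := q) 2 j) 0).sub_smul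
        (derivCoeff q 2 (mono q 2 j)) h0
      simpa [mono_succ, derivCoeff] using h
  · simp only [Nat.reduceEqDiff, and_false, if_false]
    rw [hasNormalDeriv_iff]
    refine tendsto_const_nhds.congr fun m => ?_
    have h1 : mono q 3 j ((F q 0)^[m] (bdry q (0 - 1))) =
      parity 3 * mono q 3 j ((F q 0)^[m] (bdry q 1)) := mono_iterate_bdry_two 3 j m
    rw [ndiff, mono_bdry_zero, h1]
    simp [parity]

theorem hasTangentialDeriv_mono {i : ℕ} (hi : i = 2 ∨ i = 3) (j : ℕ) :
    HasTangentialDeriv q (mono q i j) 0 (if j = 0 ∧ i = 3 then 1 else 0) := by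
  rcases hi with rfl | rfl
  · simp only [Nat.reduceEqDiff, and_false, if_false]
    rw [hasTangentialDeriv_iff]
    refine tendsto_const_nhds.congr fun m => ?_
    rw [tdiff, mono_iterate_bdry_two]
    simp [parity]
  · have h0 : HasTangentialDeriv q (harm q (initVal 3)) 0 1 := by
      convert hasTangentialDeriv_harm (q := q) (initVal 3) using 1
      simp [initVal]
      norm_num
    cases j with
    | zero => simpa [mono_zero] using h0
    | succ j =>
      obtain ⟨C, hC⟩ := exists_abs_mono_iterate_le (q := q) 3 j
      obtain ⟨t, ht⟩ := exists_hasTangentialDeriv_sol (continuous_mono (q := q) 3 j) hC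
      -- The `limUnder` in `derivCoeff` is a genuine limit here because `mono q 3 j` decays towards
      -- `q_0`.
      have hlim : derivCoeff q 3 (mono q 3 j) = t := by
        rw [derivCoeff, if_neg (by norm_num)]
        exact (hasTangentialDeriv_iff.mp ht).limUnder_eq
      have h := ht.sub_smul (derivCoeff q 3 (mono q 3 j)) h0
      rw [hlim, mul_one, sub_self] at h
      simpa [mono_succ, hlim] using h

theorem lap_mono_succ (i j : ℕ) : lap q (mono q i (j + 1)) = mono q i j :=
  (hasLaplacian_mono_succ i j).lap_eq

theorem iterate_lap_mono (i k m : ℕ) : (lap q)^[m] (mono q i (k + m)) = mono q i k := by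
  induction m with
  | zero => rfl
  | succ m ih => rw [Function.iterate_succ_apply, ← add_assoc, lap_mono_succ, ih]

/-- Each Laplacian lowers the index by one, so only the value and the two derivatives of every `mono
q i k` at `q_0` need checking. -/
theorem isMonomial_mono {i : ℕ} (hi : i = 2 ∨ i = 3) (j : ℕ) :
    IsMonomial q 0 j i (mono q i j) := by
  have hit : ∀ m ≤ j, (lap q)^[m] (mono q i j) = mono q i (j - m) := by
    intro m hm
    have := iterate_lap_mono (q := q) i (j - m) m
    rwa [Nat.sub_add_cancel hm] at this
  refine ⟨⟨fun m hm => ?_, ?_⟩, fun m hm => ?_⟩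
  · rw [hit m hm]
    cases j - m with
    | zero => exact ⟨_, hasLaplacian_mono_zero i⟩
    | succ k => exact ⟨_, hasLaplacian_mono_succ i k⟩
  · rw [Function.iterate_succ_apply', hit j le_rfl, Nat.sub_self]
    exact (hasLaplacian_mono_zero i).lap_eq
  · rw [hit m hm]
    have hm' : j - m = 0 ↔ m = j := by omega
    refine ⟨?_, ?_, ?_⟩
    · rw [mono_bdry_zero, if_neg]
      omega
    · have := hasNormalDeriv_mono (q := q) hi (j - m)
      simpa only [hm'] using this
    · have := hasTangentialDeriv_mono (q := q) hi (j - m)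
      simpa only [hm'] using this

theorem monomial_eq {i : ℕ} (hi : i = 2 ∨ i = 3) (j : ℕ) : monomial q 0 j i = mono q i j :=
  (Classical.epsilon_spec (p := IsMonomial q 0 j i) ⟨_, isMonomial_mono hi j⟩).unique
    (isMonomial_mono hi j)

end

section

variable {q : Fin 3 → Plane}

/-! ### The inner product -/

theorem ip_comm (u v : SG q → ℝ) : ip q u v = ip q v u := by
  unfold ip
  simp only [mul_comm]

theorem ip_add_left {u v w : SG q → ℝ} (hu : Continuous u) (hv : Continuous v)
    (hw : Continuous w) : ip q (u + v) w = ip q u w + ip q v w := by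
  unfold ip
  simp only [Pi.add_apply, add_mul]
  exact integral_add (integrable_of_continuous (hu.mul hw)) (integrable_of_continuous (hv.mul hw))

theorem ip_smul_left (c : ℝ) (u v : SG q → ℝ) : ip q (c • u) v = c * ip q u v := by
  unfold ip
  rw [← integral_const_mul]
  simp only [Pi.smul_apply, smul_eq_mul, mul_assoc]

theorem ip_smul_right (c : ℝ) (u v : SG q → ℝ) : ip q u (c • v) = c * ip q u v := by
  rw [ip_comm, ip_smul_left, ip_comm]

theorem ip_neg_left (u v : SG q → ℝ) : ip q (-u) v = -ip q u v := by
  have := ip_smul_left (-1) u v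
  simpa using this

theorem ip_self_pos {u : SG q → ℝ} (hu : Continuous u) (h : u ≠ 0) : 0 < ip q u u := by
  refine lt_of_le_of_ne (integral_nonneg fun x => mul_self_nonneg (u x)) fun h0 => h ?_
  funext x
  exact mul_self_eq_zero.mp
    (integral_nonneg_eq_zero (hu.mul hu) (fun x => mul_self_nonneg (u x)) h0.symm x)

/-! ### Spaces of polynomials -/

/-- The span of the first `n` monomials. -/
def polys (q : Fin 3 → Plane) (i n : ℕ) : Submodule ℝ (SG q → ℝ) :=
  Submodule.span ℝ (mono q i '' Set.Iio n)

/-- The orthogonal polynomials built from the monomials. -/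
def orth (q : Fin 3 → Plane) (i : ℕ) : ℕ → SG q → ℝ := gramSchmidtSeq q (mono q i)

theorem polys_mono (i : ℕ) : Monotone (polys q i) := fun _ _ h =>
  Submodule.span_mono (Set.image_mono (Set.Iio_subset_Iio h))

theorem mono_mem_polys (i : ℕ) {j n : ℕ} (h : j < n) : mono q i j ∈ polys q i n :=
  Submodule.subset_span ⟨j, h, rfl⟩

theorem orth_eq (i j : ℕ) : orth q i j = mono q i j - ∑ l : Fin j,
    (ip q (mono q i j) (orth q i l) / ip q (orth q i l) (orth q i l)) • orth q i l := by
  funext x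
  rw [orth, gramSchmidtSeq]
  simp

/-- The orthogonal polynomials stay monic in the monomial basis; this later identifies the entry
next to the diagonal as a ratio of norms. -/
theorem orth_sub_mono_mem (i j : ℕ) : orth q i j - mono q i j ∈ polys q i j := by
  induction j using Nat.strong_induction_on with
  | _ j ih =>
    rw [orth_eq, sub_sub_cancel_left]
    refine Submodule.neg_mem _ (Submodule.sum_mem _ fun l _ => Submodule.smul_mem _ _ ?_)
    have h1 := polys_mono i l.2.le (ih l l.2)
    have h2 := Submodule.add_mem _ h1 (mono_mem_polys (q := q) i l.2)
    rwa [sub_add_cancel] at h2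

theorem orth_mem_polys (i : ℕ) {j n : ℕ} (h : j < n) : orth q i j ∈ polys q i n := by
  have h1 := Submodule.add_mem _ (polys_mono i h.le (orth_sub_mono_mem (q := q) i j))
    (mono_mem_polys (q := q) i h)
  rwa [sub_add_cancel] at h1

theorem polys_le_span_orth (i n : ℕ) :
    polys q i n ≤ Submodule.span ℝ (orth q i '' Set.Iio n) := by
  refine Submodule.span_le.mpr ?_
  rintro _ ⟨j, hj, rfl⟩
  have h : mono q i j = orth q i j + ∑ l : Fin j,
      (ip q (mono q i j) (orth q i l) / ip q (orth q i l) (orth q i l)) • orth q i l := by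
    conv_rhs => rw [orth_eq]
    rw [sub_add_cancel]
  rw [h]
  exact Submodule.add_mem _ (Submodule.subset_span ⟨j, hj, rfl⟩)
    (Submodule.sum_mem _ fun l _ => Submodule.smul_mem _ _
      (Submodule.subset_span ⟨l, lt_trans l.2 hj, rfl⟩))

/-- The orthonormal polynomials. -/
def onp (q : Fin 3 → Plane) (i j : ℕ) : SG q → ℝ :=
  (√(ip q (orth q i j) (orth q i j)))⁻¹ • orth q i j

theorem onp_mem_polys (i : ℕ) {j n : ℕ} (h : j < n) : onp q i j ∈ polys q i n :=
  Submodule.smul_mem _ _ (orth_mem_polys i h)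

theorem neg_sol_mono_sub_mem (i j : ℕ) :
    -sol q (mono q i j) - mono q i (j + 1) ∈ polys q i (j + 1) := by
  have h : -sol q (mono q i j) - mono q i (j + 1) =
      derivCoeff q i (mono q i j) • mono q i 0 := by
    funext x
    simp [mono_succ, mono_zero]
  rw [h]
  exact Submodule.smul_mem _ _ (mono_mem_polys i (Nat.succ_pos j))

theorem ip_sum_left {ι : Type*} (s : Finset ι) {u : ι → SG q → ℝ} {v : SG q → ℝ}
    (hu : ∀ l ∈ s, Continuous (u l)) (hv : Continuous v) :
    ip q (∑ l ∈ s, u l) v = ∑ l ∈ s, ip q (u l) v := by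
  unfold ip
  simp only [Finset.sum_apply, Finset.sum_mul]
  exact integral_finsetSum s fun l hl => integrable_of_continuous ((hu l hl).mul hv)

variable [Equilateral q]

theorem continuous_of_mem_polys {i n : ℕ} {v : SG q → ℝ} (h : v ∈ polys q i n) :
    Continuous v := by
  induction h using Submodule.span_induction with
  | mem v hv =>
    obtain ⟨j, -, rfl⟩ := hv
    exact continuous_mono i j
  | zero => exact continuous_const
  | add u v _ _ hu hv => exact hu.add hv
  | smul c v _ hv => exact hv.const_smul c

theorem continuous_orth (i j : ℕ) : Continuous (orth q i j) :=
  continuous_of_mem_polys (orth_mem_polys i (Nat.lt_succ_self j))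

theorem exists_hasLaplacian_mem {i n : ℕ} {v : SG q → ℝ} (h : v ∈ polys q i (n + 1)) :
    ∃ f ∈ polys q i n, HasLaplacian q v f := by
  induction h using Submodule.span_induction with
  | mem v hv =>
    obtain ⟨j, hj, rfl⟩ := hv
    cases j with
    | zero => exact ⟨0, Submodule.zero_mem _, hasLaplacian_mono_zero i⟩
    | succ j => exact ⟨_, mono_mem_polys i (Nat.succ_lt_succ_iff.mp hj),
        hasLaplacian_mono_succ i j⟩
  | zero => exact ⟨0, Submodule.zero_mem _, hasLaplacian_zero⟩
  | add u v _ _ hu hv =>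
    obtain ⟨f, hf, hf'⟩ := hu
    obtain ⟨g, hg, hg'⟩ := hv
    exact ⟨f + g, Submodule.add_mem _ hf hg, hf'.add hg'⟩
  | smul c v _ hv =>
    obtain ⟨f, hf, hf'⟩ := hv
    exact ⟨c • f, Submodule.smul_mem _ c hf, hf'.smul c⟩

/-- A relation in degree `j + 1` becomes one in degree `j` under the Laplacian, down to `mono q i
0`, which is nonzero at `q_1`. Positivity of the norms rests on this. -/
theorem mono_notMem_polys {i : ℕ} (j : ℕ) : mono q i j ∉ polys q i j := by
  induction j with
  | zero =>
    intro h
    have h0 : mono q i 0 = 0 := by simpa [polys] using h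
    have h1 := congrFun h0 (bdry q 1)
    rw [mono_zero, harm_bdry, initVal, Pi.zero_apply] at h1
    split_ifs at h1 <;> norm_num at h1
  | succ j ih =>
    intro h
    obtain ⟨f, hf, hL⟩ := exists_hasLaplacian_mem h
    rw [hL.unique (hasLaplacian_mono_succ i j)] at hf
    exact ih hf

theorem ip_orth_self_pos (i j : ℕ) : 0 < ip q (orth q i j) (orth q i j) := by
  refine ip_self_pos (continuous_orth i j) fun h => mono_notMem_polys (q := q) (i := i) j ?_
  have := orth_sub_mono_mem (q := q) i j
  rw [h, zero_sub] at this
  simpa using Submodule.neg_mem _ this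

theorem ip_orth_of_lt {i j l : ℕ} (h : l < j) : ip q (orth q i j) (orth q i l) = 0 := by
  induction j using Nat.strong_induction_on generalizing l with
  | _ j ih =>
    have hcl := continuous_orth (q := q) i l
    set c : Fin j → ℝ := fun k =>
      ip q (mono q i j) (orth q i k) / ip q (orth q i k) (orth q i k) with hc
    have hadd : orth q i j + ∑ k, c k • orth q i k = mono q i j := by
      rw [orth_eq, sub_add_cancel]
    have hcs : Continuous (∑ k, c k • orth q i k) :=
      continuous_of_mem_polys (Submodule.sum_mem _ fun k _ =>
        Submodule.smul_mem _ _ (orth_mem_polys i k.2))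
    have hsum : ip q (∑ k, c k • orth q i k) (orth q i l) = ip q (mono q i j) (orth q i l) := by
      rw [ip_sum_left (u := fun k : Fin j => c k • orth q i k) _
        (fun k _ => (continuous_orth i k).const_smul _) hcl, Finset.sum_eq_single ⟨l, h⟩]
      · rw [ip_smul_left, hc, div_mul_cancel₀ _ (ip_orth_self_pos i l).ne']
      · intro k _ hk
        rw [ip_smul_left]
        rcases lt_or_gt_of_ne (fun e => hk (Fin.ext e) : (k : ℕ) ≠ l) with hkl | hkl
        · rw [ip_comm, ih l h hkl, mul_zero]
        · rw [ih k k.2 hkl, mul_zero]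
      · simp
    have h1 := ip_add_left (continuous_orth (q := q) i j) hcs hcl
    rw [hadd, hsum] at h1
    linarith

theorem ip_orth_of_ne {i j l : ℕ} (h : j ≠ l) : ip q (orth q i j) (orth q i l) = 0 := by
  rcases lt_or_gt_of_ne h with h | h
  · rw [ip_comm, ip_orth_of_lt h]
  · exact ip_orth_of_lt h

/-! ### Orthonormal expansions -/

theorem continuous_onp (i j : ℕ) : Continuous (onp q i j) := (continuous_orth i j).const_smul _

theorem ip_orth_onp_of_ne {i j l : ℕ} (h : j ≠ l) : ip q (orth q i j) (onp q i l) = 0 := by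
  rw [onp, ip_smul_right, ip_orth_of_ne h, mul_zero]

theorem ip_orth_onp_self (i j : ℕ) :
    ip q (orth q i j) (onp q i j) = √(ip q (orth q i j) (orth q i j)) := by
  have h := ip_orth_self_pos (q := q) i j
  rw [onp, ip_smul_right, inv_mul_eq_div, Real.div_sqrt]

theorem eq_sum_onp {i n : ℕ} {v : SG q → ℝ} (h : v ∈ polys q i n) (x : SG q) :
    v x = ∑ l ∈ Finset.range n, ip q v (onp q i l) * onp q i l x := by
  have h' := polys_le_span_orth i n h
  clear h
  have hsub : Submodule.span ℝ (orth q i '' Set.Iio n) ≤ polys q i n := by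
    refine Submodule.span_le.mpr ?_
    rintro _ ⟨j, hj, rfl⟩
    exact orth_mem_polys i hj
  induction h' using Submodule.span_induction with
  | mem v hv =>
    obtain ⟨j, hj, rfl⟩ := hv
    rw [Finset.sum_eq_single j]
    · rw [ip_orth_onp_self, onp, Pi.smul_apply, smul_eq_mul, ← mul_assoc, mul_inv_cancel₀
        (Real.sqrt_pos.mpr (ip_orth_self_pos i j)).ne', one_mul]
    · intro l _ hl
      rw [ip_orth_onp_of_ne hl.symm, zero_mul]
    · intro hj'
      exact absurd (Finset.mem_range.mpr hj) hj'
  | zero =>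
    have : ∀ l, ip q 0 (onp q i l) = 0 := fun l => by simp [ip]
    simp [this]
  | add u v hu hv ihu ihv =>
    rw [Pi.add_apply, ihu, ihv, ← Finset.sum_add_distrib]
    refine Finset.sum_congr rfl fun l _ => ?_
    rw [ip_add_left (continuous_of_mem_polys (hsub hu)) (continuous_of_mem_polys (hsub hv))
      (continuous_onp i l), add_mul]
  | smul c v _ hv =>
    rw [Pi.smul_apply, smul_eq_mul, hv, Finset.mul_sum]
    refine Finset.sum_congr rfl fun l _ => ?_
    rw [ip_smul_left, mul_assoc]

theorem ip_onp_eq_zero {i n l : ℕ} {v : SG q → ℝ} (h : v ∈ polys q i n) (hl : n ≤ l) :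
    ip q v (onp q i l) = 0 := by
  have hv : v = ∑ k ∈ Finset.range n, ip q v (onp q i k) • onp q i k := by
    funext x
    rw [eq_sum_onp h x]
    simp
  rw [hv, ip_sum_left _ (fun k _ => (continuous_onp i k).const_smul _) (continuous_onp i l)]
  refine Finset.sum_eq_zero fun k hk => ?_
  have hkl : k ≠ l := by
    have := Finset.mem_range.mp hk
    omega
  rw [ip_smul_left, onp, ip_smul_left, ip_orth_onp_of_ne hkl, mul_zero, mul_zero]

theorem sol_add {f g : SG q → ℝ} (hf : Continuous f) (hg : Continuous g) :
    sol q (f + g) = sol q f + sol q g := by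
  funext x
  rw [Pi.add_apply, ← integral_green hf, ← integral_green hg, ← integral_green (hf.add hg)]
  simp only [Pi.add_apply, mul_add]
  exact integral_add (integrable_of_continuous ((continuous_green_right x).mul hf))
    (integrable_of_continuous ((continuous_green_right x).mul hg))

theorem sol_smul (c : ℝ) {f : SG q → ℝ} (hf : Continuous f) : sol q (c • f) = c • sol q f := by
  funext x
  rw [Pi.smul_apply, ← integral_green hf, ← integral_green (hf.const_smul c), smul_eq_mul,
    ← integral_const_mul]
  refine integral_congr_ae (Eventually.of_forall fun y => ?_)
  simp only [Pi.smul_apply, smul_eq_mul]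
  ring

theorem neg_sol_mem {i n : ℕ} {v : SG q → ℝ} (h : v ∈ polys q i n) :
    -sol q v ∈ polys q i (n + 1) := by
  induction h using Submodule.span_induction with
  | mem v hv =>
    obtain ⟨j, hj, rfl⟩ := hv
    have hj' : j < n := hj
    have h1 := Submodule.add_mem _ (polys_mono i (by omega : j + 1 ≤ n + 1)
      (neg_sol_mono_sub_mem (q := q) i j)) (mono_mem_polys i (by omega : j + 1 < n + 1))
    rwa [sub_add_cancel] at h1
  | zero =>
    have := sol_smul (q := q) 0 (f := 0) continuous_const
    rw [zero_smul, zero_smul] at this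
    rw [this, neg_zero]
    exact Submodule.zero_mem _
  | add u v hu hv ihu ihv =>
    rw [sol_add (continuous_of_mem_polys hu) (continuous_of_mem_polys hv), neg_add]
    exact Submodule.add_mem _ ihu ihv
  | smul c v hv ih =>
    rw [sol_smul c (continuous_of_mem_polys hv), ← smul_neg]
    exact Submodule.smul_mem _ c ih

/-- The operator takes the leading monomial to the next one with coefficient `1` and everything else
to lower degree, so monic goes to monic. -/
theorem neg_sol_orth_sub_mem (i j : ℕ) :
    -sol q (orth q i j) - orth q i (j + 1) ∈ polys q i (j + 1) := by
  have h0 := orth_sub_mono_mem (q := q) i j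
  have h1 := neg_sol_mem h0
  have h2 := neg_sol_mono_sub_mem (q := q) i j
  have h3 := orth_sub_mono_mem (q := q) i (j + 1)
  have h4 := sol_add (continuous_of_mem_polys h0) (continuous_mono i j)
  rw [sub_add_cancel] at h4
  have e : -sol q (orth q i j) - orth q i (j + 1) = -sol q (orth q i j - mono q i j) +
      (-sol q (mono q i j) - mono q i (j + 1)) - (orth q i (j + 1) - mono q i (j + 1)) := by
    rw [h4]
    abel
  rw [e]
  exact Submodule.sub_mem _ (Submodule.add_mem _ h1 h2) h3

/-! ### The tridiagonal matrix and the summation formula. -/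

/-- The matrix of Green's operator in the orthonormal polynomials. -/
def jac (q : Fin 3 → Plane) (i k l : ℕ) : ℝ := ip q (-sol q (onp q i k)) (onp q i l)

theorem jac_symm (i k l : ℕ) : jac q i k l = jac q i l k := by
  rw [jac, jac, ip_neg_left, ip_neg_left, ip_sol (continuous_onp i k) (continuous_onp i l), ip_comm]

/-- The image of `Q_k` has degree at most `k + 1`, hence is orthogonal to later `Q_l`. With
`jac_symm` the matrix is tridiagonal. -/
theorem jac_eq_zero {i k l : ℕ} (h : k + 1 < l) : jac q i k l = 0 :=
  ip_onp_eq_zero (neg_sol_mem (onp_mem_polys i (Nat.lt_succ_self k))) h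

/-- Modulo lower degree, which `Q_{k+1}` annihilates, the image of the monic `p_k` is `p_{k+1}`;
only the two normalizations remain. -/
theorem jac_succ (i k : ℕ) : jac q i k (k + 1) =
    (√(ip q (orth q i k) (orth q i k)))⁻¹ * √(ip q (orth q i (k + 1)) (orth q i (k + 1))) := by
  have h0 := neg_sol_orth_sub_mem (q := q) i k
  have h1 := ip_add_left (continuous_of_mem_polys h0) (continuous_orth i (k + 1))
    (continuous_onp i (k + 1))
  rw [sub_add_cancel, ip_onp_eq_zero h0 le_rfl, zero_add, ip_orth_onp_self] at h1
  rw [jac]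
  conv_lhs => rw [onp]
  rw [sol_smul _ (continuous_orth i k), ← smul_neg, ip_smul_left, h1]

theorem neg_sol_onp (i : ℕ) {k n : ℕ} (h : k + 1 < n) (x : SG q) :
    -sol q (onp q i k) x = ∑ l ∈ Finset.range n, jac q i k l * onp q i l x :=
  eq_sum_onp (polys_mono i h (neg_sol_mem (onp_mem_polys i (Nat.lt_succ_self k)))) x

theorem hasLaplacian_onp (i k : ℕ) : HasLaplacian q (onp q i k) (lap q (onp q i k)) := by
  obtain ⟨f, -, hf⟩ := exists_hasLaplacian_mem (onp_mem_polys (q := q) i (Nat.lt_succ_self k))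
  exact InDomain.hasLaplacian ⟨f, hf⟩

/-- Apply the Laplacian to both sides of the expansion `neg_sol_onp`; on the left it undoes `-sol`.
-/
theorem onp_eq_sum_lap (i : ℕ) {k n : ℕ} (h : k + 1 < n) (y : SG q) :
    onp q i k y = ∑ l ∈ Finset.range n, jac q i k l * lap q (onp q i l) y := by
  have h1 := hasLaplacian_sol (continuous_onp (q := q) i k)
  rw [show (fun x => -sol q (onp q i k) x) = _ from funext (neg_sol_onp i h)] at h1
  have h2 := HasLaplacian.sum (Finset.range n) fun l _ =>
    (hasLaplacian_onp (q := q) i l).smul (jac q i k l)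
  exact congrFun (h1.unique h2) y

theorem sum_jac_last (i N : ℕ) (a : ℕ → ℝ) :
    ∑ k ∈ Finset.range (N + 1), jac q i k (N + 1) * a k = jac q i N (N + 1) * a N := by
  rw [Finset.sum_eq_single N]
  · intro k hk hkN
    have := Finset.mem_range.mp hk
    rw [jac_eq_zero (by omega), zero_mul]
  · simp

theorem sum_onp_mul_onp (i N : ℕ) (x y : SG q) :
    ∑ k ∈ Finset.range (N + 1), onp q i k x * onp q i k y =
      jac q i N (N + 1) * (onp q i N x * lap q (onp q i (N + 1)) y -
        onp q i (N + 1) x * lap q (onp q i N) y) +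
      ∑ k ∈ Finset.range (N + 1), -sol q (onp q i k) x * lap q (onp q i k) y := by
  -- Expansions up to index `N + 1` suffice for `k ≤ N`. In `h1` and `h2` the square block `k, l ≤
  -- N` is the same double sum, by symmetry of the matrix, and the last column contributes only at
  -- `k = N`.
  have h1 : ∑ k ∈ Finset.range (N + 1), onp q i k x * onp q i k y =
      ∑ k ∈ Finset.range (N + 1), ∑ l ∈ Finset.range (N + 1),
        jac q i k l * onp q i k x * lap q (onp q i l) y +
      jac q i N (N + 1) * (onp q i N x * lap q (onp q i (N + 1)) y) := by
    rw [← sum_jac_last i N fun k => onp q i k x * lap q (onp q i (N + 1)) y,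
      ← Finset.sum_add_distrib]
    refine Finset.sum_congr rfl fun k hk => ?_
    have hk' := Finset.mem_range.mp hk
    rw [onp_eq_sum_lap i (by omega : k + 1 < N + 2) y, Finset.sum_range_succ, mul_add,
      Finset.mul_sum]
    congr 1
    · exact Finset.sum_congr rfl fun l _ => by ring
    · ring
  have h2 : ∑ k ∈ Finset.range (N + 1), -sol q (onp q i k) x * lap q (onp q i k) y =
      ∑ k ∈ Finset.range (N + 1), ∑ l ∈ Finset.range (N + 1),
        jac q i k l * onp q i k x * lap q (onp q i l) y +
      jac q i N (N + 1) * (onp q i (N + 1) x * lap q (onp q i N) y) := by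
    rw [Finset.sum_comm, ← sum_jac_last i N fun k => onp q i (N + 1) x * lap q (onp q i k) y,
      ← Finset.sum_add_distrib]
    refine Finset.sum_congr rfl fun k hk => ?_
    have hk' := Finset.mem_range.mp hk
    rw [neg_sol_onp i (by omega : k + 1 < N + 2) x, Finset.sum_range_succ, add_mul,
      Finset.sum_mul]
    congr 1
    · exact Finset.sum_congr rfl fun l _ => by rw [jac_symm i k l]
    · ring
  rw [h1, h2]
  ring

/-! ### Comparison with the definitions in the statement -/

theorem monicOP_eq {i : ℕ} (hi : i = 2 ∨ i = 3) : monicOP q i = orth q i := by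
  rw [monicOP, orth]
  simp only [monomial_eq hi]

theorem Q_eq {i : ℕ} (hi : i = 2 ∨ i = 3) (j : ℕ) : Q q i j = onp q i j := by
  funext x
  rw [Q, dCoeff, monicOP_eq hi]
  rfl

/-- Both sides are `d_N / d_{N+1}`, the ratio of consecutive norms; the square root needs no sign
discussion because the norms are positive. -/
theorem sqrt_cCoeff_succ {i : ℕ} (hi : i = 2 ∨ i = 3) (N : ℕ) :
    √(cCoeff q i (N + 1)) = jac q i N (N + 1) := by
  have h1 := Real.sqrt_pos.mpr (ip_orth_self_pos (q := q) i N)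
  have h2 := Real.sqrt_pos.mpr (ip_orth_self_pos (q := q) i (N + 1))
  rw [cCoeff, dCoeff, dCoeff, monicOP_eq hi, jac_succ, ← div_pow, Real.sqrt_sq (by positivity),
    div_inv_eq_mul]

theorem fTilde_succ {i : ℕ} (hi : i = 2 ∨ i = 3) (k : ℕ) (x : SG q) :
    fTilde q i (k + 1) x = -sol q (onp q i k) x := by
  rw [← integral_green (continuous_onp i k), ← Q_eq hi]
  rfl

end

end

end SierpinskiGasket

open SierpinskiGasket in
/-- `q_0, q_1, q_2` are the vertices of an equilateral triangle, and the `Q_k` are the orthonormal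
polynomials built from the monomials `P_{j2}` or from the monomials `P_{j3}`. The first five
clauses say that all the objects in the two formulas are well defined. -/
theorem theorem3p7 (q : Fin 3 → Plane) (s : ℝ) (hs : 0 < s)
    (hq : ∀ a b : Fin 3, a ≠ b → dist (q a) (q b) = s)
    (i : ℕ) (hi : i = 2 ∨ i = 3) :
    (∀ j : ℕ, IsMonomial q 0 j i (monomial q 0 j i)) ∧
    (∀ j : ℕ, 0 < ip q (monicOP q i j) (monicOP q i j)) ∧
    (∀ k : ℕ, HasLaplacian q (Q q i k) (lap q (Q q i k))) ∧
    (∀ x y : SG q, Filter.Tendsto (fun M : ℕ => greenPartial q M x y) Filter.atTop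
      (nhds (green q x y))) ∧
    (∀ (k : ℕ) (x : SG q),
      MeasureTheory.Integrable (fun y => green q x y * Q q i k y) (mu q)) ∧
    (∀ (N : ℕ) (x y : SG q),
      K q i N x y =
        Real.sqrt (cCoeff q i (N + 1)) *
          (Q q i N x * lap q (Q q i (N + 1)) y - Q q i (N + 1) x * lap q (Q q i N) y) +
        ∑ k ∈ Finset.range (N + 1), fTilde q i (k + 1) x * lap q (Q q i k) y) ∧
    (∀ (N : ℕ) (x : SG q),
      K q i N x x =
        Real.sqrt (cCoeff q i (N + 1)) *
          (Q q i N x * lap q (Q q i (N + 1)) x - Q q i (N + 1) x * lap q (Q q i N) x) +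
        ∑ k ∈ Finset.range (N + 1), fTilde q i (k + 1) x * lap q (Q q i k) x) := by
  have : Equilateral q := ⟨s, hs, hq⟩
  have hK : ∀ (N : ℕ) (x y : SG q), K q i N x y =
      Real.sqrt (cCoeff q i (N + 1)) *
        (Q q i N x * lap q (Q q i (N + 1)) y - Q q i (N + 1) x * lap q (Q q i N) y) +
      ∑ k ∈ Finset.range (N + 1), fTilde q i (k + 1) x * lap q (Q q i k) y := by
    intro N x y
    simp only [K, Q_eq hi, fTilde_succ hi, sqrt_cCoeff_succ hi]
    exact sum_onp_mul_onp i N x y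
  refine ⟨fun j => ?_, fun j => ?_, fun k => ?_, tendsto_green, fun k x => ?_, hK,
    fun N x => hK N x x⟩
  · rw [monomial_eq hi]
    exact isMonomial_mono hi j
  · rw [monicOP_eq hi]
    exact ip_orth_self_pos i j
  · rw [Q_eq hi]
    exact hasLaplacian_onp i k
  · rw [Q_eq hi]
    exact integrable_of_continuous ((continuous_green_right x).mul (continuous_onp i k))
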